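/- **Model.** Let $(u_i,\mathbf m_i,\mathbf x_i,y_i)$, $i\ge 1$, be i.i.d. with $u_i\in\mathcal U=[\underline u,\overline u]$ (where $\underline u<\overline u$), $\mathbf m_i\in\mathbb R^p$, $\mathbf x_i\in\mathbb R^q$, $y_i\in\mathbb R$, and suppose that $$\mathbf m_i=\boldsymbol\Gamma(u_i)^T\mathbf x_i+\boldsymbol\epsilon_i,$$ where $\boldsymbol\epsilon_i$ has mean $\mathbf 0$ and covariance matrix $\boldsymbol\Sigma_\epsilon$ and is independent of $(\mathbf x_i,u_i)$. Given $(u_i,\mathbf m_i,\mathbf x_i)$, the response $y_i$ has density $c(y,\phi)\exp\{(y\theta-b(\theta))/\phi\}$, $\phi>0$, with respect to a $\sigma$-finite measure on $\mathbb R$, with canonical parameter $\theta=\boldsymbol\alpha_0(u_i)^T\mathbf m_i+\boldsymbol\alpha_1(u_i)^T\mathbf x_i$ in an open interval $\Theta$ of parameters for which this is a probability density. Let $\mathbf b_0,\mathbf b_1,\mathbf B$ be vectors of B-spline basis functions on $\mathcal U$, of fixed degrees, with fixed simple interior knots and with the end points as boundary knots of full multiplicity. On $\mathcal U$ the coefficient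 functions belong to the spline spaces: $\boldsymbol\alpha_0(u)=\{\mathbf I_p\otimes\mathbf b_0(u)^T\}\boldsymbol\alpha_0^*$, $\boldsymbol\alpha_1(u)=\{\mathbf I_q\otimes\mathbf b_1(u)^T\}\boldsymbol\alpha_1^*$, $\boldsymbol\Gamma(u)=\{\mathbf I_q\otimes\mathbf B(u)^T\}\mathbf C$. Put $\mathbf m_i^*=\mathbf m_i\otimes\mathbf b_0(u_i)$, $\mathbf x_i^*=\mathbf x_i\otimes\mathbf b_1(u_i)$, $\mathbf x_i^m=\mathbf x_i\otimes\mathbf B(u_i)$, and let $\mathbf M$ and $\mathbf X^m$ be the matrices with rows $\mathbf m_i^T$ and $\mathbf x_i^{mT}$, $i\le n$. **Estimators.** Let $\hat{\mathbf C}=(\mathbf X^{mT}\mathbf X^m)^{-1}\mathbf X^{mT}\mathbf M$ be the least-squares estimator, and let $(\hat{\boldsymbol\alpha}_0^*,\hat{\boldsymbol\alpha}_1^*)$ be a measurable maximum likelihood estimator, that is, a maximizer of the log-likelihood of $y_1,\dots,y_n$ with predictors $\boldsymbol\alpha_0^{*T}\mathbf m_i^*+\boldsymbol\alpha_1^{*T}\mathbf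 x_i^*\in\Theta$ whenever a maximizer exists (arbitrary otherwise). Put $\hat{\boldsymbol\Gamma}(u)=\{\mathbf I_q\otimes\mathbf B(u)^T\}\hat{\mathbf C}$, $\hat{\boldsymbol\alpha}_0(u)=\{\mathbf I_p\otimes\mathbf b_0(u)^T\}\hat{\boldsymbol\alpha}_0^*$, $\hat{\boldsymbol\beta}(u)=\hat{\boldsymbol\Gamma}(u)\hat{\boldsymbol\alpha}_0(u)$ and $\boldsymbol\beta(u)=\boldsymbol\Gamma(u)\boldsymbol\alpha_0(u)$. **Matrices.** Let $\eta=\boldsymbol\alpha_0^{*T}\mathbf m_1^*+\boldsymbol\alpha_1^{*T}\mathbf x_1^*$, $\boldsymbol\Sigma_{m^*m^*}=\mathrm E\{\mathbf m_1^*\mathbf m_1^{*T}b''(\eta)\}$, $\boldsymbol\Sigma_{m^*x^*}=\boldsymbol\Sigma_{x^*m^*}^T=\mathrm E\{\mathbf m_1^*\mathbf x_1^{*T}b''(\eta)\}$, $\boldsymbol\Sigma_{x^*x^*}=\mathrm E\{\mathbf x_1^*\mathbf x_1^{*T}b''(\eta)\}$, $\boldsymbol\Sigma_{m^*m^*\mid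 x^*}=\boldsymbol\Sigma_{m^*m^*}-\boldsymbol\Sigma_{m^*x^*}\boldsymbol\Sigma_{x^*x^*}^{-1}\boldsymbol\Sigma_{x^*m^*}$ and $\boldsymbol\Sigma_{x^mx^m}=\mathrm E(\mathbf x_1^m\mathbf x_1^{mT})$. **Assumptions.** (C1) $u_i$ has a Lebesgue density on $\mathcal U$ that is bounded away from $0$ and $\infty$. (C2) For some integer $r_1\ge 0$ and $\eta_1\in(0,1]$ with $r_1+\eta_1>1/2$ the $r_1$-th derivatives of all $\alpha_{0j},\alpha_{1l}$ exist and are Hölder of order $\eta_1$ on $\mathcal U$; the same holds for all $\Gamma_{lj}$ with some $r_2,\eta_2$. (C3) $\mathbf x_1,\mathbf m_1$ have finite second moments and the eigenvalues of $\mathrm E(\mathbf x_1\mathbf x_1^T)$ and $\mathrm E(\mathbf m_1\mathbf m_1^T)$ are bounded away from $0$ and $\infty$. (C4) The eigenvalues of $\boldsymbol\Sigma_\epsilon$ are bounded away from $0$ and $\infty$. (C5) $\boldsymbol\Gamma,\boldsymbol\alpha_0,\boldsymbol\alpha_1$ are twice continuously differentiable on $\mathcal U$. (C6) The numbers of basis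 functions are of the same order; here they do not depend on $n$, so this holds automatically. (R1) $\boldsymbol\Sigma_{x^mx^m}$ and $\boldsymbol\Sigma_{x^*x^*}$ are nonsingular. (R2) There is a ball around $(\boldsymbol\alpha_0^*,\boldsymbol\alpha_1^*)$ such that, almost surely, for all $(\mathbf a_0,\mathbf a_1)$ in it, $\mathbf a_0^T\mathbf m_1^*+\mathbf a_1^T\mathbf x_1^*\in\Theta$ and $(\|\mathbf m_1^*\|^2+\|\mathbf x_1^*\|^2)\,b''(\mathbf a_0^T\mathbf m_1^*+\mathbf a_1^T\mathbf x_1^*)\le H$ for one integrable random variable $H$. **Theorem.** For every $u\in\mathcal U$ for which the matrix $\mathrm{Var}\{\hat{\boldsymbol\beta}(u)\}$ below is nonsingular, $$[\mathrm{Var}\{\hat{\boldsymbol\beta}(u)\}]^{-1/2}\{\hat{\boldsymbol\beta}(u)-\boldsymbol\beta(u)\}\overset{D}{\longrightarrow}N(\mathbf 0,\mathbf I_q)\qquad(n\to\infty),$$ where $$\mathrm{Var}\{\hat{\boldsymbol\beta}(u)\}=\frac1n\,\boldsymbol\alpha_0(u)^T\boldsymbol\Sigma_\epsilon\boldsymbol\alpha_0(u)\,\{\mathbf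 I_q\otimes\mathbf B(u)^T\}\boldsymbol\Sigma_{x^mx^m}^{-1}\{\mathbf I_q\otimes\mathbf B(u)\}+\frac{\phi}{n}\,\boldsymbol\Gamma(u)\{\mathbf I_p\otimes\mathbf b_0(u)^T\}\boldsymbol\Sigma_{m^*m^*\mid x^*}^{-1}\{\mathbf I_p\otimes\mathbf b_0(u)\}\boldsymbol\Gamma(u)^T .$$ -/

import Mathlib

open MeasureTheory ProbabilityTheory Filter Set
open scoped Topology Matrix MatrixOrder Kronecker

noncomputable section

namespace GVCMM

/-- A clamped knot sequence on `[lo, hi]`: a degree and finitely many simple interior knots.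
The end points `lo` and `hi` are each repeated `degree + 1` times. -/
structure Knots (lo hi : ℝ) where
  degree : ℕ
  numInterior : ℕ
  interior : Fin numInterior → ℝ
  strictMono_interior : StrictMono interior
  interior_mem : ∀ i, interior i ∈ Ioo lo hi

namespace Knots

variable {lo hi : ℝ}

/-- The number of B-spline basis functions. -/
def dim (t : Knots lo hi) : ℕ := t.numInterior + t.degree + 1

/-- The full knot sequence, indexed from `0`. -/
def knot (t : Knots lo hi) (i : ℕ) : ℝ :=
  if i ≤ t.degree then lo
  else if h : i - (t.degree + 1) < t.numInterior then t.interior ⟨i - (t.degree + 1), h⟩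
  else hi

/-- The Cox–de Boor recursion for the `k`-th B-spline of degree `d` on the knot sequence.
Terms with vanishing denominator are `0`; the last nonempty knot interval is closed at `hi`. -/
def coxDeBoor (t : Knots lo hi) : ℕ → ℕ → ℝ → ℝ
  | 0, k, u =>
      open Classical in
      if t.knot k ≤ u ∧ t.knot k < t.knot (k + 1) ∧
          (u < t.knot (k + 1) ∨ (u = hi ∧ t.knot (k + 1) = hi)) then 1 else 0
  | d + 1, k, u =>
      (u - t.knot k) / (t.knot (k + d + 1) - t.knot k) * coxDeBoor t d k u +
        (t.knot (k + d + 2) - u) / (t.knot (k + d + 2) - t.knot (k + 1)) *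
          coxDeBoor t d (k + 1) u

/-- The vector of B-spline basis functions at the point `u`. -/
def basis (t : Knots lo hi) (u : ℝ) : Fin t.dim → ℝ :=
  fun k => t.coxDeBoor t.degree k u

end Knots

/-- `g` has an `r`-th derivative on `S` which is Hölder of order `η` with constant `K`. -/
def HolderClass (S : Set ℝ) (r : ℕ) (η K : ℝ) (g : ℝ → ℝ) : Prop :=
  (∀ k < r, DifferentiableOn ℝ (iteratedDerivWithin k g S) S) ∧
    ∀ s ∈ S, ∀ t ∈ S,
      |iteratedDerivWithin r g S s - iteratedDerivWithin r g S t| ≤ K * |s - t| ^ η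

/-- All (real) eigenvalues of `S` lie in `[N₁, N₂]` for some `0 < N₁`. -/
def EigenvaluesBounded {r : ℕ} (S : Matrix (Fin r) (Fin r) ℝ) : Prop :=
  ∃ N₁ N₂ : ℝ, 0 < N₁ ∧ ∀ t : ℝ, Module.End.HasEigenvalue (Matrix.toLin' S) t → t ∈ Icc N₁ N₂

/-- The stacked vector `(v₁ wᵀ, …, v_r wᵀ)ᵀ`. -/
def stack {r K : ℕ} (v : Fin r → ℝ) (w : Fin K → ℝ) : Fin r × Fin K → ℝ :=
  fun jk => v jk.1 * w jk.2

/-- The `r × rK` matrix `I_r ⊗ wᵀ`. -/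
def kronRow (r : ℕ) {K : ℕ} (w : Fin K → ℝ) : Matrix (Fin r) (Fin r × Fin K) ℝ :=
  ((1 : Matrix (Fin r) (Fin r) ℝ) ⊗ₖ Matrix.replicateRow Unit w).submatrix (fun l => (l, ())) id

/-- The unknown and known ingredients of the generalized varying coefficient mediation model with
`p` mediators and `q` exposures. -/
structure Model (p q : ℕ) where
  /-- the support of `u` is the interval `[lo, hi]`, and `density` is its Lebesgue density -/
  lo : ℝ
  hi : ℝ
  lo_lt_hi : lo < hi
  density : ℝ → ℝ
  /-- the coefficient functions -/
  α₀ : ℝ → Fin p → ℝ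
  α₁ : ℝ → Fin q → ℝ
  Γ : ℝ → Matrix (Fin q) (Fin p) ℝ
  /-- degrees and knots used for `α₀`, `α₁`, `Γ` -/
  knots₀ : Knots lo hi
  knots₁ : Knots lo hi
  knotsM : Knots lo hi
  /-- the spline coefficients of `α₀`, `α₁`, `Γ` -/
  a₀ : Fin p × Fin knots₀.dim → ℝ
  a₁ : Fin q × Fin knots₁.dim → ℝ
  C : Matrix (Fin q × Fin knotsM.dim) (Fin p) ℝ
  /-- the exponential family `c (y, φ) exp ((y θ - b θ) / φ)`, `θ ∈ Θ`, a density with respect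
  to the measure `ν` -/
  ν : Measure ℝ
  c : ℝ → ℝ → ℝ
  b : ℝ → ℝ
  Θ : Set ℝ
  φ : ℝ

/-- A sequence of observations `(uᵢ, mᵢ, xᵢ, yᵢ)`. -/
structure Data (Ω : Type*) (p q : ℕ) where
  u : ℕ → Ω → ℝ
  m : ℕ → Ω → Fin p → ℝ
  x : ℕ → Ω → Fin q → ℝ
  y : ℕ → Ω → ℝ

section Definitions

variable {Ω : Type*} {p q : ℕ}

/-- The parameter space of the spline coefficients `(α₀*, α₁*)`. -/
abbrev Model.Param (G : Model p q) : Type :=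
  (Fin p × Fin G.knots₀.dim → ℝ) × (Fin q × Fin G.knots₁.dim → ℝ)

/-- The exponential family density. -/
def Model.expDensity (G : Model p q) (θ y : ℝ) : ℝ :=
  G.c y G.φ * Real.exp ((y * θ - G.b θ) / G.φ)

/-- The canonical parameter `α₀(u)ᵀ m + α₁(u)ᵀ x`. -/
def Model.canonical (G : Model p q) (w : ℝ × (Fin p → ℝ) × (Fin q → ℝ)) : ℝ :=
  G.α₀ w.1 ⬝ᵥ w.2.1 + G.α₁ w.1 ⬝ᵥ w.2.2

/-- The error `ε = m - Γ(u)ᵀ x`. -/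
def Model.err (G : Model p q) (D : Data Ω p q) (i : ℕ) (ω : Ω) : Fin p → ℝ :=
  D.m i ω - (G.Γ (D.u i ω))ᵀ *ᵥ D.x i ω

/-- `m*`. -/
def Model.mStar (G : Model p q) (D : Data Ω p q) (i : ℕ) (ω : Ω) : Fin p × Fin G.knots₀.dim → ℝ :=
  stack (D.m i ω) (G.knots₀.basis (D.u i ω))

/-- `x*`. -/
def Model.xStar (G : Model p q) (D : Data Ω p q) (i : ℕ) (ω : Ω) : Fin q × Fin G.knots₁.dim → ℝ :=
  stack (D.x i ω) (G.knots₁.basis (D.u i ω))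

/-- `xᵐ`. -/
def Model.xM (G : Model p q) (D : Data Ω p q) (i : ℕ) (ω : Ω) : Fin q × Fin G.knotsM.dim → ℝ :=
  stack (D.x i ω) (G.knotsM.basis (D.u i ω))

/-- The spline predictor `α₀*ᵀ m* + α₁*ᵀ x*` at the parameter `θ = (α₀*, α₁*)`. -/
def Model.predictor (G : Model p q) (D : Data Ω p q) (θ : G.Param) (i : ℕ) (ω : Ω) : ℝ :=
  θ.1 ⬝ᵥ G.mStar D i ω + θ.2 ⬝ᵥ G.xStar D i ω

/-- The true parameter `(α₀*, α₁*)`. -/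
def Model.trueParam (G : Model p q) : G.Param := (G.a₀, G.a₁)

/-- The log-likelihood of the first `n` observations. -/
def Model.logLik (G : Model p q) (D : Data Ω p q) (n : ℕ) (ω : Ω) (θ : G.Param) : ℝ :=
  ∑ i ∈ Finset.range n,
    (Real.log (G.c (D.y i ω) G.φ) +
      (D.y i ω * G.predictor D θ i ω - G.b (G.predictor D θ i ω)) / G.φ)

/-- The parameters for which the likelihood of the first `n` observations is defined. -/
def Model.admissible (G : Model p q) (D : Data Ω p q) (n : ℕ) (ω : Ω) : Set G.Param :=
  {θ | ∀ i < n, G.predictor D θ i ω ∈ G.Θ}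

/-- `θ` maximizes the likelihood of the first `n` observations. -/
def Model.IsMaximizer (G : Model p q) (D : Data Ω p q) (n : ℕ) (ω : Ω) (θ : G.Param) : Prop :=
  θ ∈ G.admissible D n ω ∧ IsMaxOn (G.logLik D n ω) (G.admissible D n ω) θ

/-- A sequence of maximum likelihood estimators: measurable functions that maximize the likelihood
whenever it has a maximizer (and arbitrary where it has none). -/
structure Model.IsMLE [MeasurableSpace Ω] (G : Model p q) (D : Data Ω p q) (μ : Measure Ω)
    (est : ℕ → Ω → G.Param) : Prop where
  aemeasurable : ∀ n, AEMeasurable (est n) μ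
  isMaximizer : ∀ n, ∀ᵐ ω ∂μ,
    (∃ θ, G.IsMaximizer D n ω θ) → G.IsMaximizer D n ω (est n ω)

/-- The matrix `Xᵐ` with rows `x₁ᵐ, …, x_nᵐ`. -/
def Model.designM (G : Model p q) (D : Data Ω p q) (n : ℕ) (ω : Ω) :
    Matrix (Fin n) (Fin q × Fin G.knotsM.dim) ℝ :=
  Matrix.of fun i => G.xM D i ω

/-- The matrix `M` with rows `m₁, …, m_n`. -/
def mediatorMatrix (D : Data Ω p q) (n : ℕ) (ω : Ω) : Matrix (Fin n) (Fin p) ℝ :=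
  Matrix.of fun i => D.m i ω

/-- The least squares estimator `Ĉ = (Xᵐᵀ Xᵐ)⁻¹ Xᵐᵀ M`. -/
def Model.hatC (G : Model p q) (D : Data Ω p q) (n : ℕ) (ω : Ω) :
    Matrix (Fin q × Fin G.knotsM.dim) (Fin p) ℝ :=
  ((G.designM D n ω)ᵀ * G.designM D n ω)⁻¹ * (G.designM D n ω)ᵀ * mediatorMatrix D n ω

/-- `Γ̂(u) = {I_q ⊗ B(u)ᵀ} Ĉ`. -/
def Model.hatΓ (G : Model p q) (D : Data Ω p q) (n : ℕ) (ω : Ω) (u : ℝ) :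
    Matrix (Fin q) (Fin p) ℝ :=
  kronRow q (G.knotsM.basis u) * G.hatC D n ω

/-- `α̂₀(u) = {I_p ⊗ b₀(u)ᵀ} α̂₀*`. -/
def Model.hatα₀ (G : Model p q) (θ : G.Param) (u : ℝ) : Fin p → ℝ :=
  kronRow p (G.knots₀.basis u) *ᵥ θ.1

/-- The indirect effect `β(u) = Γ(u) α₀(u)`. -/
def Model.β (G : Model p q) (u : ℝ) : Fin q → ℝ := G.Γ u *ᵥ G.α₀ u

/-- The estimated indirect effect `β̂(u) = Γ̂(u) α̂₀(u)`. -/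
def Model.hatβ (G : Model p q) (D : Data Ω p q) (est : ℕ → Ω → G.Param) (n : ℕ) (ω : Ω) (u : ℝ) :
    Fin q → ℝ :=
  G.hatΓ D n ω u *ᵥ G.hatα₀ (est n ω) u

/-- `E (v wᵀ)`. -/
def crossMoment {ι κ : Type*} [MeasurableSpace Ω] (μ : Measure Ω) (v : Ω → ι → ℝ) (w : Ω → κ → ℝ) :
    Matrix ι κ ℝ :=
  Matrix.of fun i j => ∫ ω, v ω i * w ω j ∂μ

/-- `E {v wᵀ b''(α₀*ᵀ m* + α₁*ᵀ x*)}`. -/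
def Model.weightedMoment {ι κ : Type*} [MeasurableSpace Ω] (G : Model p q) (D : Data Ω p q)
    (μ : Measure Ω) (v : Ω → ι → ℝ) (w : Ω → κ → ℝ) : Matrix ι κ ℝ :=
  Matrix.of fun i j =>
    ∫ ω, v ω i * w ω j * iteratedDeriv 2 G.b (G.predictor D G.trueParam 0 ω) ∂μ

variable [MeasurableSpace Ω] (G : Model p q) (D : Data Ω p q) (μ : Measure Ω)

/-- `Σ_ε`. -/
def Model.covErr : Matrix (Fin p) (Fin p) ℝ := crossMoment μ (G.err D 0) (G.err D 0)

/-- `Σ_{xᵐxᵐ}`. -/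
def Model.gramXM := crossMoment μ (G.xM D 0) (G.xM D 0)

/-- `Σ_{m*m*}`. -/
def Model.gramMM := G.weightedMoment D μ (G.mStar D 0) (G.mStar D 0)

/-- `Σ_{m*x*}`. -/
def Model.gramMX := G.weightedMoment D μ (G.mStar D 0) (G.xStar D 0)

/-- `Σ_{x*m*}`. -/
def Model.gramXMStar := G.weightedMoment D μ (G.xStar D 0) (G.mStar D 0)

/-- `Σ_{x*x*}`. -/
def Model.gramXX := G.weightedMoment D μ (G.xStar D 0) (G.xStar D 0)

/-- `Σ_{m*m*|x*} = Σ_{m*m*} - Σ_{m*x*} Σ_{x*x*}⁻¹ Σ_{x*m*}`. -/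
def Model.gramMMGivenX := G.gramMM D μ - G.gramMX D μ * (G.gramXX D μ)⁻¹ * G.gramXMStar D μ

/-- `n Var{β̂(u)}`, that is
`α₀(u)ᵀ Σ_ε α₀(u) {I_q ⊗ B(u)ᵀ} Σ_{xᵐxᵐ}⁻¹ {I_q ⊗ B(u)}
  + φ Γ(u) {I_p ⊗ b₀(u)ᵀ} Σ_{m*m*|x*}⁻¹ {I_p ⊗ b₀(u)} Γ(u)ᵀ`. -/
def Model.scaledVarβ (u : ℝ) : Matrix (Fin q) (Fin q) ℝ :=
  (G.α₀ u ⬝ᵥ (G.covErr D μ *ᵥ G.α₀ u)) •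
      (kronRow q (G.knotsM.basis u) * (G.gramXM D μ)⁻¹ * (kronRow q (G.knotsM.basis u))ᵀ) +
    G.φ • (G.Γ u * kronRow p (G.knots₀.basis u) * (G.gramMMGivenX D μ)⁻¹ *
      (kronRow p (G.knots₀.basis u))ᵀ * (G.Γ u)ᵀ)

/-- `Var{β̂(u)}` at sample size `n`. -/
def Model.varβ (n : ℕ) (u : ℝ) : Matrix (Fin q) (Fin q) ℝ :=
  (1 / (n : ℝ)) • G.scaledVarβ D μ u

/-- `(uᵢ, mᵢ, xᵢ, yᵢ)ᵢ` is a random sample from the model. -/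
structure Model.IsSample : Prop where
  measurable_u : ∀ i, Measurable (D.u i)
  measurable_m : ∀ i, Measurable (D.m i)
  measurable_x : ∀ i, Measurable (D.x i)
  measurable_y : ∀ i, Measurable (D.y i)
  indep : iIndepFun (fun i ω => (D.u i ω, D.m i ω, D.x i ω, D.y i ω)) μ
  identDistrib : ∀ i, IdentDistrib (fun ω => (D.u i ω, D.m i ω, D.x i ω, D.y i ω))
    (fun ω => (D.u 0 ω, D.m 0 ω, D.x 0 ω, D.y 0 ω)) μ μ
  /-- the mediator equation: `ε` is centred and independent of `(x, u)` -/
  err_mean : ∀ j, ∫ ω, G.err D 0 ω j ∂μ = 0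
  err_indep : IndepFun (G.err D 0) (fun ω => (D.x 0 ω, D.u 0 ω)) μ

/-- The response equation: given `(u, m, x)`, the response has the exponential family density with
canonical parameter `α₀(u)ᵀ m + α₁(u)ᵀ x`. -/
structure Model.HasExpFamilyResponse [IsFiniteMeasure μ] : Prop where
  sigmaFinite : SigmaFinite G.ν
  φ_pos : 0 < G.φ
  measurable_c : Measurable fun y => G.c y G.φ
  c_nonneg : ∀ y, 0 ≤ G.c y G.φ
  isOpen_Θ : IsOpen G.Θ
  ordConnected_Θ : G.Θ.OrdConnected
  lintegral_eq_one : ∀ θ ∈ G.Θ, ∫⁻ y, ENNReal.ofReal (G.expDensity θ y) ∂G.ν = 1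
  canonical_mem : ∀ᵐ ω ∂μ, G.canonical (D.u 0 ω, D.m 0 ω, D.x 0 ω) ∈ G.Θ
  condDistrib_eq : ∀ᵐ w ∂(μ.map fun ω => (D.u 0 ω, D.m 0 ω, D.x 0 ω)),
    condDistrib (D.y 0) (fun ω => (D.u 0 ω, D.m 0 ω, D.x 0 ω)) μ w =
      G.ν.withDensity fun y => ENNReal.ofReal (G.expDensity (G.canonical w) y)

/-- The coefficient functions belong to the spline spaces. -/
structure Model.IsSplineModel : Prop where
  α₀_eq : ∀ u ∈ Icc G.lo G.hi, G.α₀ u = kronRow p (G.knots₀.basis u) *ᵥ G.a₀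
  α₁_eq : ∀ u ∈ Icc G.lo G.hi, G.α₁ u = kronRow q (G.knots₁.basis u) *ᵥ G.a₁
  Γ_eq : ∀ u ∈ Icc G.lo G.hi, G.Γ u = kronRow q (G.knotsM.basis u) * G.C

/-- `u` has a Lebesgue density on `[lo, hi]` that is bounded away from `0` and infinity. -/
structure Model.CondDensity : Prop where
  measurable : Measurable G.density
  bounds : ∃ l L : ℝ, 0 < l ∧ ∀ t ∈ Icc G.lo G.hi, G.density t ∈ Icc l L
  law : μ.map (D.u 0) =
    (volume.restrict (Icc G.lo G.hi)).withDensity fun t => ENNReal.ofReal (G.density t)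

/-- Hölder smoothness of the coefficient functions. -/
structure Model.CondHolder : Prop where
  α : ∃ (r : ℕ) (η K : ℝ), η ∈ Ioc (0 : ℝ) 1 ∧ 1 / 2 < r + η ∧ 0 < K ∧
    (∀ j, HolderClass (Icc G.lo G.hi) r η K fun u => G.α₀ u j) ∧
    (∀ l, HolderClass (Icc G.lo G.hi) r η K fun u => G.α₁ u l)
  Γ : ∃ (r : ℕ) (η K : ℝ), η ∈ Ioc (0 : ℝ) 1 ∧ 1 / 2 < r + η ∧ 0 < K ∧
    ∀ l j, HolderClass (Icc G.lo G.hi) r η K fun u => G.Γ u l j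

/-- Second moments of `x` and `m` exist, and the eigenvalues of `E (x xᵀ)` and `E (m mᵀ)` are
bounded away from `0` and infinity. -/
structure CondMoments : Prop where
  memLp_x : ∀ l, MemLp (fun ω => D.x 0 ω l) 2 μ
  memLp_m : ∀ j, MemLp (fun ω => D.m 0 ω j) 2 μ
  x : EigenvaluesBounded (crossMoment μ (D.x 0) (D.x 0))
  m : EigenvaluesBounded (crossMoment μ (D.m 0) (D.m 0))

/-- The second derivatives of the coefficient functions are continuous on `[lo, hi]`. -/
structure Model.CondSmooth : Prop where
  α₀ : ∀ j, ContDiffOn ℝ 2 (fun u => G.α₀ u j) (Icc G.lo G.hi)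
  α₁ : ∀ l, ContDiffOn ℝ 2 (fun u => G.α₁ u l) (Icc G.lo G.hi)
  Γ : ∀ l j, ContDiffOn ℝ 2 (fun u => G.Γ u l j) (Icc G.lo G.hi)

/-- The usual regularity of a generalized linear model with random covariates: near the true
parameter the predictor stays in `Θ`, and `‖(m*, x*)‖² b''(predictor)` is dominated by an integrable
function. In particular the matrices `Σ_{m*m*}`, `Σ_{m*x*}`, `Σ_{x*m*}`, `Σ_{x*x*}` are finite. -/
def Model.GLMRegular : Prop :=
  ∃ δ > 0, ∃ H : Ω → ℝ, Integrable H μ ∧ ∀ᵐ ω ∂μ, ∀ θ ∈ Metric.ball G.trueParam δ,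
    G.predictor D θ 0 ω ∈ G.Θ ∧
    (G.mStar D 0 ω ⬝ᵥ G.mStar D 0 ω + G.xStar D 0 ω ⬝ᵥ G.xStar D 0 ω) *
      iteratedDeriv 2 G.b (G.predictor D θ 0 ω) ≤ H ω

end Definitions

end GVCMM

end

/-! The knots are fixed and the coefficient functions are splines, so the model is parametric: both
estimators turn out to be asymptotically linear. Hence √n (β̂(u) - β(u)) is, up to a term that is
small in probability, a normalized sum of i.i.d. centred vectors (`influence`) whose covariance
matrix is `scaledVarβ`. The central limit theorem and Slutsky's lemma then finish the proof.

Maximum likelihood. With Z = (m*, x*) the response follows a generalized linear model with canonical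
parameter θ₀ᵀZ. The normalization of the densities says that b/φ is a rescaled cumulant generating
function; so b is analytic and convex on Θ, and the conditional mean and variance of y are b' and φ
b''. At θ₀ + s/√n the negative log-likelihood ratio (times φ) is, for each fixed s, close to the
quadratic function ½ sᵀJs - Wᵀs, with J the information matrix and W the normalized score
(`smallInProb_negLogLikRatio`). Since the ratio is convex in s, closeness at finitely many points
already forces a minimizer to exist and every minimizer to be close to J⁻¹W
(`exists_finite_convexOn_argmin_close`). This gives existence, consistency and linearity at once
(`smallInProb_mle_sub`).

Least squares. The law of large numbers for the Gram matrix and the boundedness of the normalized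
cross products give the linearization of Ĉ (`smallInProb_leastSquares_sub`).

Positive definiteness of J (`posDef_info`). If sᵀZ = 0 almost surely, then the independence of the
mediator errors from (x, u), the invertibility of Σ_ε and the linear independence of B-splines kill
the coefficients of m*, and nonsingularity of Σ_{x*x*} kills those of x*. Moreover b'' > 0 on Θ,
because degeneracy of one member of the family would make Σ_{x*x*} vanish.

Variance. By the product rule the error of Γ̂α̂₀ is (Γ̂ - Γ)α₀ + Γ(α̂₀ - α₀) plus a product of two
small factors. The two linear terms are uncorrelated, since y - b'(η) has conditional mean zero
given (u, m, x). The block of J⁻¹ belonging to m* is the inverse of the Schur complement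
Σ_{m*m*|x*}. -/

noncomputable section

/-! ### Linear independence of the clamped B-spline basis. -/

/-- A combination `∑ c_k (u - lo)^k g_k(u)` with `g_k(lo) ≠ 0` that vanishes on the right of `lo`
has zero coefficients. -/
theorem coeff_eq_zero_of_sum_pow_mul_eq_zero {lo hi : ℝ} (h : lo < hi) (m : ℕ) :
    ∀ (c : ℕ → ℝ) (g : ℕ → ℝ → ℝ), (∀ k < m, Continuous (g k)) → (∀ k < m, g k lo ≠ 0) →
    (∀ u ∈ Ioo lo hi, ∑ k ∈ Finset.range m, c k * ((u - lo) ^ k * g k u) = 0) →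
    ∀ k < m, c k = 0 := by
  induction m with
  | zero => intro c g _ _ _ k hk; omega
  | succ m ih =>
    intro c g hg hne hsum
    have hcont : Continuous fun u => ∑ k ∈ Finset.range (m + 1), c k * ((u - lo) ^ k * g k u) := by
      refine continuous_finsetSum _ fun k hk => ?_
      have := hg k (Finset.mem_range.1 hk)
      fun_prop
    -- As u decreases to `lo`, every term with a positive power of u - lo disappears.
    have h0 : c 0 = 0 := by
      have hl : Tendsto (fun u => ∑ k ∈ Finset.range (m + 1), c k * ((u - lo) ^ k * g k u))
          (𝓝[>] lo) (𝓝 (∑ k ∈ Finset.range (m + 1), c k * ((lo - lo) ^ k * g k lo))) :=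
        (hcont.tendsto lo).mono_left nhdsWithin_le_nhds
      have hl' : Tendsto (fun u => ∑ k ∈ Finset.range (m + 1), c k * ((u - lo) ^ k * g k u))
          (𝓝[>] lo) (𝓝 0) := by
        refine tendsto_const_nhds.congr' ?_
        filter_upwards [Ioo_mem_nhdsGT h] with u hu
        exact (hsum u hu).symm
      have := tendsto_nhds_unique hl hl'
      rw [Finset.sum_range_succ'] at this
      simp at this
      exact this.resolve_right (hne 0 (by omega))
    -- Once c 0 = 0, dividing by u - lo ≠ 0 lowers every exponent by one.
    have hrec := ih (fun k => c (k + 1)) (fun k => g (k + 1)) (fun k hk => hg _ (by omega))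
      (fun k hk => hne _ (by omega)) (by
        intro u hu
        have hs := hsum u hu
        rw [Finset.sum_range_succ', h0] at hs
        have hpos : u - lo ≠ 0 := (sub_pos.2 hu.1).ne'
        apply mul_left_cancel₀ hpos
        rw [mul_zero, Finset.mul_sum, ← hs]
        simp only [zero_mul, add_zero]
        refine Finset.sum_congr rfl fun k _ => ?_
        ring)
    intro k hk
    cases k with
    | zero => exact h0
    | succ k => exact hrec k (by omega)

namespace GVCMM.Knots

variable {lo hi : ℝ} (t : Knots lo hi)

theorem knot_of_le {i : ℕ} (h : i ≤ t.degree) : t.knot i = lo := by simp [knot, h]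

theorem knot_interior {i : ℕ} (h : i < t.numInterior) :
    t.knot (t.degree + 1 + i) = t.interior ⟨i, h⟩ := by
  have h1 : ¬ t.degree + 1 + i ≤ t.degree := by omega
  have h2 : t.degree + 1 + i - (t.degree + 1) < t.numInterior := by omega
  simp only [knot, h1, h2, if_false, dif_pos]
  congr 2; omega

theorem knot_of_ge {i : ℕ} (h : t.degree + 1 + t.numInterior ≤ i) : t.knot i = hi := by
  have h1 : ¬ i ≤ t.degree := by omega
  have h2 : ¬ i - (t.degree + 1) < t.numInterior := by omega
  simp [knot, h1, h2]

theorem knot_mem (hlt : lo < hi) (i : ℕ) : t.knot i ∈ Icc lo hi := by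
  unfold knot
  split_ifs with h1 h2
  · exact ⟨le_rfl, hlt.le⟩
  · exact Ioo_subset_Icc_self (t.interior_mem _)
  · exact ⟨hlt.le, le_rfl⟩

theorem knot_lt_succ (hlt : lo < hi) {i : ℕ} (h1 : t.degree ≤ i)
    (h2 : i ≤ t.degree + t.numInterior) : t.knot i < t.knot (i + 1) := by
  rcases h1.eq_or_lt with rfl | h1
  · rw [t.knot_of_le le_rfl]
    rcases Nat.eq_zero_or_pos t.numInterior with h0 | h0
    · rwa [t.knot_of_ge (by omega)]
    · rw [show t.degree + 1 = t.degree + 1 + 0 by omega, t.knot_interior h0]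
      exact (t.interior_mem _).1
  · obtain ⟨j, rfl⟩ : ∃ j, i = t.degree + 1 + j := ⟨i - (t.degree + 1), by omega⟩
    rw [t.knot_interior (by omega)]
    rcases (show j + 1 ≤ t.numInterior by omega).eq_or_lt with h0 | h0
    · rw [t.knot_of_ge (by omega)]
      exact (t.interior_mem _).2
    · rw [show t.degree + 1 + j + 1 = t.degree + 1 + (j + 1) by omega, t.knot_interior h0]
      exact t.strictMono_interior (by simp [Fin.lt_def])

theorem knot_mono (hlt : lo < hi) : Monotone t.knot := by
  refine monotone_nat_of_le_succ fun i => ?_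
  by_cases h1 : i < t.degree
  · rw [t.knot_of_le h1.le]; exact (t.knot_mem hlt _).1
  · by_cases h2 : i ≤ t.degree + t.numInterior
    · exact (t.knot_lt_succ hlt (by omega) h2).le
    · rw [t.knot_of_ge (i := i + 1) (by omega)]; exact (t.knot_mem hlt _).2

theorem coxDeBoor_zero_eq_ite (k : ℕ) (u : ℝ) : t.coxDeBoor 0 k u =
    open Classical in
    if t.knot k ≤ u ∧ t.knot k < t.knot (k + 1) ∧
          (u < t.knot (k + 1) ∨ (u = hi ∧ t.knot (k + 1) = hi)) then 1 else 0 := rfl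

theorem coxDeBoor_succ (d k : ℕ) (u : ℝ) : t.coxDeBoor (d + 1) k u =
      (u - t.knot k) / (t.knot (k + d + 1) - t.knot k) * coxDeBoor t d k u +
        (t.knot (k + d + 2) - u) / (t.knot (k + d + 2) - t.knot (k + 1)) *
          coxDeBoor t d (k + 1) u := rfl

/-- Only the left half of the local support property is needed, because coefficients are eliminated
from left to right. -/
theorem coxDeBoor_eq_zero_of_lt (hlt : lo < hi) {u : ℝ} (d : ℕ) :
    ∀ {k : ℕ}, u < t.knot k → t.coxDeBoor d k u = 0 := by
  induction d with
  | zero => intro k hu; rw [coxDeBoor_zero_eq_ite, if_neg]; intro h; linarith [h.1]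
  | succ d ih =>
    intro k hu
    rw [coxDeBoor_succ, ih hu, ih (hu.trans_le (t.knot_mono hlt (Nat.le_succ k)))]
    simp

/-- On the interval where the k-th spline starts, the next spline has not started yet, so the
recursion reduces to one product of positive factors. This is the pivot that isolates the k-th
coefficient. -/
theorem coxDeBoor_pos (hlt : lo < hi) {u : ℝ} {k : ℕ} (h1 : t.knot k < u)
    (h2 : u < t.knot (k + 1)) (d : ℕ) : 0 < t.coxDeBoor d k u := by
  induction d with
  | zero =>
    rw [coxDeBoor_zero_eq_ite, if_pos ⟨h1.le, h1.trans h2, Or.inl h2⟩]; exact one_pos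
  | succ d ih =>
    rw [coxDeBoor_succ, t.coxDeBoor_eq_zero_of_lt hlt d h2, mul_zero, add_zero]
    refine mul_pos (div_pos (by linarith) ?_) ih
    have : t.knot (k + 1) ≤ t.knot (k + d + 1) := t.knot_mono hlt (by omega)
    linarith

theorem measurable_coxDeBoor (d : ℕ) : ∀ k, Measurable (t.coxDeBoor d k) := by
  induction d with
  | zero =>
    intro k
    refine Measurable.ite ?_ measurable_const measurable_const
    simp only [measurableSet_setOfPred]
    refine Measurable.and (measurableSet_setOfPred.1 measurableSet_Ici) (Measurable.and
      measurable_const (Measurable.or (measurableSet_setOfPred.1 measurableSet_Iio) (Measurable.and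
      (measurableSet_setOfPred.1 (measurableSet_singleton hi)) measurable_const)))
  | succ d ih =>
    intro k
    have h1 := ih k
    have h2 := ih (k + 1)
    have : t.coxDeBoor (d + 1) k = fun u => (u - t.knot k) / (t.knot (k + d + 1) - t.knot k) *
      coxDeBoor t d k u + (t.knot (k + d + 2) - u) / (t.knot (k + d + 2) - t.knot (k + 1)) *
          coxDeBoor t d (k + 1) u := rfl
    rw [this]
    fun_prop

theorem coxDeBoor_bounded (d : ℕ) : ∀ k, ∃ K : ℝ, ∀ u ∈ Icc lo hi, |t.coxDeBoor d k u| ≤ K := by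
  induction d with
  | zero =>
    refine fun k => ⟨1, fun u _ => ?_⟩
    rw [coxDeBoor_zero_eq_ite]; split_ifs <;> simp
  | succ d ih =>
    intro k
    obtain ⟨K₁, h₁⟩ := ih k
    obtain ⟨K₂, h₂⟩ := ih (k + 1)
    have hc : ∀ f : ℝ → ℝ, Continuous f → ∃ K, ∀ u ∈ Icc lo hi, |f u| ≤ K := fun f hf => by
      simpa using (isCompact_Icc (a := lo) (b := hi)).exists_bound_of_continuousOn hf.continuousOn
    obtain ⟨L₁, hL₁⟩ := hc (fun u => (u - t.knot k) / (t.knot (k + d + 1) - t.knot k))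
      (by fun_prop)
    obtain ⟨L₂, hL₂⟩ := hc (fun u =>
      (t.knot (k + d + 2) - u) / (t.knot (k + d + 2) - t.knot (k + 1))) (by fun_prop)
    refine ⟨L₁ * K₁ + L₂ * K₂, fun u hu => ?_⟩
    rw [coxDeBoor_succ]
    refine (abs_add_le _ _).trans (add_le_add ?_ ?_) <;> rw [abs_mul]
    · exact mul_le_mul (hL₁ u hu) (h₁ u hu) (abs_nonneg _) ((abs_nonneg _).trans (hL₁ u hu))
    · exact mul_le_mul (hL₂ u hu) (h₂ u hu) (abs_nonneg _) ((abs_nonneg _).trans (hL₂ u hu))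

theorem basis_bounded : ∃ K : ℝ, ∀ u ∈ Icc lo hi, ∀ k, |t.basis u k| ≤ K := by
  choose K hK using fun k : Fin t.dim => t.coxDeBoor_bounded t.degree k
  refine ⟨∑ k, |K k|, fun u hu k => ?_⟩
  exact (hK k u hu).trans ((le_abs_self _).trans
    (Finset.single_le_sum (f := fun k => |K k|) (fun _ _ => abs_nonneg _) (Finset.mem_univ k)))

theorem measurable_basis : Measurable t.basis :=
  measurable_pi_lambda _ fun k => t.measurable_coxDeBoor t.degree k

/-- On the first knot interval, `B_{k,e}` vanishes at `lo` to the exact order `k + e - degree`. -/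
theorem coxDeBoor_first_interval (hlt : lo < hi) (e : ℕ) : ∀ k, k ≤ t.degree → t.degree ≤ k + e →
    ∃ g : ℝ → ℝ, Continuous g ∧ 0 < g lo ∧ ∀ u ∈ Ioo lo (t.knot (t.degree + 1)),
      t.coxDeBoor e k u = (u - lo) ^ (k + e - t.degree) * g u := by
  have hd : lo < t.knot (t.degree + 1) := by
    have := t.knot_lt_succ hlt le_rfl (by omega)
    rwa [t.knot_of_le le_rfl] at this
  induction e with
  | zero =>
    intro k hk hk'
    obtain rfl : k = t.degree := by omega
    refine ⟨fun _ => 1, continuous_const, one_pos, fun u hu => ?_⟩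
    rw [coxDeBoor_zero_eq_ite, t.knot_of_le le_rfl, if_pos ⟨hu.1.le, hd, Or.inl hu.2⟩]
    simp
  | succ e ih =>
    intro k hk hk'
    -- The second term of the recursion keeps the order of vanishing: its linear factor is positive
    -- at `lo`.
    have hpos2 : k + 1 ≤ t.degree → t.degree ≤ k + e + 1 → ∃ g : ℝ → ℝ, Continuous g ∧ 0 < g lo ∧
        ∀ u ∈ Ioo lo (t.knot (t.degree + 1)),
        (t.knot (k + e + 2) - u) / (t.knot (k + e + 2) - t.knot (k + 1)) *
          coxDeBoor t e (k + 1) u = (u - lo) ^ (k + (e + 1) - t.degree) * g u := by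
      intro h1 h2
      obtain ⟨g, hg, hg0, hgu⟩ := ih (k + 1) h1 (by omega)
      have hk2 : lo < t.knot (k + e + 2) := hd.trans_le (t.knot_mono hlt (by omega))
      refine ⟨fun u => (t.knot (k + e + 2) - u) / (t.knot (k + e + 2) - t.knot (k + 1)) * g u,
        by fun_prop, ?_, fun u hu => ?_⟩
      · rw [t.knot_of_le h1]
        exact mul_pos (div_pos (sub_pos.2 hk2) (sub_pos.2 hk2)) hg0
      · rw [hgu u hu, show k + 1 + e - t.degree = k + (e + 1) - t.degree by omega]; ring
    by_cases h : t.degree ≤ k + e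
    · obtain ⟨g, hg, hg0, hgu⟩ := ih k hk h
      have hk1 : lo < t.knot (k + e + 1) := hd.trans_le (t.knot_mono hlt (by omega))
      -- The first term gains one order, since knot k is `lo` and the linear factor is proportional
      -- to u - lo.
      have hfirst : ∀ u ∈ Ioo lo (t.knot (t.degree + 1)),
          (u - t.knot k) / (t.knot (k + e + 1) - t.knot k) * coxDeBoor t e k u =
          (u - lo) ^ (k + (e + 1) - t.degree) * (g u / (t.knot (k + e + 1) - lo)) := by
        intro u hu
        rw [hgu u hu, t.knot_of_le hk, show k + (e + 1) - t.degree = k + e - t.degree + 1 by omega]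
        ring
      have hg1 : 0 < g lo / (t.knot (k + e + 1) - lo) := div_pos hg0 (sub_pos.2 hk1)
      by_cases hkd : k + 1 ≤ t.degree
      · obtain ⟨g', hg', hg0', hgu'⟩ := hpos2 hkd (by omega)
        refine ⟨fun u => g u / (t.knot (k + e + 1) - lo) + g' u, by fun_prop,
          add_pos hg1 hg0', fun u hu => ?_⟩
        rw [coxDeBoor_succ, hfirst u hu, hgu' u hu]; ring
      · obtain rfl : k = t.degree := by omega
        refine ⟨fun u => g u / (t.knot (t.degree + e + 1) - lo), by fun_prop, hg1,
          fun u hu => ?_⟩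
        rw [coxDeBoor_succ, hfirst u hu, t.coxDeBoor_eq_zero_of_lt hlt e hu.2]; ring
    -- Here k + e + 1 equals the degree, so knots k and k + e + 1 both lie at `lo`, and the first
    -- term has denominator 0 and counts as 0.
    · obtain ⟨g', hg', hg0', hgu'⟩ := hpos2 (by omega) (by omega)
      refine ⟨g', hg', hg0', fun u hu => ?_⟩
      rw [coxDeBoor_succ, hgu' u hu, t.knot_of_le hk, t.knot_of_le (i := k + e + 1) (by omega)]
      simp

/-- On the first knot interval exactly the first degree + 1 splines are alive, and they vanish at
`lo` to the distinct orders 0, …, degree, which separates them. Each further interval brings in one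
new spline, whose coefficient is then forced to be zero. -/
theorem coeff_eq_zero_of_sum_coxDeBoor_eq_zero (hlt : lo < hi) (c : ℕ → ℝ)
    (h : ∀ᵐ u ∂(volume.restrict (Icc lo hi)),
      ∑ k ∈ Finset.range t.dim, c k * t.coxDeBoor t.degree k u = 0) :
    ∀ k < t.dim, c k = 0 := by
  have hdim : t.dim = t.numInterior + t.degree + 1 := rfl
  have hsub : ∀ j, Ioo (t.knot j) (t.knot (j + 1)) ⊆ Icc lo hi := fun j u hu =>
    ⟨(t.knot_mem hlt j).1.trans hu.1.le, hu.2.le.trans (t.knot_mem hlt (j + 1)).2⟩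
  have hae : ∀ j, ∀ᵐ u ∂(volume.restrict (Ioo (t.knot j) (t.knot (j + 1)))),
      ∑ k ∈ Finset.range t.dim, c k * t.coxDeBoor t.degree k u = 0 := fun j =>
    ae_restrict_of_ae_restrict_of_subset (hsub j) h
  have hfirst : ∀ k < t.degree + 1, c k = 0 := by
    choose! g hg hg0 hgu using t.coxDeBoor_first_interval hlt t.degree
    have hd : lo < t.knot (t.degree + 1) := by
      have := t.knot_lt_succ hlt le_rfl (by omega)
      rwa [t.knot_of_le le_rfl] at this
    refine coeff_eq_zero_of_sum_pow_mul_eq_zero hd _ c g (fun k hk => hg k (by omega) (by omega))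
      (fun k hk => (hg0 k (by omega) (by omega)).ne') ?_
    have hcont : Continuous fun u =>
        ∑ k ∈ Finset.range (t.degree + 1), c k * ((u - lo) ^ k * g k u) := by
      refine continuous_finsetSum _ fun k hk => ?_
      have := hg k (by have := Finset.mem_range.1 hk; omega) (by omega)
      fun_prop
    have h0 := hae t.degree
    rw [t.knot_of_le le_rfl] at h0
    -- Continuity of the factorized sum turns vanishing almost everywhere into vanishing everywhere
    -- on the open interval.
    refine fun u hu => Measure.eqOn_open_of_ae_eq (μ := volume)
      (U := Ioo lo (t.knot (t.degree + 1)))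
      (g := fun _ => 0) ?_ isOpen_Ioo hcont.continuousOn continuousOn_const hu
    filter_upwards [h0, ae_restrict_mem measurableSet_Ioo] with u hu hmem
    rw [← hu]
    refine Finset.sum_subset_zero_on_sdiff (Finset.range_subset_range.2 (by omega)) ?_ ?_
    · intro k hk
      simp only [Finset.mem_sdiff, Finset.mem_range] at hk
      rw [t.coxDeBoor_eq_zero_of_lt hlt _ (hmem.2.trans_le (t.knot_mono hlt (by omega))), mul_zero]
    · intro k hk
      have hk := Finset.mem_range.1 hk
      rw [hgu k (by omega) (by omega) u hmem, Nat.add_sub_cancel]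
  intro k
  induction k using Nat.strong_induction_on with
  | _ k ih =>
    intro hk
    by_cases hkd : k < t.degree + 1
    · exact hfirst k hkd
    have hlt' : t.knot k < t.knot (k + 1) := t.knot_lt_succ hlt (by omega) (by omega)
    have : (volume.restrict (Ioo (t.knot k) (t.knot (k + 1)))) ≠ 0 := by
      rw [Ne, Measure.restrict_eq_zero]
      simp [hlt']
    have : NeBot (ae (volume.restrict (Ioo (t.knot k) (t.knot (k + 1))))) := ae_neBot.2 this
    obtain ⟨u, hu, hmem⟩ := ((hae k).and (ae_restrict_mem measurableSet_Ioo)).exists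
    rw [Finset.sum_eq_single k] at hu
    · exact (mul_eq_zero.1 hu).resolve_right (t.coxDeBoor_pos hlt hmem.1 hmem.2 _).ne'
    · intro j hj hjk
      rcases lt_or_gt_of_ne hjk with hj' | hj'
      · rw [ih j hj' (Finset.mem_range.1 hj), zero_mul]
      · rw [t.coxDeBoor_eq_zero_of_lt hlt _ (hmem.2.trans_le (t.knot_mono hlt (by omega))),
          mul_zero]
    · intro hk'; exact absurd (Finset.mem_range.2 hk) hk'

/-- The B-spline basis is linearly independent. -/
theorem eq_zero_of_dotProduct_basis_eq_zero (hlt : lo < hi) (c : Fin t.dim → ℝ)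
    (h : ∀ᵐ u ∂(volume.restrict (Icc lo hi)), c ⬝ᵥ t.basis u = 0) : c = 0 := by
  have := t.coeff_eq_zero_of_sum_coxDeBoor_eq_zero hlt
    (fun k => if hk : k < t.dim then c ⟨k, hk⟩ else 0) (by
      filter_upwards [h] with u hu
      rw [Finset.sum_range, ← hu]
      simp [dotProduct, basis])
  ext k
  simpa using this k k.2

end GVCMM.Knots

/-! ### Exponential families: b as a cumulant generating function. -/

namespace GVCMM

/-- The densities `c y * exp ((y θ - b θ) / φ)`, `θ ∈ Θ`, form an exponential family with respect
to `ν`. -/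
structure IsExpFamily (ν : Measure ℝ) (c b : ℝ → ℝ) (Θ : Set ℝ) (φ : ℝ) : Prop where
  φ_pos : 0 < φ
  measurable_c : Measurable c
  c_nonneg : ∀ y, 0 ≤ c y
  isOpen_Θ : IsOpen Θ
  ordConnected_Θ : Θ.OrdConnected
  lintegral_eq_one : ∀ θ ∈ Θ, ∫⁻ y, ENNReal.ofReal (c y * Real.exp ((y * θ - b θ) / φ)) ∂ν = 1

namespace IsExpFamily

variable {ν : Measure ℝ} {c b : ℝ → ℝ} {Θ : Set ℝ} {φ θ : ℝ}

/-- The member of the exponential family with parameter `θ`. -/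
def law (ν : Measure ℝ) (c b : ℝ → ℝ) (φ θ : ℝ) : Measure ℝ :=
  ν.withDensity fun y => ENNReal.ofReal (c y * Real.exp ((y * θ - b θ) / φ))

/-- The carrier measure of the exponential family. -/
def carrier (ν : Measure ℝ) (c : ℝ → ℝ) : Measure ℝ := ν.withDensity fun y => ENNReal.ofReal (c y)

theorem law_eq_withDensity (h : IsExpFamily ν c b Θ φ) (θ : ℝ) : law ν c b φ θ =
    (carrier ν c).withDensity fun y => ENNReal.ofReal (Real.exp (θ / φ * y - b θ / φ)) := by
  have h1 := h.measurable_c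
  rw [carrier, ← withDensity_mul _ (by fun_prop) (by fun_prop), law]
  congr 1
  ext y
  rw [Pi.mul_apply, ← ENNReal.ofReal_mul (h.c_nonneg y)]
  congr 3
  ring

theorem lintegral_carrier (h : IsExpFamily ν c b Θ φ) (hθ : θ ∈ Θ) :
    ∫⁻ y, ENNReal.ofReal (Real.exp (θ / φ * y)) ∂(carrier ν c) =
      ENNReal.ofReal (Real.exp (b θ / φ)) := by
  have h1 : law ν c b φ θ univ = 1 := by
    rw [law, withDensity_apply _ MeasurableSet.univ, setLIntegral_univ, h.lintegral_eq_one θ hθ]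
  rw [h.law_eq_withDensity, withDensity_apply _ MeasurableSet.univ, setLIntegral_univ] at h1
  have h2 : ∀ y, ENNReal.ofReal (Real.exp (θ / φ * y)) =
      ENNReal.ofReal (Real.exp (b θ / φ)) *
        ENNReal.ofReal (Real.exp (θ / φ * y - b θ / φ)) := fun y => by
    rw [← ENNReal.ofReal_mul (Real.exp_pos _).le, ← Real.exp_add]
    congr 2; ring
  simp_rw [h2]
  rw [lintegral_const_mul _ (by fun_prop), h1, mul_one]

theorem integrable_exp (h : IsExpFamily ν c b Θ φ) (hθ : θ ∈ Θ) :
    Integrable (fun y => Real.exp (θ / φ * id y)) (carrier ν c) := by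
  refine ⟨by fun_prop, ?_⟩
  rw [hasFiniteIntegral_iff_ofReal (ae_of_all _ fun _ => (Real.exp_pos _).le)]
  simp only [id]
  rw [h.lintegral_carrier hθ]
  exact ENNReal.ofReal_lt_top

theorem mgf_carrier (h : IsExpFamily ν c b Θ φ)
    (hθ : θ ∈ Θ) : mgf id (carrier ν c) (θ / φ) = Real.exp (b θ / φ) := by
  rw [mgf, integral_eq_lintegral_of_nonneg_ae (ae_of_all _ fun _ => (Real.exp_pos _).le)
    (h.integrable_exp hθ).1]
  simp only [id]
  rw [h.lintegral_carrier hθ, ENNReal.toReal_ofReal (Real.exp_pos _).le]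

/-- Total mass one forces this identity. It is the source of all regularity of b: differentiability
of b is nowhere assumed. -/
theorem cgf_carrier (h : IsExpFamily ν c b Θ φ)
    (hθ : θ ∈ Θ) : cgf id (carrier ν c) (θ / φ) = b θ / φ := by
  rw [cgf, h.mgf_carrier hθ, Real.log_exp]

/-- Openness of Θ is used here; in the interior of the domain the cumulant generating function is
analytic and all moments of the tilted measures are finite. -/
theorem mem_interior (h : IsExpFamily ν c b Θ φ)
    (hθ : θ ∈ Θ) : θ / φ ∈ interior (integrableExpSet id (carrier ν c)) := by
  have hφ := h.φ_pos.ne'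
  refine _root_.mem_interior.2 ⟨(fun t => t * φ) ⁻¹' Θ, ?_, h.isOpen_Θ.preimage (by fun_prop), ?_⟩
  · intro t ht
    have := h.integrable_exp ht
    rwa [mul_div_cancel_right₀ _ hφ] at this
  · simpa [div_mul_cancel₀ _ hφ] using hθ

/-- Derivatives of the cumulant generating function are the mean and the variance of the tilted
measure, so this yields the moments of y. -/
theorem law_eq_tilted (h : IsExpFamily ν c b Θ φ) (hθ : θ ∈ Θ) :
    law ν c b φ θ = (carrier ν c).tilted (θ / φ * id ·) := by
  rw [h.law_eq_withDensity, Measure.tilted]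
  congr 1
  ext y
  have := h.mgf_carrier hθ
  rw [mgf] at this
  rw [this, Real.exp_sub, id]

theorem isProbabilityMeasure_law (h : IsExpFamily ν c b Θ φ)
    (hθ : θ ∈ Θ) : IsProbabilityMeasure (law ν c b φ θ) :=
  ⟨by rw [law, withDensity_apply _ MeasurableSet.univ, setLIntegral_univ, h.lintegral_eq_one θ hθ]⟩

theorem eventuallyEq (h : IsExpFamily ν c b Θ φ) (hθ : θ ∈ Θ) :
    b =ᶠ[𝓝 θ] fun s => φ * cgf id (carrier ν c) (φ⁻¹ * s) := by
  filter_upwards [h.isOpen_Θ.mem_nhds hθ] with s hs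
  rw [inv_mul_eq_div, h.cgf_carrier hs, mul_div_cancel₀ _ h.φ_pos.ne']

theorem analyticAt (h : IsExpFamily ν c b Θ φ) (hθ : θ ∈ Θ) : AnalyticAt ℝ b θ := by
  refine AnalyticAt.congr ?_ (h.eventuallyEq hθ).symm
  refine analyticAt_const.mul (AnalyticAt.fun_comp (f := fun s => φ⁻¹ * s) ?_ (by fun_prop))
  rw [inv_mul_eq_div]
  exact analyticAt_cgf (h.mem_interior hθ)

theorem deriv_eq (h : IsExpFamily ν c b Θ φ)
    (hθ : θ ∈ Θ) : deriv b θ = deriv (cgf id (carrier ν c)) (θ / φ) := by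
  rw [(h.eventuallyEq hθ).deriv_eq, deriv_const_mul_field, deriv_comp_mul_left, smul_eq_mul,
    mul_inv_cancel_left₀ h.φ_pos.ne', inv_mul_eq_div]

theorem iteratedDeriv_two_eq (h : IsExpFamily ν c b Θ φ) (hθ : θ ∈ Θ) :
    φ * iteratedDeriv 2 b θ = iteratedDeriv 2 (cgf id (carrier ν c)) (θ / φ) := by
  have h1 : deriv b =ᶠ[𝓝 θ] fun s => deriv (cgf id (carrier ν c)) (φ⁻¹ * s) := by
    filter_upwards [h.isOpen_Θ.mem_nhds hθ] with s hs
    rw [h.deriv_eq hs, inv_mul_eq_div]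
  rw [iteratedDeriv_succ, iteratedDeriv_one, h1.deriv_eq, deriv_comp_mul_left, smul_eq_mul,
    mul_inv_cancel_left₀ h.φ_pos.ne', inv_mul_eq_div, iteratedDeriv_succ, iteratedDeriv_one]

theorem memLp_law (h : IsExpFamily ν c b Θ φ) (hθ : θ ∈ Θ) : MemLp id 2 (law ν c b φ θ) := by
  rw [h.law_eq_tilted hθ]
  exact memLp_tilted_mul (h.mem_interior hθ) 2

theorem integral_law (h : IsExpFamily ν c b Θ φ)
    (hθ : θ ∈ Θ) : ∫ y, y ∂(law ν c b φ θ) = deriv b θ := by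
  rw [h.law_eq_tilted hθ, h.deriv_eq hθ, ← integral_tilted_mul_self (h.mem_interior hθ)]
  rfl

theorem variance_law (h : IsExpFamily ν c b Θ φ)
    (hθ : θ ∈ Θ) : Var[id; law ν c b φ θ] = φ * iteratedDeriv 2 b θ := by
  rw [h.law_eq_tilted hθ, h.iteratedDeriv_two_eq hθ, variance_tilted_mul (h.mem_interior hθ)]

theorem integral_sq_law (h : IsExpFamily ν c b Θ φ) (hθ : θ ∈ Θ) :
    ∫ y, (y - deriv b θ) ^ 2 ∂(law ν c b φ θ) = φ * iteratedDeriv 2 b θ := by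
  rw [← h.variance_law hθ, variance_eq_integral (by fun_prop)]
  simp only [id]
  rw [h.integral_law hθ]

/-- The form with the lower integral can be averaged over the covariates before any integrability is
known. -/
theorem lintegral_sq_law (h : IsExpFamily ν c b Θ φ) (hθ : θ ∈ Θ) :
    ∫⁻ y, ENNReal.ofReal ((y - deriv b θ) ^ 2) ∂(law ν c b φ θ) =
      ENNReal.ofReal (φ * iteratedDeriv 2 b θ) := by
  have := h.isProbabilityMeasure_law hθ
  rw [← h.integral_sq_law hθ, ofReal_integral_eq_lintegral_ofReal]
  · exact ((h.memLp_law hθ).sub (memLp_const (deriv b θ))).integrable_sq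
  · exact ae_of_all _ fun _ => sq_nonneg _

theorem iteratedDeriv_two_nonneg (h : IsExpFamily ν c b Θ φ)
    (hθ : θ ∈ Θ) : 0 ≤ iteratedDeriv 2 b θ := by
  have := variance_nonneg id (law ν c b φ θ)
  rw [h.variance_law hθ] at this
  exact nonneg_of_mul_nonneg_right this h.φ_pos

theorem continuousOn (h : IsExpFamily ν c b Θ φ) : ContinuousOn b Θ := fun _ hθ =>
  (h.analyticAt hθ).continuousAt.continuousWithinAt

theorem continuousOn_iteratedDeriv_two (h : IsExpFamily ν c b Θ φ)
    : ContinuousOn (iteratedDeriv 2 b) Θ := fun _ hθ => by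
  rw [iteratedDeriv_succ, iteratedDeriv_one]
  exact (h.analyticAt hθ).deriv.deriv.continuousAt.continuousWithinAt

theorem convexOn (h : IsExpFamily ν c b Θ φ) : ConvexOn ℝ Θ b := by
  refine convexOn_of_deriv2_nonneg' h.ordConnected_Θ.convex
    (fun x hx => (h.analyticAt hx).differentiableAt.differentiableWithinAt)
    (fun x hx => (h.analyticAt hx).deriv.differentiableAt.differentiableWithinAt) ?_
  intro x hx
  rw [← iteratedDeriv_eq_iterate]
  exact h.iteratedDeriv_two_nonneg hx

/-- Degeneracy of one member of the family entails degeneracy of all members. -/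
theorem iteratedDeriv_two_eq_zero (h : IsExpFamily ν c b Θ φ) {θ' : ℝ} (hθ : θ ∈ Θ) (hθ' : θ' ∈ Θ)
    (h0 : iteratedDeriv 2 b θ = 0) : iteratedDeriv 2 b θ' = 0 := by
  have h1 := h.isProbabilityMeasure_law hθ
  have h2 := h.isProbabilityMeasure_law hθ'
  -- Zero variance makes one law a point mass; all members are tilts of the same carrier, so the
  -- other law sits at the same point.
  have hae := ae_eq_integral_of_variance_eq_zero (h.memLp_law hθ)
    (by rw [h.variance_law hθ, h0, mul_zero])
  have hac : law ν c b φ θ' ≪ law ν c b φ θ := by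
    rw [h.law_eq_tilted hθ, h.law_eq_tilted hθ']
    exact (tilted_absolutelyContinuous _ _).trans
      (absolutelyContinuous_tilted (h.integrable_exp hθ))
  have hae' := hac.ae_le hae
  have hv : Var[id; law ν c b φ θ'] = 0 := by
    rw [variance_congr hae']
    rw [variance_eq_integral aemeasurable_const]
    simp
  rw [h.variance_law hθ'] at hv
  exact (mul_eq_zero.1 hv).resolve_left h.φ_pos.ne'

end IsExpFamily

end GVCMM

/-! ### Minimizers of convex functions that are close to a quadratic function. -/

section ConvexArgmin

variable {ι : Type*} [Fintype ι]

/-- The norm is the sup norm, so a ball is a cube, the convex hull of its finitely many vertices. -/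
theorem mem_convexHull_vertices {R : ℝ} {s : ι → ℝ} (hs : ‖s‖ ≤ R) :
    s ∈ convexHull ℝ (Set.pi univ fun _ : ι => ({-R, R} : Set ℝ)) := by
  rw [convexHull_pi]
  have hR : (0 : ℝ) ≤ R := (norm_nonneg s).trans hs
  intro i _
  rw [convexHull_pair, segment_eq_Icc (by linarith)]
  have := (norm_le_pi_norm s i).trans hs
  rw [Real.norm_eq_abs, abs_le] at this
  exact this

/-- A convex function that is close to a bounded Lipschitz function at finitely many suitable points
is close to it on a whole ball. -/
theorem exists_finite_convexOn_uniformly_close {R M L τ : ℝ} (hR : 0 ≤ R) (hM : 0 ≤ M) (hL : 0 ≤ L)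
    (hτ : 0 < τ) :
    ∃ N : Set (ι → ℝ), N.Finite ∧ ∃ δ > 0, ∀ (D : Set (ι → ℝ)) (f g : (ι → ℝ) → ℝ),
      ConvexOn ℝ D f → N ⊆ D → (∀ v ∈ N, |f v - g v| ≤ δ) →
      (∀ v, ‖v‖ ≤ R + 2 → |g v| ≤ M) →
      (∀ v w, ‖v‖ ≤ R + 2 → ‖w‖ ≤ R + 2 → |g v - g w| ≤ L * ‖v - w‖) →
      Metric.closedBall 0 R ⊆ D ∧ ContinuousOn f (Metric.closedBall 0 R) ∧
        ∀ v ∈ Metric.closedBall 0 R, |f v - g v| ≤ τ := by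
  set L' : ℝ := 2 * (3 * (M + 1)) with hL'
  obtain ⟨η, hη, hητ⟩ : ∃ η > 0, (L' + L) * η ≤ τ / 2 := by
    refine ⟨τ / 2 / (L' + L), by positivity, ?_⟩
    rw [mul_div_cancel₀]; positivity
  obtain ⟨T, hTsub, hTfin, hT⟩ :=
    (isCompact_closedBall (0 : ι → ℝ) R).finite_cover_balls hη
  set V : Set (ι → ℝ) := Set.pi univ fun _ : ι => ({-(R + 2), R + 2} : Set ℝ) with hV
  have hVfin : V.Finite := Set.Finite.pi fun _ => Set.toFinite _
  have hVnorm : ∀ v ∈ V, ‖v‖ ≤ R + 2 := fun v hv => by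
    rw [pi_norm_le_iff_of_nonneg (by linarith)]
    intro i
    rcases hv i (mem_univ i) with h | h
    · rw [h, norm_neg, Real.norm_of_nonneg (by linarith)]
    · rw [mem_singleton_iff.1 h, Real.norm_of_nonneg (by linarith)]
  -- The vertices of a larger cube bound f from above, the origin bounds it from below, and the net
  -- T carries the approximation.
  refine ⟨V ∪ T ∪ {0}, (hVfin.union hTfin).union (Set.finite_singleton _), min 1 (τ / 2),
    by positivity, fun D f g hf hND hclose hgM hgL => ?_⟩
  have hVD : V ⊆ D := fun v hv => hND (Or.inl (Or.inl hv))
  have hball : ∀ v : ι → ℝ, ‖v‖ ≤ R + 2 → v ∈ D := fun v hv =>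
    convexHull_min hVD hf.1 (mem_convexHull_vertices hv)
  have hup : ∀ v : ι → ℝ, ‖v‖ ≤ R + 2 → f v ≤ M + 1 := by
    intro v hv
    obtain ⟨y, hy, hyv⟩ := hf.exists_ge_of_mem_convexHull hVD (mem_convexHull_vertices hv)
    have h1 := hgM y (hVnorm y hy)
    have h2 := (hclose y (Or.inl (Or.inl hy))).trans (min_le_left _ _)
    rw [abs_le] at h1 h2
    linarith
  -- Reflection in the origin: f v ≥ 2 f 0 - f (-v), where f 0 ≥ -(M + 1) and f (-v) ≤ M + 1.
  have hlow : ∀ v : ι → ℝ, ‖v‖ ≤ R + 2 → -(3 * (M + 1)) ≤ f v := by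
    intro v hv
    have h0 : f 0 ≤ (1 / 2 : ℝ) * f v + (1 / 2 : ℝ) * f (-v) := by
      have := hf.2 (hball v hv) (hball (-v) (by rwa [norm_neg])) one_half_pos.le one_half_pos.le
        (add_halves 1)
      simpa using this
    have h1 := hgM 0 (by simp; linarith)
    have h2 := (hclose 0 (Or.inr rfl)).trans (min_le_left _ _)
    have h3 := hup (-v) (by rwa [norm_neg])
    rw [abs_le] at h1 h2
    linarith
  -- A bounded convex function is Lipschitz at distance 1 from the boundary of its domain; the ball
  -- of radius R + 1 still contains the one of radius R.
  have hlip : LipschitzOnWith (2 * (3 * (M + 1)) / 1).toNNReal f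
      (Metric.ball 0 (R + 2 - 1)) := by
    refine ConvexOn.lipschitzOnWith_of_abs_le
      (hf.subset (fun v hv => hball v (mem_ball_zero_iff.1 hv).le) (convex_ball _ _)) one_pos ?_
    intro v hv
    have hv' : ‖v‖ ≤ R + 2 := by rw [dist_zero_right] at hv; exact hv.le
    rw [abs_le]
    exact ⟨hlow v hv', by linarith [hup v hv']⟩
  have hsub : Metric.closedBall (0 : ι → ℝ) R ⊆ Metric.ball 0 (R + 2 - 1) :=
    Metric.closedBall_subset_ball (by linarith)
  refine ⟨fun v hv => hball v (by simp at hv; linarith), hlip.continuousOn.mono hsub, ?_⟩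
  intro v hv
  obtain ⟨w, hw, hvw⟩ := mem_iUnion₂.1 (hT hv)
  rw [Metric.mem_ball, dist_eq_norm] at hvw
  have h1 : |f v - f w| ≤ L' * ‖v - w‖ := by
    have := hlip.dist_le_mul v (hsub hv) w (hsub (hTsub hw))
    rwa [Real.dist_eq, dist_eq_norm, div_one, Real.coe_toNNReal _ (by positivity)] at this
  have hv' : ‖v‖ ≤ R + 2 := by simp at hv; linarith
  have hw' : ‖w‖ ≤ R + 2 := by have := hTsub hw; simp at this; linarith
  have h2 := hgL v w hv' hw'
  have h3 := (hclose w (Or.inl (Or.inr hw))).trans (min_le_right _ _)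
  have h4 : (L' + L) * ‖v - w‖ ≤ τ / 2 :=
    (mul_le_mul_of_nonneg_left hvw.le (by positivity)).trans hητ
  rw [abs_le] at h1 h2 h3 ⊢
  constructor <;> linarith

theorem abs_dotProduct_mulVec_le (J : Matrix ι ι ℝ) (v w : ι → ℝ) :
    |v ⬝ᵥ J *ᵥ w| ≤ (∑ i, ∑ j, |J i j|) * (‖v‖ * ‖w‖) := by
  simp only [dotProduct, Matrix.mulVec, Finset.mul_sum, Finset.sum_mul]
  refine (Finset.abs_sum_le_sum_abs _ _).trans (Finset.sum_le_sum fun i _ => ?_)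
  refine (Finset.abs_sum_le_sum_abs _ _).trans (Finset.sum_le_sum fun j _ => ?_)
  rw [abs_mul, abs_mul]
  have h1 : |v i| ≤ ‖v‖ := norm_le_pi_norm v i
  have h2 : |w j| ≤ ‖w‖ := norm_le_pi_norm w j
  calc |v i| * (|J i j| * |w j|) = |J i j| * (|v i| * |w j|) := by ring
    _ ≤ _ := by gcongr

/-- By homogeneity, c can be the minimum of the quadratic form on the compact unit sphere. -/
theorem Matrix.PosDef.exists_mul_sq_norm_le {J : Matrix ι ι ℝ} (hJ : J.PosDef) :
    ∃ c > 0, ∀ s : ι → ℝ, c * ‖s‖ ^ 2 ≤ s ⬝ᵥ J *ᵥ s := by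
  cases isEmpty_or_nonempty ι with
  | inl h => exact ⟨1, one_pos, fun s => by simp [Subsingleton.elim s 0]⟩
  | inr h =>
    have hcont : Continuous fun s : ι → ℝ => s ⬝ᵥ J *ᵥ s := by fun_prop
    obtain ⟨s₀, hs₀, hmin⟩ := (isCompact_sphere (0 : ι → ℝ) 1).exists_isMinOn
      (NormedSpace.sphere_nonempty.2 zero_le_one) hcont.continuousOn
    have hne : s₀ ≠ 0 := by
      rintro rfl; simp at hs₀
    have hpos : ∀ s : ι → ℝ, s ≠ 0 → 0 < s ⬝ᵥ J *ᵥ s := fun s hs => by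
      simpa using hJ.dotProduct_mulVec_pos hs
    refine ⟨s₀ ⬝ᵥ J *ᵥ s₀, hpos s₀ hne, fun s => ?_⟩
    by_cases hs : s = 0
    · simp [hs]
    have hn : ‖s‖ ≠ 0 := norm_ne_zero_iff.2 hs
    have : s₀ ⬝ᵥ J *ᵥ s₀ ≤ (‖s‖⁻¹ • s) ⬝ᵥ J *ᵥ (‖s‖⁻¹ • s) := hmin (by simp [norm_smul, hn])
    simp only [Matrix.mulVec_smul, dotProduct_smul, smul_dotProduct, smul_eq_mul] at this
    have h3 : s ⬝ᵥ J *ᵥ s = (‖s‖⁻¹ * (‖s‖⁻¹ * (s ⬝ᵥ J *ᵥ s))) * ‖s‖ ^ 2 := by field_simp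
    rw [h3]
    exact mul_le_mul_of_nonneg_right this (sq_nonneg _)

/-- A convex function that is close, at finitely many suitable points, to a positive definite
quadratic function has a minimizer, and all its minimizers are close to the vertex. -/
theorem exists_finite_convexOn_argmin_close {J : Matrix ι ι ℝ} (hJ : J.PosDef) {K ρ : ℝ}
    (hK : 0 ≤ K) (hρ : 0 < ρ) :
    ∃ N : Set (ι → ℝ), N.Finite ∧ ∃ δ > 0,
      ∀ (s₀ : ι → ℝ) (D : Set (ι → ℝ)) (f : (ι → ℝ) → ℝ), ‖s₀‖ ≤ K →
      ConvexOn ℝ D f → N ⊆ D →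
      (∀ v ∈ N, |f v - (1 / 2 * (v ⬝ᵥ J *ᵥ v) - (J *ᵥ s₀) ⬝ᵥ v)| ≤ δ) →
      (∃ s ∈ D, IsMinOn f D s) ∧ ∀ s ∈ D, IsMinOn f D s → ‖s - s₀‖ ≤ ρ := by
  obtain ⟨c, hc, hcJ⟩ := hJ.exists_mul_sq_norm_le
  have hsymm : ∀ v w, v ⬝ᵥ J *ᵥ w = w ⬝ᵥ J *ᵥ v := fun v w => by
    have h1 : Jᵀ = J := by rw [← Matrix.conjTranspose_eq_transpose_of_trivial, hJ.1.eq]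
    rw [Matrix.dotProduct_mulVec, ← Matrix.mulVec_transpose, h1, dotProduct_comm]
  set A : ℝ := ∑ i, ∑ j, |J i j| with hA
  have hA0 : 0 ≤ A := Finset.sum_nonneg fun i _ => Finset.sum_nonneg fun j _ => abs_nonneg _
  have hAJ : ∀ v w, |v ⬝ᵥ J *ᵥ w| ≤ A * (‖v‖ * ‖w‖) := abs_dotProduct_mulVec_le J
  set R := K + ρ with hR
  -- On the sphere of radius ρ about s₀ the quadratic function exceeds its minimum by at least
  -- cρ²/2. Two errors of size τ = cρ²/8 leave a positive gap for f. The constants M and L depend on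
  -- s₀ only through K, so the finite set serves all vertices s₀ in the ball; this matters because
  -- s₀ will be random.
  obtain ⟨N, hN, δ, hδ, hmain⟩ := exists_finite_convexOn_uniformly_close (ι := ι) (R := R)
    (M := A * ((R + 2) * (R + 2)) + A * (K * (R + 2)))
    (L := A * (R + 2) + A * K) (τ := c * ρ ^ 2 / 8) (by positivity) (by positivity)
    (by positivity) (by positivity)
  refine ⟨N, hN, δ, hδ, fun s₀ D f hs₀ hf hND hclose => ?_⟩
  set g : (ι → ℝ) → ℝ := fun v => 1 / 2 * (v ⬝ᵥ J *ᵥ v) - (J *ᵥ s₀) ⬝ᵥ v with hg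
  have hcross : ∀ v, (J *ᵥ s₀) ⬝ᵥ v = v ⬝ᵥ J *ᵥ s₀ := fun v => dotProduct_comm _ _
  have hR2 : (0 : ℝ) ≤ R + 2 := by positivity
  obtain ⟨hballD, hcont, hunif⟩ := hmain D f g hf hND hclose (by
      intro v hv
      have h1 : |v ⬝ᵥ J *ᵥ v| ≤ A * ((R + 2) * (R + 2)) := (hAJ v v).trans (by gcongr)
      have h2 : |v ⬝ᵥ J *ᵥ s₀| ≤ A * (K * (R + 2)) := (hAJ v s₀).trans (by
        rw [mul_comm ‖v‖]; gcongr)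
      simp only [hg, hcross]
      rw [abs_le] at h1 h2 ⊢
      constructor <;> nlinarith [h1.1, h1.2, h2.1, h2.2]) (by
      intro v w hv hw
      have h1 : |(v - w) ⬝ᵥ J *ᵥ v| ≤ A * (R + 2) * ‖v - w‖ := (hAJ _ v).trans (by
        rw [mul_comm ‖v - w‖, ← mul_assoc]; gcongr)
      have h2 : |(v - w) ⬝ᵥ J *ᵥ w| ≤ A * (R + 2) * ‖v - w‖ := (hAJ _ w).trans (by
        rw [mul_comm ‖v - w‖, ← mul_assoc]; gcongr)
      have h3 : |(v - w) ⬝ᵥ J *ᵥ s₀| ≤ A * K * ‖v - w‖ := (hAJ _ s₀).trans (by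
        rw [mul_comm ‖v - w‖, ← mul_assoc]; gcongr)
      have h4 : g v - g w = 1 / 2 * ((v - w) ⬝ᵥ J *ᵥ v) + 1 / 2 * ((v - w) ⬝ᵥ J *ᵥ w) -
          (v - w) ⬝ᵥ J *ᵥ s₀ := by
        simp only [hg, hcross, sub_dotProduct]
        rw [hsymm v w]; ring
      rw [h4]
      rw [abs_le] at h1 h2 h3 ⊢
      constructor <;> linarith [h1.1, h1.2, h2.1, h2.2, h3.1, h3.2])
  have hgap : ∀ v, g v - g s₀ = 1 / 2 * ((v - s₀) ⬝ᵥ J *ᵥ (v - s₀)) := by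
    intro v
    simp only [hg, hcross, sub_dotProduct, Matrix.mulVec_sub, dotProduct_sub]
    rw [hsymm s₀ v]; ring
  have hin : Metric.closedBall s₀ ρ ⊆ Metric.closedBall 0 R :=
    Metric.closedBall_subset_closedBall' (by simp; linarith)
  have hs₀D : s₀ ∈ D := hballD (hin (Metric.mem_closedBall_self hρ.le))
  have hsphere : ∀ v, ‖v - s₀‖ = ρ → f s₀ < f v := by
    intro v hv
    have h1 := hunif v (hin (by simp [dist_eq_norm, hv]))
    have h2 := hunif s₀ (hin (Metric.mem_closedBall_self hρ.le))
    have h3 := hgap v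
    have h4 := hcJ (v - s₀)
    rw [hv] at h4
    rw [abs_le] at h1 h2
    have : 0 < c * ρ ^ 2 := by positivity
    linarith
  -- Moving v back along the ray to s₀ until it meets the sphere, convexity carries the strict gap
  -- from the sphere to everything beyond it.
  have hout : ∀ v ∈ D, ρ < ‖v - s₀‖ → f s₀ < f v := by
    intro v hv hlt
    set t := ρ / ‖v - s₀‖ with ht
    have hpos : 0 < ‖v - s₀‖ := hρ.trans hlt
    have ht0 : 0 < t := div_pos hρ hpos
    have ht1 : t < 1 := (div_lt_one hpos).2 hlt
    have h1 := hf.2 hs₀D hv (sub_nonneg.2 ht1.le) ht0.le (sub_add_cancel 1 t)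
    have h2 := hsphere ((1 - t) • s₀ + t • v) (by
      rw [show (1 - t) • s₀ + t • v - s₀ = t • (v - s₀) by module, norm_smul,
        Real.norm_of_nonneg ht0.le, ht, div_mul_cancel₀ _ hpos.ne'])
    simp only [smul_eq_mul] at h1
    nlinarith
  refine ⟨?_, fun s hs hmin => ?_⟩
  -- A minimizer over the compact ball is global, as f exceeds f s₀ outside.
  · obtain ⟨s, hs, hmin⟩ := (isCompact_closedBall s₀ ρ).exists_isMinOn
      ⟨s₀, Metric.mem_closedBall_self hρ.le⟩ (hcont.mono hin)
    refine ⟨s, hballD (hin hs), fun v hv => ?_⟩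
    by_cases h : ‖v - s₀‖ ≤ ρ
    · exact hmin (by simpa [dist_eq_norm] using h)
    · exact (hmin (Metric.mem_closedBall_self hρ.le)).trans (hout v hv (not_le.1 h)).le
  · by_contra h
    exact absurd (hmin hs₀D) (not_le.2 (hout s hs (not_le.1 h)))

end ConvexArgmin

/-! ### Calculus of smallness and boundedness in probability. -/

section InProbability

variable {Ω : Type*} [MeasurableSpace Ω] {μ : Measure Ω} {E : Type*} [NormedAddCommGroup E]

/-- `f n` converges to zero in probability. -/
def SmallInProb (μ : Measure Ω) (f : ℕ → Ω → E) : Prop :=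
  ∀ ε > 0, Tendsto (fun n => μ {ω | ε ≤ ‖f n ω‖}) atTop (𝓝 0)

/-- `f n` is bounded in probability. -/
def BoundedInProb (μ : Measure Ω) (f : ℕ → Ω → E) : Prop :=
  ∀ ε > 0, ∃ K > 0, ∀ᶠ n in atTop, μ {ω | K ≤ ‖f n ω‖} ≤ ENNReal.ofReal ε

theorem SmallInProb.tendstoInMeasure {f : ℕ → Ω → E} (h : SmallInProb μ f) :
    TendstoInMeasure μ f atTop 0 := by
  rw [tendstoInMeasure_iff_norm]
  intro ε hε
  simpa using h ε hε

theorem smallInProb_iff {f : ℕ → Ω → E} :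
    SmallInProb μ f ↔ ∀ ε > 0, ∀ η > 0, ∀ᶠ n in atTop, μ {ω | ε ≤ ‖f n ω‖} ≤ ENNReal.ofReal η := by
  refine forall₂_congr fun ε hε => ?_
  rw [ENNReal.tendsto_nhds_zero]
  constructor
  · intro h η hη
    exact h _ (ENNReal.ofReal_pos.2 hη)
  · intro h η hη
    rcases eq_or_ne η ⊤ with rfl | htop
    · exact Eventually.of_forall fun _ => le_top
    · filter_upwards [h η.toReal (ENNReal.toReal_pos hη.ne' htop)] with n hn
      rwa [ENNReal.ofReal_toReal htop] at hn

theorem SmallInProb.mono {F : Type*} [NormedAddCommGroup F] {f : ℕ → Ω → E} {g : ℕ → Ω → F}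
    (hg : SmallInProb μ g) (h : ∀ᶠ n in atTop, ∀ᵐ ω ∂μ, ‖f n ω‖ ≤ ‖g n ω‖) : SmallInProb μ f := by
  intro ε hε
  refine tendsto_of_tendsto_of_tendsto_of_le_of_le' tendsto_const_nhds (hg ε hε)
    (Eventually.of_forall fun _ => zero_le) ?_
  filter_upwards [h] with n hn
  refine measure_mono_ae ?_
  filter_upwards [hn] with ω hω h1
  exact le_trans h1 hω

theorem SmallInProb.congr {f g : ℕ → Ω → E} (hg : SmallInProb μ g)
    (h : ∀ᶠ n in atTop, f n =ᵐ[μ] g n) : SmallInProb μ f :=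
  hg.mono (h.mono fun n hn => by filter_upwards [hn] with ω hω; rw [hω])

theorem BoundedInProb.mono {F : Type*} [NormedAddCommGroup F] {f : ℕ → Ω → E} {g : ℕ → Ω → F}
    (hg : BoundedInProb μ g) (h : ∀ᶠ n in atTop, ∀ᵐ ω ∂μ, ‖f n ω‖ ≤ ‖g n ω‖) :
    BoundedInProb μ f := by
  intro ε hε
  obtain ⟨K, hK, hn⟩ := hg ε hε
  refine ⟨K, hK, ?_⟩
  filter_upwards [hn, h] with n hn h
  refine le_trans (measure_mono_ae ?_) hn
  filter_upwards [h] with ω hω h1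
  exact le_trans h1 hω

/-- Only monotonicity and subadditivity of μ enter, so no measurability is required of the
functions. -/
theorem SmallInProb.add {f g : ℕ → Ω → E} (hf : SmallInProb μ f) (hg : SmallInProb μ g) :
    SmallInProb μ (fun n ω => f n ω + g n ω) := by
  intro ε hε
  have := (hf (ε / 2) (by positivity)).add (hg (ε / 2) (by positivity))
  rw [add_zero] at this
  refine tendsto_of_tendsto_of_tendsto_of_le_of_le tendsto_const_nhds this (fun _ => zero_le) ?_
  intro n
  refine (measure_mono ?_).trans (measure_union_le _ _)
  intro ω hω
  by_contra h
  simp only [mem_union, mem_ofPred_eq, not_or, not_le] at h hω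
  linarith [norm_add_le (f n ω) (g n ω)]

theorem smallInProb_zero : SmallInProb μ (fun _ _ => (0 : E)) := by
  intro ε hε
  simp [hε.not_ge]

theorem SmallInProb.sum {κ : Type*} (s : Finset κ) {f : κ → ℕ → Ω → E}
    (hf : ∀ k ∈ s, SmallInProb μ (f k)) : SmallInProb μ (fun n ω => ∑ k ∈ s, f k n ω) := by
  classical
  induction s using Finset.induction_on with
  | empty => simpa using smallInProb_zero
  | insert a s ha ih =>
    simp only [Finset.sum_insert ha]
    exact (hf a (Finset.mem_insert_self _ _)).add
      (ih fun k hk => hf k (Finset.mem_insert_of_mem hk))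

theorem BoundedInProb.add {f g : ℕ → Ω → E} (hf : BoundedInProb μ f) (hg : BoundedInProb μ g) :
    BoundedInProb μ (fun n ω => f n ω + g n ω) := by
  intro ε hε
  obtain ⟨K, hK, h1⟩ := hf (ε / 2) (by positivity)
  obtain ⟨L, hL, h2⟩ := hg (ε / 2) (by positivity)
  refine ⟨K + L, by positivity, ?_⟩
  filter_upwards [h1, h2] with n h1 h2
  calc μ {ω | K + L ≤ ‖f n ω + g n ω‖} ≤ μ ({ω | K ≤ ‖f n ω‖} ∪ {ω | L ≤ ‖g n ω‖}) := by
        refine measure_mono fun ω hω => ?_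
        by_contra h
        simp only [mem_union, mem_ofPred_eq, not_or, not_le] at h hω
        linarith [norm_add_le (f n ω) (g n ω)]
    _ ≤ _ := measure_union_le _ _
    _ ≤ ENNReal.ofReal (ε / 2) + ENNReal.ofReal (ε / 2) := add_le_add h1 h2
    _ = _ := by rw [← ENNReal.ofReal_add (by positivity) (by positivity), add_halves]

theorem SmallInProb.boundedInProb {f : ℕ → Ω → E} (hf : SmallInProb μ f) : BoundedInProb μ f :=
  fun ε hε => ⟨1, one_pos, smallInProb_iff.1 hf 1 one_pos ε hε⟩

theorem boundedInProb_const [IsFiniteMeasure μ] (c : E) : BoundedInProb μ (fun _ _ => c) := by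
  intro ε hε
  refine ⟨‖c‖ + 1, by positivity, Eventually.of_forall fun n => ?_⟩
  have : {ω : Ω | ‖c‖ + 1 ≤ ‖c‖} = ∅ := by ext; simp
  rw [this, measure_empty]
  exact zero_le

theorem BoundedInProb.sum [IsFiniteMeasure μ] {κ : Type*} (s : Finset κ) {f : κ → ℕ → Ω → E}
    (hf : ∀ k ∈ s, BoundedInProb μ (f k)) : BoundedInProb μ (fun n ω => ∑ k ∈ s, f k n ω) := by
  classical
  induction s using Finset.induction_on with
  | empty => simpa using boundedInProb_const 0
  | insert a s ha ih =>
    simp only [Finset.sum_insert ha]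
    exact (hf a (Finset.mem_insert_self _ _)).add
      (ih fun k hk => hf k (Finset.mem_insert_of_mem hk))

theorem SmallInProb.mul_bounded {f g : ℕ → Ω → ℝ} (hf : SmallInProb μ f) (hg : BoundedInProb μ g) :
    SmallInProb μ (fun n ω => f n ω * g n ω) := by
  rw [smallInProb_iff]
  intro ε hε η hη
  obtain ⟨K, hK, h1⟩ := hg (η / 2) (by positivity)
  filter_upwards [h1, smallInProb_iff.1 hf (ε / K) (by positivity) (η / 2) (by positivity)]
    with n h1 h2
  calc μ {ω | ε ≤ ‖f n ω * g n ω‖} ≤ μ ({ω | ε / K ≤ ‖f n ω‖} ∪ {ω | K ≤ ‖g n ω‖}) := by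
        refine measure_mono fun ω hω => ?_
        by_contra h
        simp only [mem_union, mem_ofPred_eq, not_or, not_le, norm_mul] at h hω
        have : ‖f n ω‖ * ‖g n ω‖ < ε / K * K :=
          mul_lt_mul'' h.1 h.2 (norm_nonneg _) (norm_nonneg _)
        rw [div_mul_cancel₀ _ hK.ne'] at this
        linarith
    _ ≤ _ := measure_union_le _ _
    _ ≤ ENNReal.ofReal (η / 2) + ENNReal.ofReal (η / 2) := add_le_add h2 h1
    _ = _ := by rw [← ENNReal.ofReal_add (by positivity) (by positivity), add_halves]

theorem BoundedInProb.mul {f g : ℕ → Ω → ℝ} (hf : BoundedInProb μ f) (hg : BoundedInProb μ g) :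
    BoundedInProb μ (fun n ω => f n ω * g n ω) := by
  intro ε hε
  obtain ⟨K, hK, h1⟩ := hf (ε / 2) (by positivity)
  obtain ⟨L, hL, h2⟩ := hg (ε / 2) (by positivity)
  refine ⟨K * L, by positivity, ?_⟩
  filter_upwards [h1, h2] with n h1 h2
  calc μ {ω | K * L ≤ ‖f n ω * g n ω‖} ≤ μ ({ω | K ≤ ‖f n ω‖} ∪ {ω | L ≤ ‖g n ω‖}) := by
        refine measure_mono fun ω hω => ?_
        by_contra h
        simp only [mem_union, mem_ofPred_eq, not_or, not_le, norm_mul] at h hω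
        have : ‖f n ω‖ * ‖g n ω‖ < K * L :=
          mul_lt_mul'' h.1 h.2 (norm_nonneg _) (norm_nonneg _)
        linarith
    _ ≤ _ := measure_union_le _ _
    _ ≤ ENNReal.ofReal (ε / 2) + ENNReal.ofReal (ε / 2) := add_le_add h1 h2
    _ = _ := by rw [← ENNReal.ofReal_add (by positivity) (by positivity), add_halves]

theorem SmallInProb.const_mul [IsFiniteMeasure μ] {f : ℕ → Ω → ℝ} (hf : SmallInProb μ f) (c : ℝ) :
    SmallInProb μ (fun n ω => c * f n ω) := by
  simpa only [mul_comm] using hf.mul_bounded (boundedInProb_const c)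

theorem smallInProb_of_tendsto [IsFiniteMeasure μ] {c : ℕ → ℝ} (hc : Tendsto c atTop (𝓝 0)) :
    SmallInProb μ (fun n (_ : Ω) => c n) := by
  rw [smallInProb_iff]
  intro ε hε η hη
  filter_upwards [hc.norm.eventually_lt_const (by simpa using hε)] with n hn
  have : {ω : Ω | ε ≤ ‖c n‖} = ∅ := by ext; simpa using hn
  rw [this, measure_empty]
  exact zero_le

theorem smallInProb_pi {ι : Type*} [Fintype ι] {f : ℕ → Ω → ι → ℝ}
    (hf : ∀ i, SmallInProb μ (fun n ω => f n ω i)) : SmallInProb μ f := by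
  have h1 : SmallInProb μ (fun n ω => ∑ i, |f n ω i|) :=
    SmallInProb.sum _ fun i _ => (hf i).mono (Eventually.of_forall fun n => by simp)
  refine h1.mono (Eventually.of_forall fun n => ae_of_all _ fun ω => ?_)
  rw [Real.norm_of_nonneg (Finset.sum_nonneg fun _ _ => abs_nonneg _)]
  refine (pi_norm_le_iff_of_nonneg (Finset.sum_nonneg fun _ _ => abs_nonneg _)).2 fun i => ?_
  exact Finset.single_le_sum (f := fun i => |f n ω i|) (fun _ _ => abs_nonneg _)
    (Finset.mem_univ i)

theorem SmallInProb.eval {ι : Type*} [Fintype ι] {f : ℕ → Ω → ι → ℝ} (hf : SmallInProb μ f)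
    (i : ι) : SmallInProb μ (fun n ω => f n ω i) :=
  hf.mono (Eventually.of_forall fun _ => ae_of_all _ fun _ => norm_le_pi_norm _ _)

theorem boundedInProb_pi [IsFiniteMeasure μ] {ι : Type*} [Fintype ι] {f : ℕ → Ω → ι → ℝ}
    (hf : ∀ i, BoundedInProb μ (fun n ω => f n ω i)) : BoundedInProb μ f := by
  have h1 : BoundedInProb μ (fun n ω => ∑ i, |f n ω i|) :=
    BoundedInProb.sum _ fun i _ => (hf i).mono (Eventually.of_forall fun n => by simp)
  refine h1.mono (Eventually.of_forall fun n => ae_of_all _ fun ω => ?_)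
  rw [Real.norm_of_nonneg (Finset.sum_nonneg fun _ _ => abs_nonneg _)]
  refine (pi_norm_le_iff_of_nonneg (Finset.sum_nonneg fun _ _ => abs_nonneg _)).2 fun i => ?_
  exact Finset.single_le_sum (f := fun i => |f n ω i|) (fun _ _ => abs_nonneg _)
    (Finset.mem_univ i)

theorem smallInProb_of_ae_tendsto [IsFiniteMeasure μ] {f : ℕ → Ω → ℝ}
    (hf : ∀ n, AEStronglyMeasurable (f n) μ)
    (h : ∀ᵐ ω ∂μ, Tendsto (fun n => f n ω) atTop (𝓝 0)) : SmallInProb μ f := by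
  have := tendstoInMeasure_of_tendsto_ae hf (g := fun _ => 0) h
  rw [tendstoInMeasure_iff_norm] at this
  intro ε hε
  simpa using this ε hε

theorem smallInProb_of_tendsto_integral {f : ℕ → Ω → ℝ} (hint : ∀ᶠ n in atTop, Integrable (f n) μ)
    (h : Tendsto (fun n => ∫ ω, |f n ω| ∂μ) atTop (𝓝 0)) : SmallInProb μ f := by
  rw [smallInProb_iff]
  intro ε hε η hη
  filter_upwards [hint, h.eventually_lt_const (show 0 < ε * η by positivity)] with n hn hlt
  have h1 := meas_ge_le_lintegral_div (μ := μ) (f := fun ω => ENNReal.ofReal |f n ω|)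
    hn.1.aemeasurable.abs.ennreal_ofReal (ε := ENNReal.ofReal ε) (by simpa using hε)
    ENNReal.ofReal_ne_top
  rw [← ofReal_integral_eq_lintegral_ofReal hn.abs (ae_of_all _ fun _ => abs_nonneg _),
    ← ENNReal.ofReal_div_of_pos hε] at h1
  refine le_trans (measure_mono fun ω hω => ?_) (h1.trans (ENNReal.ofReal_le_ofReal ?_))
  · exact ENNReal.ofReal_le_ofReal hω
  · rw [div_le_iff₀ hε, mul_comm]; exact hlt.le

/-- Normalized sums of centred i.i.d. square integrable variables are bounded in probability. -/
theorem boundedInProb_normalized_sum [IsProbabilityMeasure μ] {X : ℕ → Ω → ℝ}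
    (hX : MemLp (X 0) 2 μ) (h0 : ∫ ω, X 0 ω ∂μ = 0)
    (hindep : Pairwise fun i j => IndepFun (X i) (X j) μ)
    (hident : ∀ i, IdentDistrib (X i) (X 0) μ μ) :
    BoundedInProb μ (fun n ω => (√(n : ℝ))⁻¹ * ∑ i ∈ Finset.range n, X i ω) := by
  intro ε hε
  set v := Var[X 0; μ] with hv
  have hv0 : 0 ≤ v := variance_nonneg _ _
  have hLp : ∀ i, MemLp (X i) 2 μ := fun i => (hident i).memLp_iff.2 hX
  have hmean : ∀ i, ∫ ω, X i ω ∂μ = 0 := fun i => by rw [(hident i).integral_eq, h0]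
  -- Chebyshev's bound v / K² is at most ε; the summand 1 keeps K positive when v = 0.
  set K := √(v / ε) + 1 with hK
  have hKpos : 0 < K := by positivity
  refine ⟨K, hKpos, ?_⟩
  filter_upwards [eventually_gt_atTop 0] with n hn
  have hn' : (0 : ℝ) < n := by exact_mod_cast hn
  have hL : MemLp (fun ω => (√(n : ℝ))⁻¹ * ∑ i ∈ Finset.range n, X i ω) 2 μ :=
    (memLp_finsetSum _ fun i _ => hLp i).const_mul _
  have hvar : Var[fun ω => (√(n : ℝ))⁻¹ * ∑ i ∈ Finset.range n, X i ω; μ] = v := by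
    rw [variance_const_mul]
    have h1 : (fun ω => ∑ i ∈ Finset.range n, X i ω) = ∑ i ∈ Finset.range n, X i := by
      ext ω; simp
    rw [h1, IndepFun.variance_sum (fun i _ => hLp i) (fun i _ j _ hij => hindep hij)]
    simp only [fun i => (hident i).variance_eq, Finset.sum_const, Finset.card_range, nsmul_eq_mul]
    rw [inv_pow, Real.sq_sqrt hn'.le]
    field_simp
    rfl
  have hm : ∫ ω, (√(n : ℝ))⁻¹ * ∑ i ∈ Finset.range n, X i ω ∂μ = 0 := by
    rw [integral_const_mul, integral_finsetSum _ fun i _ => (hLp i).integrable one_le_two]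
    simp [hmean]
  have := meas_ge_le_variance_div_sq hL hKpos
  simp only [hm, sub_zero, hvar] at this
  refine this.trans (ENNReal.ofReal_le_ofReal ?_)
  rw [div_le_iff₀ (by positivity)]
  have h2 : v / ε ≤ K ^ 2 := by
    have h3 := Real.sq_sqrt (show 0 ≤ v / ε by positivity)
    have h4 := Real.sqrt_nonneg (v / ε)
    nlinarith
  rwa [div_le_iff₀ hε, mul_comm] at h2

theorem smallInProb_mean_sub [IsProbabilityMeasure μ] {X : ℕ → Ω → ℝ}
    (hX : Integrable (X 0) μ) (hindep : Pairwise fun i j => IndepFun (X i) (X j) μ)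
    (hident : ∀ i, IdentDistrib (X i) (X 0) μ μ) :
    SmallInProb μ (fun n ω => (∑ i ∈ Finset.range n, X i ω) / n - ∫ ω, X 0 ω ∂μ) := by
  refine smallInProb_of_ae_tendsto (fun n => ?_) ?_
  · have : ∀ i, AEMeasurable (X i) μ := fun i => (hident i).aemeasurable_fst
    have h2 : AEMeasurable (fun ω => ∑ i ∈ Finset.range n, X i ω) μ :=
      Finset.aemeasurable_fun_sum _ fun i _ => this i
    exact ((h2.div_const _).sub_const _).aestronglyMeasurable
  · filter_upwards [strong_law_ae_real X hX hindep hident] with ω hω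
    simpa using hω.sub_const (∫ ω, X 0 ω ∂μ)

end InProbability

/-! ### The central limit theorem in a Euclidean space. -/

section MultivariateCLT

variable {Ω : Type*} [MeasurableSpace Ω] {μ : Measure Ω} [IsProbabilityMeasure μ]
  {E : Type*} [NormedAddCommGroup E] [InnerProductSpace ℝ E] [FiniteDimensional ℝ E]
  [MeasurableSpace E] [BorelSpace E]

/-- The central limit theorem for standardized random vectors. -/
theorem tendstoInDistribution_stdGaussian {X : ℕ → Ω → E} (hmeas : ∀ i, Measurable (X i))
    (hindep : iIndepFun X μ) (hident : ∀ i, IdentDistrib (X i) (X 0) μ μ)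
    (hLp : ∀ t, MemLp (fun ω => inner ℝ (X 0 ω) t) 2 μ)
    (hmean : ∀ t, ∫ ω, inner ℝ (X 0 ω) t ∂μ = 0)
    (hvar : ∀ t, ∫ ω, inner ℝ (X 0 ω) t ^ 2 ∂μ = ‖t‖ ^ 2) :
    TendstoInDistribution (fun (n : ℕ) ω => (√(n : ℝ))⁻¹ • ∑ i ∈ Finset.range n, X i ω) atTop
      (id : E → E) (fun _ => μ) (stdGaussian E) where
  forall_aemeasurable n := by fun_prop
  tendsto := by
    refine ProbabilityMeasure.tendsto_iff_tendsto_charFun.2 fun t => ?_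
    have hm : Measurable fun x : E => inner ℝ x t := by fun_prop
    have h1 := tendstoInDistribution_inv_sqrt_mul_sum_sub (P := μ)
      (X := fun i ω => inner ℝ (X i ω) t) (Y := id)
      (P' := gaussianReal 0 Var[fun ω => inner ℝ (X 0 ω) t; μ].toNNReal)
      ⟨aemeasurable_id, Measure.map_id⟩ (hLp t)
      (hindep.comp (fun _ x => inner ℝ x t) (fun _ => hm)) (fun i => (hident i).comp hm)
    -- Cramér–Wold: the characteristic function of the vector sum at t is that of the scalar sum of
    -- the projections on t at the point 1.
    have h2 := (ProbabilityMeasure.tendsto_iff_tendsto_charFun.1 h1.tendsto) 1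
    simp only [ProbabilityMeasure.coe_mk, Measure.map_id, charFun_gaussianReal, hmean t] at h2 ⊢
    rw [charFun_stdGaussian]
    have hv : Var[fun ω => inner ℝ (X 0 ω) t; μ] = ‖t‖ ^ 2 := by
      rw [variance_of_integral_eq_zero (hLp t).aestronglyMeasurable.aemeasurable (hmean t)]
      exact hvar t
    rw [hv, Real.coe_toNNReal _ (by positivity)] at h2
    convert h2 using 2
    · rename_i n
      rw [charFun_apply, charFun_apply_real, integral_map (by fun_prop) (by fun_prop),
        integral_map (by fun_prop) (by fun_prop)]
      congr with ω
      simp [sum_inner, inner_smul_left]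
    · push_cast
      simp
      ring_nf

end MultivariateCLT

/-! ### Moments of the response residual given the covariates. -/

namespace GVCMM.IsExpFamily

variable {ν : Measure ℝ} {c b : ℝ → ℝ} {Θ : Set ℝ} {φ : ℝ}
  {Ω 𝓦 : Type*} [MeasurableSpace Ω] [MeasurableSpace 𝓦] {μ : Measure Ω} [IsProbabilityMeasure μ]
  {W : Ω → 𝓦} {Y : Ω → ℝ} {η : 𝓦 → ℝ}

/-- The joint law of (W, Y) is disintegrated over W, and the inner integral is the conditional
variance φ b''. Working with lower integrals lets the identity itself deliver square integrability
in `memLp_residual`. -/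
theorem lintegral_sq_residual (h : IsExpFamily ν c b Θ φ) (hW : Measurable W)
    (hY : Measurable Y) (hη : Measurable η) (hmem : ∀ᵐ w ∂(μ.map W), η w ∈ Θ)
    (hcond : ∀ᵐ w ∂(μ.map W), condDistrib Y W μ w = law ν c b φ (η w))
    {g : 𝓦 → ℝ} (hg : Measurable g) :
    ∫⁻ ω, ENNReal.ofReal ((g (W ω) * (Y ω - deriv b (η (W ω)))) ^ 2) ∂μ =
      ∫⁻ ω, ENNReal.ofReal (g (W ω) ^ 2 * (φ * iteratedDeriv 2 b (η (W ω)))) ∂μ := by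
  have hb1 : Measurable (deriv b) := measurable_deriv b
  have hb2 : Measurable (iteratedDeriv 2 b) := by
    rw [iteratedDeriv_succ]; exact measurable_deriv _
  have e1 : ∫⁻ ω, ENNReal.ofReal ((g (W ω) * (Y ω - deriv b (η (W ω)))) ^ 2) ∂μ =
      ∫⁻ x, ENNReal.ofReal ((g x.1 * (x.2 - deriv b (η x.1))) ^ 2)
        ∂(μ.map fun ω => (W ω, Y ω)) :=
    (lintegral_map (f := fun x : 𝓦 × ℝ => ENNReal.ofReal ((g x.1 * (x.2 - deriv b (η x.1))) ^ 2))
      (by fun_prop) (hW.prodMk hY)).symm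
  have e2 : ∫⁻ ω, ENNReal.ofReal (g (W ω) ^ 2 * (φ * iteratedDeriv 2 b (η (W ω)))) ∂μ =
      ∫⁻ w, ENNReal.ofReal (g w ^ 2 * (φ * iteratedDeriv 2 b (η w))) ∂(μ.map W) :=
    (lintegral_map (f := fun w => ENNReal.ofReal (g w ^ 2 * (φ * iteratedDeriv 2 b (η w))))
      (by fun_prop) hW).symm
  rw [e1, e2, ← compProd_map_condDistrib hY.aemeasurable,
    Measure.lintegral_compProd (by fun_prop)]
  refine lintegral_congr_ae ?_
  filter_upwards [hmem, hcond] with w hw hc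
  rw [hc]
  simp_rw [mul_pow, ENNReal.ofReal_mul (sq_nonneg (g w))]
  rw [lintegral_const_mul _ (by fun_prop), h.lintegral_sq_law hw]

/-- The residual has conditional mean zero, so it is orthogonal to functions of the covariates. This
centres the score and later removes the covariance between the two estimation errors. -/
theorem integral_residual_eq_zero (h : IsExpFamily ν c b Θ φ) (hW : Measurable W)
    (hY : Measurable Y) (hη : Measurable η) (hmem : ∀ᵐ w ∂(μ.map W), η w ∈ Θ)
    (hcond : ∀ᵐ w ∂(μ.map W), condDistrib Y W μ w = law ν c b φ (η w))
    {g : 𝓦 → ℝ} (hg : Measurable g)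
    (hint : Integrable (fun ω => g (W ω) * (Y ω - deriv b (η (W ω)))) μ) :
    ∫ ω, g (W ω) * (Y ω - deriv b (η (W ω))) ∂μ = 0 := by
  have hb1 : Measurable (deriv b) := measurable_deriv b
  have hm : Measurable fun x : 𝓦 × ℝ => g x.1 * (x.2 - deriv b (η x.1)) := by fun_prop
  have hi : Integrable (fun x : 𝓦 × ℝ => g x.1 * (x.2 - deriv b (η x.1)))
      (μ.map fun ω => (W ω, Y ω)) :=
    (integrable_map_measure hm.aestronglyMeasurable (by fun_prop)).2 hint
  have e1 : ∫ ω, g (W ω) * (Y ω - deriv b (η (W ω))) ∂μ =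
      ∫ x, g x.1 * (x.2 - deriv b (η x.1)) ∂(μ.map fun ω => (W ω, Y ω)) :=
    (integral_map (hW.prodMk hY).aemeasurable hm.aestronglyMeasurable).symm
  rw [e1]
  rw [← compProd_map_condDistrib hY.aemeasurable] at hi ⊢
  rw [Measure.integral_compProd hi]
  refine integral_eq_zero_of_ae ?_
  filter_upwards [hmem, hcond] with w hw hc
  have := h.isProbabilityMeasure_law hw
  have hid : Integrable (fun y : ℝ => y) (law ν c b φ (η w)) :=
    (h.memLp_law hw).integrable one_le_two
  rw [hc, integral_const_mul, integral_sub hid (integrable_const _), h.integral_law hw]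
  simp

theorem memLp_residual (h : IsExpFamily ν c b Θ φ) (hW : Measurable W)
    (hY : Measurable Y) (hη : Measurable η) (hmem : ∀ᵐ w ∂(μ.map W), η w ∈ Θ)
    (hcond : ∀ᵐ w ∂(μ.map W), condDistrib Y W μ w = law ν c b φ (η w))
    {g : 𝓦 → ℝ} (hg : Measurable g)
    (hint : Integrable (fun ω => g (W ω) ^ 2 * iteratedDeriv 2 b (η (W ω))) μ) :
    MemLp (fun ω => g (W ω) * (Y ω - deriv b (η (W ω)))) 2 μ ∧
    ∫ ω, (g (W ω) * (Y ω - deriv b (η (W ω)))) ^ 2 ∂μ =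
      φ * ∫ ω, g (W ω) ^ 2 * iteratedDeriv 2 b (η (W ω)) ∂μ := by
  have hb1 : Measurable (deriv b) := measurable_deriv b
  have hmeas : Measurable fun ω => g (W ω) * (Y ω - deriv b (η (W ω))) := by fun_prop
  have key := h.lintegral_sq_residual hW hY hη hmem hcond hg
  have hnn : 0 ≤ᵐ[μ] fun ω => g (W ω) ^ 2 * (φ * iteratedDeriv 2 b (η (W ω))) := by
    filter_upwards [ae_of_ae_map hW.aemeasurable hmem] with ω hω
    exact mul_nonneg (sq_nonneg _) (mul_nonneg h.φ_pos.le (h.iteratedDeriv_two_nonneg hω))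
  have hint' : Integrable (fun ω => g (W ω) ^ 2 * (φ * iteratedDeriv 2 b (η (W ω)))) μ := by
    simpa only [mul_left_comm] using hint.const_mul φ
  rw [← ofReal_integral_eq_lintegral_ofReal hint' hnn] at key
  have hsq : Integrable (fun ω => (g (W ω) * (Y ω - deriv b (η (W ω)))) ^ 2) μ := by
    refine ⟨(hmeas.pow_const 2).aestronglyMeasurable, ?_⟩
    rw [hasFiniteIntegral_iff_ofReal (ae_of_all _ fun _ => sq_nonneg _), key]
    exact ENNReal.ofReal_lt_top
  refine ⟨(memLp_two_iff_integrable_sq hmeas.aestronglyMeasurable).2 hsq, ?_⟩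
  rw [integral_eq_lintegral_of_nonneg_ae (ae_of_all _ fun _ => sq_nonneg _) hsq.1, key,
    ENNReal.toReal_ofReal (integral_nonneg_of_ae hnn), ← integral_const_mul]
  congr with ω
  ring

end GVCMM.IsExpFamily

/-! ### Generalized linear models: quadratic expansion of the likelihood and linearity of the
estimator. -/

/-- Second order Taylor expansion with Lagrange remainder between two points of a set of
analyticity. -/
theorem exists_taylor_two {f : ℝ → ℝ} {η t : ℝ}
    (hf : ∀ l ∈ Icc (0 : ℝ) 1, AnalyticAt ℝ f (η + l * t)) :
    ∃ l ∈ Icc (0 : ℝ) 1,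
      f (η + t) - f η - deriv f η * t = iteratedDeriv 2 f (η + l * t) * t ^ 2 / 2 := by
  set R := f (η + t) - f η - deriv f η * t with hR
  have h1 : ∀ l ∈ Icc (0 : ℝ) 1, HasDerivAt
      (fun u => f (η + u * t) - f η - deriv f η * (u * t) - u ^ 2 * R)
      (deriv f (η + l * t) * t - deriv f η * t - 2 * l * R) l := by
    intro l hl
    have hlin : HasDerivAt (fun u : ℝ => η + u * t) t l := by
      simpa using ((hasDerivAt_id l).mul_const t).const_add η
    have h2 := (hf l hl).differentiableAt.hasDerivAt.comp l hlin
    have h3 : HasDerivAt (fun u : ℝ => deriv f η * (u * t)) (deriv f η * t) l := by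
      simpa using ((hasDerivAt_id l).mul_const t).const_mul (deriv f η)
    have h4 : HasDerivAt (fun u : ℝ => u ^ 2 * R) (2 * l * R) l := by
      simpa using (hasDerivAt_pow 2 l).mul_const R
    exact ((h2.sub_const (f η)).sub h3).sub h4
  have h2 : ∀ l ∈ Icc (0 : ℝ) 1, HasDerivAt
      (fun u => deriv f (η + u * t) * t - deriv f η * t - 2 * u * R)
      (iteratedDeriv 2 f (η + l * t) * t * t - 2 * R) l := by
    intro l hl
    have hlin : HasDerivAt (fun u : ℝ => η + u * t) t l := by
      simpa using ((hasDerivAt_id l).mul_const t).const_add η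
    have h2 := (hf l hl).deriv.differentiableAt.hasDerivAt.comp l hlin
    have h4 : HasDerivAt (fun u : ℝ => 2 * u * R) (2 * R) l := by
      simpa using ((hasDerivAt_id l).const_mul 2).mul_const R
    have := ((h2.mul_const t).sub_const (deriv f η * t)).sub h4
    rw [iteratedDeriv_succ, iteratedDeriv_one]
    exact this
  -- By the choice of R this function vanishes at 0 and 1. Its derivative vanishes at 0 and, by
  -- Rolle, at l₁; a second application of Rolle gives the intermediate point.
  obtain ⟨l₁, hl₁, e₁⟩ := exists_hasDerivAt_eq_zero (f := fun u =>
      f (η + u * t) - f η - deriv f η * (u * t) - u ^ 2 * R) zero_lt_one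
    (fun l hl => (h1 l hl).continuousAt.continuousWithinAt) (by simp [hR])
    (fun l hl => h1 l (Ioo_subset_Icc_self hl))
  obtain ⟨l₂, hl₂, e₂⟩ := exists_hasDerivAt_eq_zero (f := fun u =>
      deriv f (η + u * t) * t - deriv f η * t - 2 * u * R) hl₁.1
    (fun l hl => (h2 l ⟨hl.1, hl.2.trans hl₁.2.le⟩).continuousAt.continuousWithinAt)
    (by simpa using e₁.symm)
    (fun l hl => h2 l ⟨hl.1.le, hl.2.le.trans hl₁.2.le⟩)
  exact ⟨l₂, ⟨hl₂.1.le, hl₂.2.le.trans hl₁.2.le⟩, by linarith⟩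

theorem dotProduct_sq_le {ι : Type*} [Fintype ι] (s z : ι → ℝ) :
    (s ⬝ᵥ z) ^ 2 ≤ (s ⬝ᵥ s) * (z ⬝ᵥ z) := by
  simpa [dotProduct, pow_two] using Finset.sum_mul_sq_le_sq_mul_sq Finset.univ s z

theorem integral_sum_sum_mul {Ω ι κ : Type*} [MeasurableSpace Ω] [Fintype ι] [Fintype κ]
    {μ : Measure Ω} {g : ι → κ → Ω → ℝ} (hg : ∀ j k, Integrable (g j k) μ) (s : ι → ℝ)
    (t : κ → ℝ) :
    Integrable (fun ω => ∑ j, ∑ k, s j * t k * g j k ω) μ ∧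
    ∫ ω, ∑ j, ∑ k, s j * t k * g j k ω ∂μ =
      s ⬝ᵥ (Matrix.of fun j k => ∫ ω, g j k ω ∂μ) *ᵥ t := by
  have hi : ∀ j k, Integrable (fun ω => s j * t k * g j k ω) μ := fun j k => (hg j k).const_mul _
  refine ⟨integrable_finsetSum _ fun j _ => integrable_finsetSum _ fun k _ => hi j k, ?_⟩
  rw [integral_finsetSum _ fun j _ => integrable_finsetSum _ fun k _ => hi j k]
  simp only [dotProduct, Matrix.mulVec, Matrix.of_apply, Finset.mul_sum]
  refine Finset.sum_congr rfl fun j _ => ?_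
  rw [integral_finsetSum _ fun k _ => hi j k]
  refine Finset.sum_congr rfl fun k _ => ?_
  rw [integral_const_mul]; ring

namespace GVCMM

/-- A sample of covariates `Z` and responses `Y` from a regular generalized linear model with
canonical parameter `θ₀ ⬝ᵥ Z`. -/
structure IsGLMSample {Ω ι : Type*} [MeasurableSpace Ω] [Fintype ι] (μ : Measure Ω)
    (Z : ℕ → Ω → ι → ℝ) (Y : ℕ → Ω → ℝ) (b : ℝ → ℝ) (Θ : Set ℝ) (θ₀ : ι → ℝ) : Prop where
  measurable_Z : ∀ i, Measurable (Z i)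
  indep : iIndepFun (fun i ω => (Z i ω, Y i ω)) μ
  identDistrib : ∀ i, IdentDistrib (fun ω => (Z i ω, Y i ω)) (fun ω => (Z 0 ω, Y 0 ω)) μ μ
  memLp_score : ∀ j, MemLp (fun ω => Z 0 ω j * (Y 0 ω - deriv b (θ₀ ⬝ᵥ Z 0 ω))) 2 μ
  integral_score : ∀ j, ∫ ω, Z 0 ω j * (Y 0 ω - deriv b (θ₀ ⬝ᵥ Z 0 ω)) ∂μ = 0
  regular : ∃ δ > 0, ∃ H : Ω → ℝ, Integrable H μ ∧ ∀ᵐ ω ∂μ, ∀ θ ∈ Metric.ball θ₀ δ,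
    θ ⬝ᵥ Z 0 ω ∈ Θ ∧ (Z 0 ω ⬝ᵥ Z 0 ω) * iteratedDeriv 2 b (θ ⬝ᵥ Z 0 ω) ≤ H ω

/-- The information matrix `E {Z Zᵀ b''(θ₀ᵀ Z)}`. -/
def information {Ω ι : Type*} [MeasurableSpace Ω] [Fintype ι] (μ : Measure Ω) (Z : Ω → ι → ℝ)
    (b : ℝ → ℝ) (θ₀ : ι → ℝ) : Matrix ι ι ℝ :=
  Matrix.of fun j k => ∫ ω, Z ω j * Z ω k * iteratedDeriv 2 b (θ₀ ⬝ᵥ Z ω) ∂μ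

/-- The normalized score `n^{-1/2} ∑ Zᵢ (Yᵢ - b'(θ₀ᵀ Zᵢ))`. -/
def score {Ω ι : Type*} [Fintype ι] (Z : ℕ → Ω → ι → ℝ) (Y : ℕ → Ω → ℝ) (b : ℝ → ℝ)
    (θ₀ : ι → ℝ) (n : ℕ) (ω : Ω) : ι → ℝ :=
  fun j => (√(n : ℝ))⁻¹ * ∑ i ∈ Finset.range n, Z i ω j * (Y i ω - deriv b (θ₀ ⬝ᵥ Z i ω))

/-- The rescaled negative log-likelihood ratio at `θ₀ + s / √n`. -/
def negLogLikRatio {Ω ι : Type*} [Fintype ι] (Z : ℕ → Ω → ι → ℝ) (Y : ℕ → Ω → ℝ) (b : ℝ → ℝ)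
    (θ₀ : ι → ℝ) (n : ℕ) (ω : Ω) (s : ι → ℝ) : ℝ :=
  ∑ i ∈ Finset.range n, (b ((θ₀ + (√(n : ℝ))⁻¹ • s) ⬝ᵥ Z i ω) - b (θ₀ ⬝ᵥ Z i ω) -
    Y i ω * ((√(n : ℝ))⁻¹ * (s ⬝ᵥ Z i ω)))

/-- The local parameters `s` for which the likelihood at `θ₀ + s / √n` is defined. -/
def localAdmissible {Ω ι : Type*} [Fintype ι] (Z : ℕ → Ω → ι → ℝ) (Θ : Set ℝ) (θ₀ : ι → ℝ)
    (n : ℕ) (ω : Ω) : Set (ι → ℝ) :=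
  {s | ∀ i < n, (θ₀ + (√(n : ℝ))⁻¹ • s) ⬝ᵥ Z i ω ∈ Θ}

/-- The canonical link makes the predictor affine in s, so convexity of b on the interval Θ passes
to the domain and to the function. This convexity replaces a separate consistency proof. -/
theorem convexOn_negLogLikRatio {Ω ι : Type*} [Fintype ι] {Z : ℕ → Ω → ι → ℝ} {Y : ℕ → Ω → ℝ}
    {b : ℝ → ℝ} {Θ : Set ℝ} {θ₀ : ι → ℝ} (hb : ConvexOn ℝ Θ b) (n : ℕ) (ω : Ω) :
    ConvexOn ℝ (localAdmissible Z Θ θ₀ n ω) (negLogLikRatio Z Y b θ₀ n ω) := by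
  have hpred : ∀ (s t : ι → ℝ) (a c : ℝ), a + c = 1 → ∀ i,
      (θ₀ + (√(n : ℝ))⁻¹ • (a • s + c • t)) ⬝ᵥ Z i ω =
      a • ((θ₀ + (√(n : ℝ))⁻¹ • s) ⬝ᵥ Z i ω) + c • ((θ₀ + (√(n : ℝ))⁻¹ • t) ⬝ᵥ Z i ω) := by
    intro s t a c hac i
    simp only [add_dotProduct, smul_dotProduct, smul_eq_mul]
    linear_combination (-(θ₀ ⬝ᵥ Z i ω)) * hac
  constructor
  · intro s hs t ht a c ha hc hac i hi
    rw [hpred s t a c hac i]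
    exact hb.1 (hs i hi) (ht i hi) ha hc hac
  · intro s hs t ht a c ha hc hac
    simp only [negLogLikRatio, smul_eq_mul, Finset.mul_sum, ← Finset.sum_add_distrib]
    refine Finset.sum_le_sum fun i hi => ?_
    have hi := Finset.mem_range.1 hi
    have h1 := hb.2 (hs i hi) (ht i hi) ha hc hac
    rw [hpred s t a c hac i]
    simp only [smul_eq_mul, add_dotProduct, smul_dotProduct] at h1 ⊢
    have : b (θ₀ ⬝ᵥ Z i ω) = a * b (θ₀ ⬝ᵥ Z i ω) + c * b (θ₀ ⬝ᵥ Z i ω) := by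
      rw [← add_mul, hac, one_mul]
    linarith

namespace IsGLMSample

variable {ν : Measure ℝ} {c b : ℝ → ℝ} {Θ : Set ℝ} {φ : ℝ} {Ω ι : Type*} [MeasurableSpace Ω]
  [Fintype ι] {μ : Measure Ω} {Z : ℕ → Ω → ι → ℝ} {Y : ℕ → Ω → ℝ}
  {θ₀ : ι → ℝ}

theorem ae_all_mem (hS : IsGLMSample μ Z Y b Θ θ₀) (hΘ : IsOpen Θ) {θ : ι → ℝ}
    (h0 : ∀ᵐ ω ∂μ, θ ⬝ᵥ Z 0 ω ∈ Θ) : ∀ᵐ ω ∂μ, ∀ i, θ ⬝ᵥ Z i ω ∈ Θ := by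
  rw [ae_all_iff]
  intro i
  have hm : Measurable fun z : (ι → ℝ) × ℝ => θ ⬝ᵥ z.1 := by unfold dotProduct; fun_prop
  exact (hS.identDistrib i).symm.ae_snd (p := fun z => θ ⬝ᵥ z.1 ∈ Θ) (hm hΘ.measurableSet) h0

theorem boundedInProb_score [IsProbabilityMeasure μ] (hS : IsGLMSample μ Z Y b Θ θ₀) :
    BoundedInProb μ (score Z Y b θ₀) := by
  refine boundedInProb_pi fun j => ?_
  have hm : Measurable fun z : (ι → ℝ) × ℝ => z.1 j * (z.2 - deriv b (θ₀ ⬝ᵥ z.1)) := by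
    have := measurable_deriv b
    unfold dotProduct; fun_prop
  exact boundedInProb_normalized_sum (X := fun i ω => Z i ω j * (Y i ω - deriv b (θ₀ ⬝ᵥ Z i ω)))
    (hS.memLp_score j) (hS.integral_score j)
    (fun i k hik => (hS.indep.indepFun hik).comp hm hm) (fun i => (hS.identDistrib i).comp hm)

theorem integrable_information (h : IsExpFamily ν c b Θ φ) (hS : IsGLMSample μ Z Y b Θ θ₀)
    (j k : ι) : Integrable (fun ω => Z 0 ω j * Z 0 ω k * iteratedDeriv 2 b (θ₀ ⬝ᵥ Z 0 ω)) μ := by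
  obtain ⟨δ, hδ, H, hH, hreg⟩ := hS.regular
  have hb2 : Measurable (iteratedDeriv 2 b) := by
    rw [iteratedDeriv_succ]; exact measurable_deriv _
  have hZ := hS.measurable_Z 0
  refine hH.mono' (Measurable.aestronglyMeasurable (by unfold dotProduct; fun_prop)) ?_
  filter_upwards [hreg] with ω hω
  obtain ⟨h1, h2⟩ := hω θ₀ (Metric.mem_ball_self hδ)
  have h3 := h.iteratedDeriv_two_nonneg h1
  rw [Real.norm_eq_abs, abs_mul, abs_of_nonneg h3]
  refine le_trans (mul_le_mul_of_nonneg_right ?_ h3) h2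
  have hsq : ∀ i, Z 0 ω i ^ 2 ≤ Z 0 ω ⬝ᵥ Z 0 ω := fun i => by
    rw [pow_two]
    exact Finset.single_le_sum (f := fun i => Z 0 ω i * Z 0 ω i) (fun _ _ => mul_self_nonneg _)
      (Finset.mem_univ i)
  have := hsq j
  have := hsq k
  rw [abs_le]
  constructor <;> nlinarith [sq_nonneg (Z 0 ω j - Z 0 ω k), sq_nonneg (Z 0 ω j + Z 0 ω k)]

theorem dotProduct_information_mulVec (h : IsExpFamily ν c b Θ φ)
    (hS : IsGLMSample μ Z Y b Θ θ₀) (s : ι → ℝ) :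
    Integrable (fun ω => (s ⬝ᵥ Z 0 ω) ^ 2 * iteratedDeriv 2 b (θ₀ ⬝ᵥ Z 0 ω)) μ ∧
    ∫ ω, (s ⬝ᵥ Z 0 ω) ^ 2 * iteratedDeriv 2 b (θ₀ ⬝ᵥ Z 0 ω) ∂μ =
      s ⬝ᵥ information μ (Z 0) b θ₀ *ᵥ s := by
  have hexp : ∀ ω, (s ⬝ᵥ Z 0 ω) ^ 2 * iteratedDeriv 2 b (θ₀ ⬝ᵥ Z 0 ω) =
      ∑ j, ∑ k, s j * s k * (Z 0 ω j * Z 0 ω k * iteratedDeriv 2 b (θ₀ ⬝ᵥ Z 0 ω)) := by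
    intro ω
    rw [show (s ⬝ᵥ Z 0 ω) ^ 2 = (∑ j, s j * Z 0 ω j) * (∑ k, s k * Z 0 ω k) by
      rw [pow_two]; rfl, Finset.sum_mul_sum, Finset.sum_mul]
    refine Finset.sum_congr rfl fun j _ => ?_
    rw [Finset.sum_mul]
    refine Finset.sum_congr rfl fun k _ => ?_
    ring
  simp_rw [hexp]
  exact integral_sum_sum_mul (fun j k => hS.integrable_information h j k) s s

end IsGLMSample

end GVCMM

namespace GVCMM.IsGLMSample

variable {ν : Measure ℝ} {c b : ℝ → ℝ} {Θ : Set ℝ} {φ : ℝ} {Ω ι : Type*} [MeasurableSpace Ω]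
  [Fintype ι] {μ : Measure Ω} {Z : ℕ → Ω → ι → ℝ} {Y : ℕ → Ω → ℝ}
  {θ₀ : ι → ℝ}

theorem eventually_mem_ball {δ : ℝ} (hδ : 0 < δ) (θ₀ s : ι → ℝ) :
    ∀ᶠ n : ℕ in atTop, ∀ l ∈ Icc (0 : ℝ) 1, θ₀ + l • (√(n : ℝ))⁻¹ • s ∈ Metric.ball θ₀ δ := by
  have h1 : Tendsto (fun n : ℕ => (√(n : ℝ))⁻¹ * ‖s‖) atTop (𝓝 0) := by
    rw [← zero_mul ‖s‖]
    exact (tendsto_inv_atTop_zero.comp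
      (Real.tendsto_sqrt_atTop.comp tendsto_natCast_atTop_atTop)).mul_const _
  filter_upwards [h1.eventually_lt_const hδ] with n hn l hl
  rw [Metric.mem_ball, dist_eq_norm, add_sub_cancel_left, norm_smul, norm_smul,
    Real.norm_of_nonneg hl.1, Real.norm_of_nonneg (by positivity)]
  refine lt_of_le_of_lt ?_ hn
  exact mul_le_of_le_one_left (by positivity) hl.2

theorem eventually_ae_mem (h : IsExpFamily ν c b Θ φ) (hS : IsGLMSample μ Z Y b Θ θ₀)
    (s : ι → ℝ) :
    ∀ᶠ n : ℕ in atTop, ∀ᵐ ω ∂μ, ∀ i, (θ₀ + (√(n : ℝ))⁻¹ • s) ⬝ᵥ Z i ω ∈ Θ := by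
  obtain ⟨δ, hδ, H, hH, hreg⟩ := hS.regular
  filter_upwards [eventually_mem_ball hδ θ₀ s] with n hn
  refine hS.ae_all_mem h.isOpen_Θ ?_
  filter_upwards [hreg] with ω hω
  have := hn 1 ⟨zero_le_one, le_rfl⟩
  rw [one_smul] at this
  exact (hω _ this).1

/-- The expected remainder of the quadratic expansion of the cumulant function, scaled by `n`,
vanishes. -/
theorem tendsto_integral_remainder (h : IsExpFamily ν c b Θ φ) (hS : IsGLMSample μ Z Y b Θ θ₀)
    (s : ι → ℝ) {b' : ℝ → ℝ} (hb' : Measurable b') (hbb' : EqOn b' b Θ) :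
    let ψ : ℕ → (ι → ℝ) → ℝ := fun n z =>
      n * (b' ((θ₀ + (√(n : ℝ))⁻¹ • s) ⬝ᵥ z) - b' (θ₀ ⬝ᵥ z) -
        deriv b (θ₀ ⬝ᵥ z) * ((√(n : ℝ))⁻¹ * (s ⬝ᵥ z))) -
      1 / 2 * ((s ⬝ᵥ z) ^ 2 * iteratedDeriv 2 b (θ₀ ⬝ᵥ z))
    (∀ n, Measurable (ψ n)) ∧ (∀ᶠ n in atTop, Integrable (fun ω => ψ n (Z 0 ω)) μ) ∧
      Tendsto (fun n => ∫ ω, |ψ n (Z 0 ω)| ∂μ) atTop (𝓝 0) := by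
  intro ψ
  obtain ⟨δ, hδ, H, hH, hreg⟩ := hS.regular
  have hb2 : Measurable (iteratedDeriv 2 b) := by
    rw [iteratedDeriv_succ]; exact measurable_deriv _
  have hb1 := measurable_deriv b
  have hψ : ∀ n, Measurable (ψ n) := fun n => by
    simp only [ψ]; unfold dotProduct; fun_prop
  have hZ := hS.measurable_Z 0
  have hball := eventually_mem_ball hδ θ₀ s
  -- Taylor's formula along the step s/√n: the factor n cancels the square of 1/√n, and the
  -- remainder is a difference of two values of b''.
  have hexp : ∀ᶠ n : ℕ in atTop, ∀ᵐ ω ∂μ, ∃ l ∈ Icc (0 : ℝ) 1,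
      ψ n (Z 0 ω) = 1 / 2 * ((s ⬝ᵥ Z 0 ω) ^ 2 *
        (iteratedDeriv 2 b ((θ₀ + l • (√(n : ℝ))⁻¹ • s) ⬝ᵥ Z 0 ω) -
          iteratedDeriv 2 b (θ₀ ⬝ᵥ Z 0 ω))) := by
    filter_upwards [hball, eventually_gt_atTop 0] with n hn hn0
    filter_upwards [hreg] with ω hω
    have hpred : ∀ l : ℝ, (θ₀ + l • (√(n : ℝ))⁻¹ • s) ⬝ᵥ Z 0 ω =
        θ₀ ⬝ᵥ Z 0 ω + l * ((√(n : ℝ))⁻¹ * (s ⬝ᵥ Z 0 ω)) := fun l => by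
      simp [add_dotProduct, smul_dotProduct]
    obtain ⟨l, hl, e⟩ := exists_taylor_two (f := b) (η := θ₀ ⬝ᵥ Z 0 ω)
      (t := (√(n : ℝ))⁻¹ * (s ⬝ᵥ Z 0 ω)) (fun l hl => by
        rw [← hpred]; exact h.analyticAt (hω _ (hn l hl)).1)
    refine ⟨l, hl, ?_⟩
    have h1 := hpred 1
    rw [one_smul, one_mul] at h1
    have hm1 : (θ₀ + (√(n : ℝ))⁻¹ • s) ⬝ᵥ Z 0 ω ∈ Θ := by
      have := (hω _ (hn 1 ⟨zero_le_one, le_rfl⟩)).1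
      rwa [one_smul] at this
    have hm0 : θ₀ ⬝ᵥ Z 0 ω ∈ Θ := (hω _ (Metric.mem_ball_self hδ)).1
    simp only [ψ]
    rw [hbb' hm1, hbb' hm0, h1, e, hpred, mul_pow, inv_pow, Real.sq_sqrt (by positivity)]
    have : (n : ℝ) ≠ 0 := by positivity
    field_simp
  -- By Cauchy–Schwarz both values of b'', weighted by (sᵀZ)², are at most (sᵀs) H: a dominating
  -- function free of n.
  have hbound : ∀ᶠ n : ℕ in atTop, ∀ᵐ ω ∂μ, |ψ n (Z 0 ω)| ≤ (s ⬝ᵥ s) * H ω := by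
    filter_upwards [hexp, hball] with n hn hb
    filter_upwards [hn, hreg] with ω ⟨l, hl, e⟩ hω
    have hA := hω _ (hb l hl)
    have hB := hω _ (Metric.mem_ball_self hδ)
    have hA0 := h.iteratedDeriv_two_nonneg hA.1
    have hB0 := h.iteratedDeriv_two_nonneg hB.1
    set A := iteratedDeriv 2 b ((θ₀ + l • (√(n : ℝ))⁻¹ • s) ⬝ᵥ Z 0 ω)
    set B := iteratedDeriv 2 b (θ₀ ⬝ᵥ Z 0 ω)
    have hcs := dotProduct_sq_le s (Z 0 ω)
    have hss : 0 ≤ s ⬝ᵥ s := Finset.sum_nonneg fun i _ => mul_self_nonneg _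
    have hA' : (s ⬝ᵥ Z 0 ω) ^ 2 * A ≤ (s ⬝ᵥ s) * H ω :=
      (mul_le_mul_of_nonneg_right hcs hA0).trans (by
        rw [mul_assoc]; exact mul_le_mul_of_nonneg_left hA.2 hss)
    have hB' : (s ⬝ᵥ Z 0 ω) ^ 2 * B ≤ (s ⬝ᵥ s) * H ω :=
      (mul_le_mul_of_nonneg_right hcs hB0).trans (by
        rw [mul_assoc]; exact mul_le_mul_of_nonneg_left hB.2 hss)
    have hA2 : 0 ≤ (s ⬝ᵥ Z 0 ω) ^ 2 * A := by positivity
    have hB2 : 0 ≤ (s ⬝ᵥ Z 0 ω) ^ 2 * B := by positivity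
    rw [e, mul_sub, abs_le]
    constructor <;> linarith
  -- The intermediate point, which depends on n and ω, tends to θ₀ᵀZ, where b'' is continuous.
  have hlim : ∀ᵐ ω ∂μ, Tendsto (fun n => |ψ n (Z 0 ω)|) atTop (𝓝 0) := by
    obtain ⟨N, hN⟩ := eventually_atTop.1 hexp
    have hall : ∀ᵐ ω ∂μ, ∀ n, N ≤ n → ∃ l ∈ Icc (0 : ℝ) 1,
      ψ n (Z 0 ω) = 1 / 2 * ((s ⬝ᵥ Z 0 ω) ^ 2 *
        (iteratedDeriv 2 b ((θ₀ + l • (√(n : ℝ))⁻¹ • s) ⬝ᵥ Z 0 ω) -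
          iteratedDeriv 2 b (θ₀ ⬝ᵥ Z 0 ω))) := by
      rw [ae_all_iff]; intro n
      by_cases hn : N ≤ n
      · filter_upwards [hN n hn] with ω hω _ using hω
      · exact ae_of_all _ fun ω h => absurd h hn
    filter_upwards [hall, hreg] with ω hω hr
    choose! l hl e using hω
    have hη := (hr _ (Metric.mem_ball_self hδ)).1
    have hcontb : ContinuousAt (iteratedDeriv 2 b) (θ₀ ⬝ᵥ Z 0 ω) :=
      (h.continuousOn_iteratedDeriv_two).continuousAt (h.isOpen_Θ.mem_nhds hη)
    have hq : Tendsto (fun n : ℕ => (√(n : ℝ))⁻¹ * |s ⬝ᵥ Z 0 ω|) atTop (𝓝 0) := by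
      rw [← zero_mul |s ⬝ᵥ Z 0 ω|]
      exact (tendsto_inv_atTop_zero.comp
        (Real.tendsto_sqrt_atTop.comp tendsto_natCast_atTop_atTop)).mul_const _
    have hpt : Tendsto (fun n : ℕ => (θ₀ + l n • (√(n : ℝ))⁻¹ • s) ⬝ᵥ Z 0 ω) atTop
        (𝓝 (θ₀ ⬝ᵥ Z 0 ω)) := by
      rw [tendsto_iff_norm_sub_tendsto_zero]
      refine squeeze_zero' (Eventually.of_forall fun _ => norm_nonneg _) ?_ hq
      filter_upwards [eventually_ge_atTop N] with n hn
      have hln := hl n hn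
      rw [add_dotProduct, add_sub_cancel_left, smul_dotProduct, smul_dotProduct, smul_eq_mul,
        smul_eq_mul, norm_mul, norm_mul, Real.norm_of_nonneg hln.1,
        Real.norm_of_nonneg (by positivity), Real.norm_eq_abs]
      exact mul_le_of_le_one_left (by positivity) hln.2
    have h2 : Tendsto (fun n : ℕ => |1 / 2 * ((s ⬝ᵥ Z 0 ω) ^ 2 *
        (iteratedDeriv 2 b ((θ₀ + l n • (√(n : ℝ))⁻¹ • s) ⬝ᵥ Z 0 ω) -
          iteratedDeriv 2 b (θ₀ ⬝ᵥ Z 0 ω)))|) atTop (𝓝 0) := by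
      have := ((((hcontb.tendsto.comp hpt).sub_const
        (iteratedDeriv 2 b (θ₀ ⬝ᵥ Z 0 ω))).const_mul ((s ⬝ᵥ Z 0 ω) ^ 2)).const_mul (1 / 2)).abs
      simpa using this
    refine h2.congr' ?_
    filter_upwards [eventually_ge_atTop N] with n hn
    rw [e n hn]
  have hmeas : ∀ n, Measurable fun ω => ψ n (Z 0 ω) := fun n => (hψ n).comp hZ
  have hHi : Integrable (fun ω => (s ⬝ᵥ s) * H ω) μ := hH.const_mul _
  refine ⟨hψ, ?_, ?_⟩
  · filter_upwards [hbound] with n hn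
    exact hHi.mono' (hmeas n).aestronglyMeasurable (by simpa using hn)
  · have := tendsto_integral_filter_of_dominated_convergence (μ := μ) (l := atTop)
      (F := fun n ω => |ψ n (Z 0 ω)|) (f := fun _ => 0) (fun ω => (s ⬝ᵥ s) * H ω)
      (Eventually.of_forall fun n => (hmeas n).abs.aestronglyMeasurable)
      (by filter_upwards [hbound] with n hn; simpa using hn) hHi hlim
    simpa using this

/-- Local asymptotic quadraticity of the likelihood ratio. -/
theorem smallInProb_negLogLikRatio [IsProbabilityMeasure μ] (h : IsExpFamily ν c b Θ φ)
    (hS : IsGLMSample μ Z Y b Θ θ₀)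
    (s : ι → ℝ) :
    SmallInProb μ fun n ω => negLogLikRatio Z Y b θ₀ n ω s -
      (1 / 2 * (s ⬝ᵥ information μ (Z 0) b θ₀ *ᵥ s) - score Z Y b θ₀ n ω ⬝ᵥ s) := by
  classical
  -- Outside Θ nothing is known about b, not even measurability; the predictors lie in Θ almost
  -- surely for large n, so b may be replaced by 0 there.
  set b' := Θ.piecewise b 0 with hb'
  have hb'm : Measurable b' :=
    h.continuousOn.measurable_piecewise continuousOn_const h.isOpen_Θ.measurableSet
  have hbb' : EqOn b' b Θ := fun x hx => piecewise_eq_of_mem _ _ _ hx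
  obtain ⟨hψ, hψi, hψ0⟩ := hS.tendsto_integral_remainder h s hb'm hbb'
  set ψ : ℕ → (ι → ℝ) → ℝ := fun n z =>
      n * (b' ((θ₀ + (√(n : ℝ))⁻¹ • s) ⬝ᵥ z) - b' (θ₀ ⬝ᵥ z) -
        deriv b (θ₀ ⬝ᵥ z) * ((√(n : ℝ))⁻¹ * (s ⬝ᵥ z))) -
      1 / 2 * ((s ⬝ᵥ z) ^ 2 * iteratedDeriv 2 b (θ₀ ⬝ᵥ z)) with hψdef
  have hb2 : Measurable (iteratedDeriv 2 b) := by
    rw [iteratedDeriv_succ]; exact measurable_deriv _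
  have hid : ∀ i, IdentDistrib (Z i) (Z 0) μ μ := fun i =>
    (hS.identDistrib i).comp measurable_fst
  -- The summands change with n, so the law of large numbers does not apply; instead the mean
  -- absolute value of the average is at most that of one summand, which tends to zero.
  have hrem : SmallInProb μ fun n ω => (∑ i ∈ Finset.range n, ψ n (Z i ω)) / n := by
    have hint : ∀ᶠ n in atTop, ∀ i, Integrable (fun ω => ψ n (Z i ω)) μ := by
      filter_upwards [hψi] with n hn i
      exact ((hid i).comp (hψ n)).integrable_iff.2 hn
    refine smallInProb_of_tendsto_integral ?_ ?_
    · filter_upwards [hint] with n hn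
      exact (integrable_finsetSum _ fun i _ => hn i).div_const _
    · refine squeeze_zero' (Eventually.of_forall fun n =>
        integral_nonneg fun _ => abs_nonneg _) ?_ hψ0
      filter_upwards [hint, eventually_gt_atTop 0] with n hn hn0
      have hn' : (0 : ℝ) < n := by exact_mod_cast hn0
      calc ∫ ω, |(∑ i ∈ Finset.range n, ψ n (Z i ω)) / n| ∂μ
          ≤ ∫ ω, (∑ i ∈ Finset.range n, |ψ n (Z i ω)|) / n ∂μ := by
            refine integral_mono ((integrable_finsetSum _ fun i _ => hn i).div_const _).abs
              ((integrable_finsetSum _ fun i _ => (hn i).abs).div_const _) fun ω => ?_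
            simp only [abs_div, abs_of_pos hn']
            exact div_le_div_of_nonneg_right (Finset.abs_sum_le_sum_abs _ _) hn'.le
        _ = ∫ ω, |ψ n (Z 0 ω)| ∂μ := by
            rw [integral_div, integral_finsetSum _ fun i _ => (hn i).abs]
            have : ∀ i, ∫ ω, |ψ n (Z i ω)| ∂μ = ∫ ω, |ψ n (Z 0 ω)| ∂μ := fun i =>
              ((hid i).comp (hψ n).abs).integral_eq
            simp only [this, Finset.sum_const, Finset.card_range, nsmul_eq_mul]
            field_simp
  have hquad : SmallInProb μ fun n ω =>
      (∑ i ∈ Finset.range n, (s ⬝ᵥ Z i ω) ^ 2 * iteratedDeriv 2 b (θ₀ ⬝ᵥ Z i ω)) / n -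
        s ⬝ᵥ information μ (Z 0) b θ₀ *ᵥ s := by
    have hg : Measurable fun z : ι → ℝ => (s ⬝ᵥ z) ^ 2 * iteratedDeriv 2 b (θ₀ ⬝ᵥ z) := by
      unfold dotProduct; fun_prop
    obtain ⟨h1, h2⟩ := hS.dotProduct_information_mulVec h s
    rw [← h2]
    exact smallInProb_mean_sub
      (X := fun i ω => (s ⬝ᵥ Z i ω) ^ 2 * iteratedDeriv 2 b (θ₀ ⬝ᵥ Z i ω)) h1
      (fun i j hij => ((hS.indep.indepFun hij).comp measurable_fst measurable_fst).comp hg hg)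
      (fun i => (hid i).comp hg)
  refine (hrem.add (hquad.const_mul (1 / 2))).congr ?_
  have hmem0 : ∀ᵐ ω ∂μ, ∀ i, θ₀ ⬝ᵥ Z i ω ∈ Θ := by
    obtain ⟨δ, hδ, H, -, hreg⟩ := hS.regular
    refine hS.ae_all_mem h.isOpen_Θ ?_
    filter_upwards [hreg] with ω hω using (hω _ (Metric.mem_ball_self hδ)).1
  filter_upwards [hS.eventually_ae_mem h s, eventually_gt_atTop 0] with n hn hn0
  have hn' : (n : ℝ) ≠ 0 := by positivity
  filter_upwards [hn, hmem0] with ω hω hω0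
  have e1 : score Z Y b θ₀ n ω ⬝ᵥ s = ∑ i ∈ Finset.range n,
      (√(n : ℝ))⁻¹ * (s ⬝ᵥ Z i ω) * (Y i ω - deriv b (θ₀ ⬝ᵥ Z i ω)) := by
    simp only [score, dotProduct, Finset.mul_sum, Finset.sum_mul]
    rw [Finset.sum_comm]
    refine Finset.sum_congr rfl fun i _ => Finset.sum_congr rfl fun j _ => ?_
    ring
  have e2 : (∑ i ∈ Finset.range n, ψ n (Z i ω)) / n =
      negLogLikRatio Z Y b θ₀ n ω s + score Z Y b θ₀ n ω ⬝ᵥ s -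
      1 / 2 * ((∑ i ∈ Finset.range n, (s ⬝ᵥ Z i ω) ^ 2 * iteratedDeriv 2 b (θ₀ ⬝ᵥ Z i ω)) / n) := by
    rw [e1, negLogLikRatio, ← Finset.sum_add_distrib, Finset.sum_div, Finset.sum_div,
      Finset.mul_sum, ← Finset.sum_sub_distrib]
    refine Finset.sum_congr rfl fun i _ => ?_
    simp only [hψdef]
    rw [hbb' (hω i), hbb' (hω0 i)]
    field_simp
    ring
  rw [e2]
  ring

/-- Asymptotic linearity of maximum likelihood estimators in a generalized linear model. -/
theorem smallInProb_mle_sub [IsProbabilityMeasure μ] [DecidableEq ι] (h : IsExpFamily ν c b Θ φ)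
    (hS : IsGLMSample μ Z Y b Θ θ₀)
    (hJ : (information μ (Z 0) b θ₀).PosDef) {est : ℕ → Ω → ι → ℝ}
    (hest : ∀ n, ∀ᵐ ω ∂μ, (∃ s ∈ localAdmissible Z Θ θ₀ n ω,
        IsMinOn (negLogLikRatio Z Y b θ₀ n ω) (localAdmissible Z Θ θ₀ n ω) s) →
      est n ω ∈ localAdmissible Z Θ θ₀ n ω ∧
        IsMinOn (negLogLikRatio Z Y b θ₀ n ω) (localAdmissible Z Θ θ₀ n ω) (est n ω)) :
    SmallInProb μ fun n ω => est n ω - (information μ (Z 0) b θ₀)⁻¹ *ᵥ score Z Y b θ₀ n ω := by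
  set J := information μ (Z 0) b θ₀ with hJdef
  set s₀ : ℕ → Ω → ι → ℝ := fun n ω => J⁻¹ *ᵥ score Z Y b θ₀ n ω with hs₀
  have hJs₀ : ∀ n ω, J *ᵥ s₀ n ω = score Z Y b θ₀ n ω := fun n ω => by
    rw [hs₀, Matrix.mulVec_mulVec, Matrix.mul_nonsing_inv _ ((Matrix.isUnit_iff_isUnit_det _).1
      hJ.isUnit), Matrix.one_mulVec]
  have hbdd : BoundedInProb μ s₀ := by
    refine boundedInProb_pi fun j => ?_
    simp only [hs₀, Matrix.mulVec, dotProduct]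
    refine BoundedInProb.sum _ fun k _ => (boundedInProb_const (J⁻¹ j k)).mul ?_
    exact hS.boundedInProb_score.mono
      (Eventually.of_forall fun _ => ae_of_all _ fun _ => norm_le_pi_norm _ _)
  rw [smallInProb_iff]
  intro ρ hρ η hη
  -- The random vertex J⁻¹W stays in a fixed ball of radius K with high probability, so one finite
  -- set N works for all large n. The radius ρ/2 makes the final inequality strict.
  obtain ⟨K, hK, hKn⟩ := hbdd (η / 2) (by positivity)
  obtain ⟨N, hN, δ, hδ, hmain⟩ := exists_finite_convexOn_argmin_close hJ hK.le (half_pos hρ)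
  have hsum : SmallInProb μ fun n ω => ∑ v ∈ hN.toFinset, |negLogLikRatio Z Y b θ₀ n ω v -
      (1 / 2 * (v ⬝ᵥ J *ᵥ v) - score Z Y b θ₀ n ω ⬝ᵥ v)| :=
    SmallInProb.sum _ fun v _ => (hS.smallInProb_negLogLikRatio h v).mono
      (Eventually.of_forall fun _ => ae_of_all _ fun _ => by rw [hJdef]; simp)
  have hadm : ∀ᶠ n : ℕ in atTop, ∀ᵐ ω ∂μ, N ⊆ localAdmissible Z Θ θ₀ n ω := by
    have : ∀ᶠ n : ℕ in atTop, ∀ v ∈ N,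
        ∀ᵐ ω ∂μ, ∀ i, (θ₀ + (√(n : ℝ))⁻¹ • v) ⬝ᵥ Z i ω ∈ Θ :=
      (hN.eventually_all).2 fun v _ => hS.eventually_ae_mem h v
    filter_upwards [this] with n hn
    filter_upwards [(ae_ball_iff hN.countable).2 hn] with ω hω v hv i _
    exact hω v hv i
  filter_upwards [hKn, smallInProb_iff.1 hsum δ hδ (η / 2) (by positivity), hadm] with n h1 h2 h3
  refine le_trans ((measure_mono_ae (t := {ω | K ≤ ‖s₀ n ω‖} ∪ {ω | δ ≤ ‖∑ v ∈ hN.toFinset,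
    |negLogLikRatio Z Y b θ₀ n ω v - (1 / 2 * (v ⬝ᵥ J *ᵥ v) - score Z Y b θ₀ n ω ⬝ᵥ v)|‖}) ?_).trans
    (measure_union_le _ _)) ((add_le_add h1 h2).trans ?_)
  · filter_upwards [h3, hest n] with ω hω he hlarge
    by_contra hcon
    have hcon := not_or.1 hcon
    have hc1 : ‖s₀ n ω‖ ≤ K := (not_le.1 hcon.1).le
    have hc2 := (not_le.1 (show ¬ δ ≤ _ from hcon.2)).le
    rw [Real.norm_of_nonneg (Finset.sum_nonneg fun _ _ => abs_nonneg _)] at hc2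
    -- Off the two exceptional events a minimizer exists, so the estimator is one; its arbitrary
    -- values elsewhere are harmless.
    obtain ⟨hex, hall⟩ := hmain (s₀ n ω) (localAdmissible Z Θ θ₀ n ω) (negLogLikRatio Z Y b θ₀ n ω)
      hc1 (convexOn_negLogLikRatio h.convexOn n ω) hω (fun v hv => by
        rw [hJs₀]
        exact (Finset.single_le_sum (f := fun v => |negLogLikRatio Z Y b θ₀ n ω v -
          (1 / 2 * (v ⬝ᵥ J *ᵥ v) - score Z Y b θ₀ n ω ⬝ᵥ v)|) (fun _ _ => abs_nonneg _)
          (hN.mem_toFinset.2 hv)).trans hc2)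
    obtain ⟨hmem, hmin⟩ := he hex
    have h5 := hall _ hmem hmin
    have h6 : ρ ≤ ‖est n ω - s₀ n ω‖ := hlarge
    linarith
  · rw [← ENNReal.ofReal_add (by positivity) (by positivity), add_halves]

end GVCMM.IsGLMSample

/-! ### Measurability and continuity of the matrix inverse. -/

section MatrixInverse

variable {κ : Type*} [Fintype κ] [DecidableEq κ]

/-- With 0⁻¹ = 0 this also holds for singular matrices, so entries of the inverse are measurable
everywhere and continuous where the determinant does not vanish. -/
theorem Matrix.inv_apply_eq_inv_det_mul (A : Matrix κ κ ℝ) (k l : κ) :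
    A⁻¹ k l = (A.det)⁻¹ * A.adjugate k l := by
  rw [Matrix.inv_def, Matrix.smul_apply, Ring.inverse_eq_inv', smul_eq_mul]

theorem continuous_matrix_det_of : Continuous fun f : κ → κ → ℝ => (Matrix.of f).det :=
  Continuous.matrix_det (A := fun f : κ → κ → ℝ => Matrix.of f) continuous_id

theorem continuous_matrix_adjugate_of (k l : κ) :
    Continuous fun f : κ → κ → ℝ => (Matrix.of f).adjugate k l :=
  Continuous.matrix_elem
    (Continuous.matrix_adjugate (A := fun f : κ → κ → ℝ => Matrix.of f) continuous_id) k l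

theorem measurable_matrix_inv_apply {Ω : Type*} [MeasurableSpace Ω] {A : Ω → Matrix κ κ ℝ}
    (hA : ∀ k l, Measurable fun ω => A ω k l) (k l : κ) : Measurable fun ω => (A ω)⁻¹ k l := by
  have h : Measurable fun ω => (fun k l => A ω k l : κ → κ → ℝ) :=
    measurable_pi_lambda _ fun k => measurable_pi_lambda _ fun l => hA k l
  simp_rw [Matrix.inv_apply_eq_inv_det_mul]
  exact ((continuous_matrix_det_of.measurable.comp h).inv).mul
    ((continuous_matrix_adjugate_of k l).measurable.comp h)

theorem measurable_matrix_det {Ω : Type*} [MeasurableSpace Ω] {A : Ω → Matrix κ κ ℝ}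
    (hA : ∀ k l, Measurable fun ω => A ω k l) : Measurable fun ω => (A ω).det :=
  continuous_matrix_det_of.measurable.comp
    (measurable_pi_lambda _ fun k => measurable_pi_lambda _ fun l => hA k l)

theorem tendsto_matrix_det {α : Type*} {l : Filter α} {A : α → Matrix κ κ ℝ} {S : Matrix κ κ ℝ}
    (hA : ∀ k l', Tendsto (fun a => A a k l') l (𝓝 (S k l'))) :
    Tendsto (fun a => (A a).det) l (𝓝 S.det) :=
  (continuous_matrix_det_of.tendsto (fun k l => S k l)).comp
    (tendsto_pi_nhds.2 fun k => tendsto_pi_nhds.2 fun l => hA k l)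

theorem tendsto_matrix_inv_apply {α : Type*} {l : Filter α} {A : α → Matrix κ κ ℝ}
    {S : Matrix κ κ ℝ} (hA : ∀ k l', Tendsto (fun a => A a k l') l (𝓝 (S k l')))
    (hS : S.det ≠ 0) (k l' : κ) :
    Tendsto (fun a => (A a)⁻¹ k l') l (𝓝 (S⁻¹ k l')) := by
  simp_rw [Matrix.inv_apply_eq_inv_det_mul]
  exact ((tendsto_matrix_det hA).inv₀ hS).mul
    (((continuous_matrix_adjugate_of k l').tendsto (fun k l => S k l)).comp
      (tendsto_pi_nhds.2 fun k => tendsto_pi_nhds.2 fun l => hA k l))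

end MatrixInverse

/-! ### Asymptotic linearity of least squares. -/

section LeastSquares

/-- Allows an identity to fail on an event detected by h; it will be the event that the Gram matrix
is singular. -/
theorem SmallInProb.congr_of_small {Ω E : Type*} [MeasurableSpace Ω] {μ : Measure Ω}
    [NormedAddCommGroup E] {f g : ℕ → Ω → E} {h : ℕ → Ω → ℝ} (hg : SmallInProb μ g)
    (hh : SmallInProb μ h) (hfg : ∀ᶠ n in atTop, ∀ ω, |h n ω| < 1 → f n ω = g n ω) :
    SmallInProb μ f := by
  intro ε hε
  have := (hg ε hε).add (hh 1 one_pos)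
  rw [add_zero] at this
  refine tendsto_of_tendsto_of_tendsto_of_le_of_le' tendsto_const_nhds this
    (Eventually.of_forall fun _ => zero_le) ?_
  filter_upwards [hfg] with n hn
  refine (measure_mono fun ω hω => ?_).trans (measure_union_le _ _)
  by_cases hc : |h n ω| < 1
  · left
    have h1 : ε ≤ ‖f n ω‖ := hω
    rwa [hn ω hc] at h1
  · right
    exact not_lt.1 hc

variable {Ω κ ρ : Type*} {X : ℕ → Ω → κ → ℝ} {m : ℕ → Ω → ρ → ℝ} {C : Matrix κ ρ ℝ}

/-- The least squares estimator in the multivariate regression of `m` on `X`. -/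
def leastSquares [Fintype κ] [DecidableEq κ] (X : ℕ → Ω → κ → ℝ) (m : ℕ → Ω → ρ → ℝ)
    (n : ℕ) (ω : Ω) : Matrix κ ρ ℝ :=
  ((Matrix.of fun i : Fin n => X i ω)ᵀ * (Matrix.of fun i : Fin n => X i ω))⁻¹ *
    (Matrix.of fun i : Fin n => X i ω)ᵀ * (Matrix.of fun i : Fin n => m i ω)

/-- The normalized cross product `n^{-1/2} ∑ Xᵢ (mᵢ - Cᵀ Xᵢ)ᵀ`. -/
def normalizedCross [Fintype κ] (X : ℕ → Ω → κ → ℝ) (m : ℕ → Ω → ρ → ℝ)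
    (C : Matrix κ ρ ℝ) (n : ℕ) (ω : Ω) :
    Matrix κ ρ ℝ :=
  Matrix.of fun k j => (√(n : ℝ))⁻¹ * ∑ i ∈ Finset.range n, X i ω k * (m i ω - Cᵀ *ᵥ X i ω) j

theorem gram_apply (n : ℕ) (ω : Ω) (k l : κ) :
    ((Matrix.of fun i : Fin n => X i ω)ᵀ * (Matrix.of fun i : Fin n => X i ω)) k l =
      ∑ i ∈ Finset.range n, X i ω k * X i ω l := by
  rw [Finset.sum_range]
  simp [Matrix.mul_apply]

/-- The estimation error of least squares when the Gram matrix is invertible. -/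
theorem sqrt_smul_leastSquares_sub [Fintype κ] [DecidableEq κ] {n : ℕ} (hn : 0 < n) (ω : Ω)
    (hdet : ((n : ℝ)⁻¹ • ((Matrix.of fun i : Fin n => X i ω)ᵀ *
      (Matrix.of fun i : Fin n => X i ω))).det ≠ 0) :
    √(n : ℝ) • (leastSquares X m n ω - C) =
      ((n : ℝ)⁻¹ • ((Matrix.of fun i : Fin n => X i ω)ᵀ *
        (Matrix.of fun i : Fin n => X i ω)))⁻¹ * normalizedCross X m C n ω := by
  set D : Matrix (Fin n) κ ℝ := Matrix.of fun i : Fin n => X i ω with hD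
  set M : Matrix (Fin n) ρ ℝ := Matrix.of fun i : Fin n => m i ω with hM
  have hn' : (0 : ℝ) < n := by exact_mod_cast hn
  have hW : normalizedCross X m C n ω = (√(n : ℝ))⁻¹ • (Dᵀ * (M - D * C)) := by
    ext k j
    simp only [normalizedCross, Matrix.of_apply, Matrix.smul_apply, smul_eq_mul, Matrix.mul_apply,
      Matrix.transpose_apply, Matrix.sub_apply, hD, hM, Pi.sub_apply, Matrix.mulVec, dotProduct]
    rw [Finset.sum_range]
    congr 1
    refine Finset.sum_congr rfl fun i _ => ?_
    congr 2
    exact Finset.sum_congr rfl fun l _ => mul_comm _ _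
  have hdet' : (Dᵀ * D).det ≠ 0 := by
    rw [Matrix.det_smul] at hdet
    exact right_ne_zero_of_mul hdet
  have hinv : ((n : ℝ)⁻¹ • (Dᵀ * D))⁻¹ = (n : ℝ) • (Dᵀ * D)⁻¹ := by
    refine Matrix.inv_eq_left_inv ?_
    rw [Matrix.smul_mul, Matrix.mul_smul, smul_smul, mul_inv_cancel₀ hn'.ne', one_smul,
      Matrix.nonsing_inv_mul _ (isUnit_iff_ne_zero.2 hdet')]
  have hLS : leastSquares X m n ω - C = (Dᵀ * D)⁻¹ * (Dᵀ * (M - D * C)) := by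
    rw [leastSquares, Matrix.mul_sub, Matrix.mul_sub, ← Matrix.mul_assoc, ← Matrix.mul_assoc Dᵀ D C,
      ← Matrix.mul_assoc _ (Dᵀ * D) C, Matrix.nonsing_inv_mul _ (isUnit_iff_ne_zero.2 hdet'),
      Matrix.one_mul]
  rw [hW, hinv, hLS, Matrix.smul_mul, Matrix.mul_smul, smul_smul]
  congr 1
  rw [← div_eq_mul_inv, Real.div_sqrt]

theorem boundedInProb_normalizedCross [MeasurableSpace Ω] {μ : Measure Ω}
    [IsProbabilityMeasure μ] [Fintype κ]
    (hindep : iIndepFun (fun i ω => (X i ω, m i ω)) μ)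
    (hident : ∀ i, IdentDistrib (fun ω => (X i ω, m i ω)) (fun ω => (X 0 ω, m 0 ω)) μ μ)
    (hLp : ∀ k j, MemLp (fun ω => X 0 ω k * (m 0 ω - Cᵀ *ᵥ X 0 ω) j) 2 μ)
    (hmean : ∀ k j, ∫ ω, X 0 ω k * (m 0 ω - Cᵀ *ᵥ X 0 ω) j ∂μ = 0) (k : κ) (j : ρ) :
    BoundedInProb μ fun n ω => normalizedCross X m C n ω k j := by
  have hg : Measurable fun z : (κ → ℝ) × (ρ → ℝ) => z.1 k * (z.2 - Cᵀ *ᵥ z.1) j := by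
    simp only [Pi.sub_apply, Matrix.mulVec, dotProduct]; fun_prop
  exact boundedInProb_normalized_sum (X := fun i ω => X i ω k * (m i ω - Cᵀ *ᵥ X i ω) j)
    (hLp k j) (hmean k j) (fun i i' hii => (hindep.indepFun hii).comp hg hg)
    (fun i => (hident i).comp hg)

/-- Asymptotic linearity of the least squares estimator. -/
theorem smallInProb_leastSquares_sub [MeasurableSpace Ω] {μ : Measure Ω}
    [IsProbabilityMeasure μ] [Fintype κ] [DecidableEq κ] (hX : ∀ i, Measurable (X i))
    (hindep : iIndepFun (fun i ω => (X i ω, m i ω)) μ)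
    (hident : ∀ i, IdentDistrib (fun ω => (X i ω, m i ω)) (fun ω => (X 0 ω, m 0 ω)) μ μ)
    (hint : ∀ k l, Integrable (fun ω => X 0 ω k * X 0 ω l) μ)
    (hunit : IsUnit (Matrix.of fun k l => ∫ ω, X 0 ω k * X 0 ω l ∂μ))
    (hLp : ∀ k j, MemLp (fun ω => X 0 ω k * (m 0 ω - Cᵀ *ᵥ X 0 ω) j) 2 μ)
    (hmean : ∀ k j, ∫ ω, X 0 ω k * (m 0 ω - Cᵀ *ᵥ X 0 ω) j ∂μ = 0) (k : κ) (j : ρ) :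
    SmallInProb μ fun n ω => (√(n : ℝ) • (leastSquares X m n ω - C) -
      (Matrix.of fun k l => ∫ ω, X 0 ω k * X 0 ω l ∂μ)⁻¹ * normalizedCross X m C n ω) k j := by
  set S : Matrix κ κ ℝ := Matrix.of fun k l => ∫ ω, X 0 ω k * X 0 ω l ∂μ with hS
  have hdetS : S.det ≠ 0 := isUnit_iff_ne_zero.1 ((Matrix.isUnit_iff_isUnit_det _).1 hunit)
  set A : ℕ → Ω → Matrix κ κ ℝ := fun n ω => (n : ℝ)⁻¹ • ((Matrix.of fun i : Fin n => X i ω)ᵀ *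
        (Matrix.of fun i : Fin n => X i ω)) with hA
  have hAapp : ∀ n ω k l, A n ω k l = (∑ i ∈ Finset.range n, X i ω k * X i ω l) / n := by
    intro n ω k l
    simp only [hA, Matrix.smul_apply, gram_apply, smul_eq_mul, inv_mul_eq_div]
  have hAm : ∀ n k l, Measurable fun ω => A n ω k l := fun n k l => by
    simp_rw [hAapp]; fun_prop
  have hAlim : ∀ᵐ ω ∂μ, ∀ k l, Tendsto (fun n => A n ω k l) atTop (𝓝 (S k l)) := by
    simp_rw [ae_all_iff, hAapp]
    intro k l
    have hg : Measurable fun z : (κ → ℝ) × (ρ → ℝ) => z.1 k * z.1 l := by fun_prop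
    exact strong_law_ae_real (fun i ω => X i ω k * X i ω l) (hint k l)
      (fun i i' hii => (hindep.indepFun hii).comp hg hg) (fun i => (hident i).comp hg)
  have hsmall : ∀ l, SmallInProb μ fun n ω => (A n ω)⁻¹ k l - S⁻¹ k l := fun l => by
    refine smallInProb_of_ae_tendsto (fun n =>
      ((measurable_matrix_inv_apply (hAm n) k l).sub_const _).aestronglyMeasurable) ?_
    filter_upwards [hAlim] with ω hω
    simpa using (tendsto_matrix_inv_apply hω hdetS k l).sub_const (S⁻¹ k l)
  -- This expression is 0 for an invertible Gram matrix and -1 for a singular one.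
  have hdet : SmallInProb μ fun n ω => (A n ω).det⁻¹ * (A n ω).det - 1 := by
    have hm := fun n => measurable_matrix_det (hAm n)
    refine smallInProb_of_ae_tendsto (fun n => Measurable.aestronglyMeasurable (by fun_prop)) ?_
    filter_upwards [hAlim] with ω hω
    refine tendsto_const_nhds.congr' ?_
    filter_upwards [(tendsto_matrix_det hω).eventually_ne hdetS] with n hn
    rw [inv_mul_cancel₀ hn, sub_self]
  -- The error of replacing the empirical inverse by its limit: small factors times bounded ones.
  have hmain : SmallInProb μ fun n ω =>
      ∑ l, ((A n ω)⁻¹ k l - S⁻¹ k l) * normalizedCross X m C n ω l j :=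
    SmallInProb.sum _ fun l _ => (hsmall l).mul_bounded
      (boundedInProb_normalizedCross hindep hident hLp hmean l j)
  refine hmain.congr_of_small hdet ?_
  filter_upwards [eventually_gt_atTop 0] with n hn ω hω
  have hne : (A n ω).det ≠ 0 := by
    intro h0
    rw [h0] at hω
    simp at hω
  rw [sqrt_smul_leastSquares_sub hn ω hne, ← Matrix.sub_mul, Matrix.mul_apply]
  rfl

end LeastSquares

/-! ### The spline model as a generalized linear model in (m*, x*). -/

namespace GVCMM

theorem kronRow_mulVec_apply (r : ℕ) {K : ℕ} (w : Fin K → ℝ) (a : Fin r × Fin K → ℝ) (l : Fin r) :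
    (kronRow r w *ᵥ a) l = (fun k => a (l, k)) ⬝ᵥ w := by
  simp [kronRow, Matrix.mulVec, dotProduct, Fintype.sum_prod_type, Matrix.one_apply, mul_comm]

theorem transpose_kronRow_mulVec (r : ℕ) {K : ℕ} (w : Fin K → ℝ) (v : Fin r → ℝ) :
    (kronRow r w)ᵀ *ᵥ v = stack v w := by
  ext ⟨l, k⟩
  simp [kronRow, Matrix.mulVec, dotProduct, stack, Matrix.one_apply, mul_comm]

theorem kronRow_mulVec_dotProduct (r : ℕ) {K : ℕ} (w : Fin K → ℝ) (a : Fin r × Fin K → ℝ)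
    (v : Fin r → ℝ) : (kronRow r w *ᵥ a) ⬝ᵥ v = a ⬝ᵥ stack v w := by
  rw [← transpose_kronRow_mulVec, Matrix.dotProduct_mulVec, Matrix.vecMul_transpose]

theorem measurable_stack {r K : ℕ} : Measurable fun z : (Fin r → ℝ) × (Fin K → ℝ) =>
    stack z.1 z.2 :=
  measurable_pi_lambda _ fun jk => by unfold stack; fun_prop

namespace Model

variable {p q : ℕ} (G : Model p q)

/-- Index set of the spline coefficients of `α₀` and `α₁`. -/
abbrev Idx : Type := (Fin p × Fin G.knots₀.dim) ⊕ (Fin q × Fin G.knots₁.dim)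

/-- The vector of all spline coefficients of `α₀` and `α₁`. -/
def flat (θ : G.Param) : G.Idx → ℝ := Sum.elim θ.1 θ.2

/-- The inverse of `flat`. -/
def unflat (θ : G.Idx → ℝ) : G.Param := (fun j => θ (Sum.inl j), fun l => θ (Sum.inr l))

theorem flat_unflat (θ : G.Idx → ℝ) : G.flat (G.unflat θ) = θ := by
  ext (j | l) <;> rfl

theorem unflat_flat (θ : G.Param) : G.unflat (G.flat θ) = θ := rfl

/-- The vector `(m*, x*)` as a function of `(u, m, x)`. -/
def covariate (w : ℝ × (Fin p → ℝ) × (Fin q → ℝ)) : G.Idx → ℝ :=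
  Sum.elim (stack w.2.1 (G.knots₀.basis w.1)) (stack w.2.2 (G.knots₁.basis w.1))

/-- The vector `xᵐ` as a function of `(u, m, x)`. -/
def regressor (w : ℝ × (Fin p → ℝ) × (Fin q → ℝ)) : Fin q × Fin G.knotsM.dim → ℝ :=
  stack w.2.2 (G.knotsM.basis w.1)

/-- The error of the mediator equation in terms of the spline coefficients. -/
def resid (w : ℝ × (Fin p → ℝ) × (Fin q → ℝ)) : Fin p → ℝ :=
  w.2.1 - (G.C)ᵀ *ᵥ G.regressor w

theorem measurable_covariate : Measurable G.covariate := by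
  have h₀ := G.knots₀.measurable_basis
  have h₁ := G.knots₁.measurable_basis
  refine measurable_pi_lambda _ ?_
  rintro (j | l)
  · exact (measurable_pi_apply j).comp (measurable_stack.comp
      ((by fun_prop : Measurable fun w : ℝ × (Fin p → ℝ) × (Fin q → ℝ) => w.2.1).prodMk
        (h₀.comp measurable_fst)))
  · exact (measurable_pi_apply l).comp (measurable_stack.comp
      ((by fun_prop : Measurable fun w : ℝ × (Fin p → ℝ) × (Fin q → ℝ) => w.2.2).prodMk
        (h₁.comp measurable_fst)))

theorem measurable_regressor : Measurable G.regressor :=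
  measurable_stack.comp
      ((by fun_prop : Measurable fun w : ℝ × (Fin p → ℝ) × (Fin q → ℝ) => w.2.2).prodMk
        (G.knotsM.measurable_basis.comp measurable_fst))

theorem measurable_resid : Measurable G.resid := by
  have := G.measurable_regressor
  refine measurable_pi_lambda _ fun j => ?_
  simp only [resid, Pi.sub_apply, Matrix.mulVec, dotProduct]
  fun_prop

variable {Ω : Type*} (D : Data Ω p q)

/-- The covariates `(u, m, x)` of an observation. -/
def obs (D : Data Ω p q) (i : ℕ) (ω : Ω) : ℝ × (Fin p → ℝ) × (Fin q → ℝ) :=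
  (D.u i ω, D.m i ω, D.x i ω)

theorem covariate_obs (i : ℕ) (ω : Ω) :
    G.covariate (obs D i ω) = Sum.elim (G.mStar D i ω) (G.xStar D i ω) := rfl

theorem predictor_eq (θ : G.Param) (i : ℕ) (ω : Ω) :
    G.predictor D θ i ω = G.flat θ ⬝ᵥ G.covariate (obs D i ω) := by
  rw [covariate_obs, flat, sumElim_dotProduct_sumElim]; rfl

theorem covariate_dotProduct_self (i : ℕ) (ω : Ω) :
    G.covariate (obs D i ω) ⬝ᵥ G.covariate (obs D i ω) =
      G.mStar D i ω ⬝ᵥ G.mStar D i ω + G.xStar D i ω ⬝ᵥ G.xStar D i ω := by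
  rw [covariate_obs, sumElim_dotProduct_sumElim]

variable {G D}

theorem IsSplineModel.canonical_eq (h : G.IsSplineModel) {w : ℝ × (Fin p → ℝ) × (Fin q → ℝ)}
    (hw : w.1 ∈ Icc G.lo G.hi) : G.canonical w = G.flat G.trueParam ⬝ᵥ G.covariate w := by
  rw [canonical, h.α₀_eq _ hw, h.α₁_eq _ hw, kronRow_mulVec_dotProduct, kronRow_mulVec_dotProduct,
    covariate, flat, sumElim_dotProduct_sumElim]
  rfl

theorem IsSplineModel.err_eq (h : G.IsSplineModel) {i : ℕ} {ω : Ω}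
    (hw : D.u i ω ∈ Icc G.lo G.hi) : G.err D i ω = G.resid (obs D i ω) := by
  rw [err, h.Γ_eq _ hw, Matrix.transpose_mul, ← Matrix.mulVec_mulVec, transpose_kronRow_mulVec]
  rfl

variable [MeasurableSpace Ω] {μ : Measure Ω}

theorem CondDensity.ae_mem (h : G.CondDensity D μ) (hu : Measurable (D.u 0)) :
    ∀ᵐ ω ∂μ, D.u 0 ω ∈ Icc G.lo G.hi := by
  refine ae_of_ae_map hu.aemeasurable ?_
  rw [h.law]
  exact (withDensity_absolutelyContinuous _ _).ae_le (ae_restrict_mem measurableSet_Icc)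

/-- The positive lower bound of the density makes null sets of the law of u Lebesgue null on [lo,
hi], so linear independence of the splines can be applied to statements about the law of u. -/
theorem CondDensity.ae_restrict (h : G.CondDensity D μ) {P : ℝ → Prop}
    (hP : ∀ᵐ t ∂(μ.map (D.u 0)), P t) :
    ∀ᵐ t ∂(volume.restrict (Icc G.lo G.hi)), P t := by
  have hm := h.measurable
  rw [h.law, ae_withDensity_iff (by fun_prop)] at hP
  obtain ⟨l, L, hl, hbd⟩ := h.bounds
  filter_upwards [hP, ae_restrict_mem measurableSet_Icc] with t ht hmem
  refine ht ?_
  simpa using hl.trans_le (hbd t hmem).1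

theorem measurable_obs (hS : G.IsSample D μ) (i : ℕ) : Measurable (obs D i) :=
  (hS.measurable_u i).prodMk ((hS.measurable_m i).prodMk (hS.measurable_x i))

theorem iIndepFun_obs (hS : G.IsSample D μ) :
    iIndepFun (fun i ω => (obs D i ω, D.y i ω)) μ :=
  hS.indep.comp (fun _ z => ((z.1, z.2.1, z.2.2.1), z.2.2.2)) (fun _ => by fun_prop)

theorem identDistrib_obs (hS : G.IsSample D μ) (i : ℕ) :
    IdentDistrib (fun ω => (obs D i ω, D.y i ω)) (fun ω => (obs D 0 ω, D.y 0 ω)) μ μ :=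
  (hS.identDistrib i).comp
    (u := fun z : ℝ × (Fin p → ℝ) × (Fin q → ℝ) × ℝ => ((z.1, z.2.1, z.2.2.1), z.2.2.2))
    (by fun_prop)

theorem HasExpFamilyResponse.isExpFamily [IsFiniteMeasure μ] (h : G.HasExpFamilyResponse D μ) :
    IsExpFamily G.ν (fun y => G.c y G.φ) G.b G.Θ G.φ :=
  ⟨h.φ_pos, h.measurable_c, h.c_nonneg, h.isOpen_Θ, h.ordConnected_Θ, h.lintegral_eq_one⟩

theorem ae_obs_mem (hS : G.IsSample D μ) (hd : G.CondDensity D μ) :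
    ∀ᵐ w ∂(μ.map (obs D 0)), w.1 ∈ Icc G.lo G.hi := by
  have hm : MeasurableSet {w : ℝ × (Fin p → ℝ) × (Fin q → ℝ) | w.1 ∈ Icc G.lo G.hi} :=
    measurable_fst measurableSet_Icc
  rw [ae_map_iff (measurable_obs hS 0).aemeasurable hm]
  exact hd.ae_mem (hS.measurable_u 0)

theorem ae_predictor_mem [IsFiniteMeasure μ] (hS : G.IsSample D μ)
    (hr : G.HasExpFamilyResponse D μ) (hsp : G.IsSplineModel) (hd : G.CondDensity D μ) :
    ∀ᵐ w ∂(μ.map (obs D 0)), G.flat G.trueParam ⬝ᵥ G.covariate w ∈ G.Θ := by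
  have hc := G.measurable_covariate
  have hm : Measurable fun w => G.flat G.trueParam ⬝ᵥ G.covariate w := by
    unfold dotProduct; fun_prop
  rw [ae_map_iff (measurable_obs hS 0).aemeasurable (hm hr.isOpen_Θ.measurableSet)]
  filter_upwards [hr.canonical_mem, hd.ae_mem (hS.measurable_u 0)] with ω h1 h2
  rwa [hsp.canonical_eq (w := (D.u 0 ω, D.m 0 ω, D.x 0 ω)) h2] at h1

theorem ae_condDistrib_eq [IsFiniteMeasure μ] (hS : G.IsSample D μ)
    (hr : G.HasExpFamilyResponse D μ) (hsp : G.IsSplineModel) (hd : G.CondDensity D μ) :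
    ∀ᵐ w ∂(μ.map (obs D 0)), condDistrib (D.y 0) (obs D 0) μ w =
      IsExpFamily.law G.ν (fun y => G.c y G.φ) G.b G.φ
        (G.flat G.trueParam ⬝ᵥ G.covariate w) := by
  filter_upwards [hr.condDistrib_eq, ae_obs_mem hS hd] with w h1 h2
  rw [← hsp.canonical_eq h2]
  exact h1

/-- The residual `y - b'(η)`. -/
def respResid (G : Model p q) (D : Data Ω p q) (i : ℕ) (ω : Ω) : ℝ :=
  D.y i ω - deriv G.b (G.flat G.trueParam ⬝ᵥ G.covariate (obs D i ω))

/-- A product of sup-normed spaces carries the maximum norm, so flattening is an isometry and δ is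
unchanged. -/
theorem regular_flat (hreg : G.GLMRegular D μ) : ∃ δ > 0, ∃ H : Ω → ℝ, Integrable H μ ∧
    ∀ᵐ ω ∂μ, ∀ θ ∈ Metric.ball (G.flat G.trueParam) δ,
      θ ⬝ᵥ G.covariate (obs D 0 ω) ∈ G.Θ ∧
      (G.covariate (obs D 0 ω) ⬝ᵥ G.covariate (obs D 0 ω)) *
        iteratedDeriv 2 G.b (θ ⬝ᵥ G.covariate (obs D 0 ω)) ≤ H ω := by
  obtain ⟨δ, hδ, H, hH, h⟩ := hreg
  refine ⟨δ, hδ, H, hH, ?_⟩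
  filter_upwards [h] with ω hω θ hθ
  have hθ' : G.unflat θ ∈ Metric.ball G.trueParam δ := by
    rw [Metric.mem_ball, dist_pi_lt_iff hδ] at hθ
    rw [Metric.mem_ball, Prod.dist_eq, max_lt_iff, dist_pi_lt_iff hδ, dist_pi_lt_iff hδ]
    exact ⟨fun j => hθ (Sum.inl j), fun l => hθ (Sum.inr l)⟩
  have := hω _ hθ'
  rwa [predictor_eq, flat_unflat, ← covariate_dotProduct_self] at this

variable [IsProbabilityMeasure μ]

theorem integrable_covariate_sq (hS : G.IsSample D μ) (hr : G.HasExpFamilyResponse D μ)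
    (hreg : G.GLMRegular D μ) (s : G.Idx → ℝ) :
    Integrable (fun ω => (s ⬝ᵥ G.covariate (obs D 0 ω)) ^ 2 *
      iteratedDeriv 2 G.b (G.flat G.trueParam ⬝ᵥ G.covariate (obs D 0 ω))) μ := by
  obtain ⟨δ, hδ, H, hH, h⟩ := regular_flat hreg
  have hb2 : Measurable (iteratedDeriv 2 G.b) := by
    rw [iteratedDeriv_succ]; exact measurable_deriv _
  have hc := G.measurable_covariate
  have hW := measurable_obs hS 0
  refine (hH.const_mul (s ⬝ᵥ s)).mono'
    (Measurable.aestronglyMeasurable (by unfold dotProduct; fun_prop)) ?_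
  filter_upwards [h] with ω hω
  obtain ⟨h1, h2⟩ := hω _ (Metric.mem_ball_self hδ)
  have h3 := hr.isExpFamily.iteratedDeriv_two_nonneg h1
  have hss : 0 ≤ s ⬝ᵥ s := Finset.sum_nonneg fun i _ => mul_self_nonneg _
  rw [Real.norm_of_nonneg (mul_nonneg (sq_nonneg _) h3)]
  refine (mul_le_mul_of_nonneg_right (dotProduct_sq_le _ _) h3).trans ?_
  rw [mul_assoc]
  exact mul_le_mul_of_nonneg_left h2 hss

theorem memLp_score (hS : G.IsSample D μ) (hr : G.HasExpFamilyResponse D μ)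
    (hsp : G.IsSplineModel) (hd : G.CondDensity D μ) (hreg : G.GLMRegular D μ) (s : G.Idx → ℝ) :
    MemLp (fun ω => (s ⬝ᵥ G.covariate (obs D 0 ω)) * G.respResid D 0 ω) 2 μ ∧
    ∫ ω, ((s ⬝ᵥ G.covariate (obs D 0 ω)) * G.respResid D 0 ω) ^ 2 ∂μ =
      G.φ * ∫ ω, (s ⬝ᵥ G.covariate (obs D 0 ω)) ^ 2 *
        iteratedDeriv 2 G.b (G.flat G.trueParam ⬝ᵥ G.covariate (obs D 0 ω)) ∂μ := by
  have hc := G.measurable_covariate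
  have hη : ∀ s : G.Idx → ℝ, Measurable fun w => s ⬝ᵥ G.covariate w := fun s => by
    unfold dotProduct; fun_prop
  exact hr.isExpFamily.memLp_residual (measurable_obs hS 0) (hS.measurable_y 0)
    (hη (G.flat G.trueParam)) (ae_predictor_mem hS hr hsp hd) (ae_condDistrib_eq hS hr hsp hd)
    (hη s) (integrable_covariate_sq hS hr hreg s)

theorem integral_mul_respResid (hS : G.IsSample D μ) (hr : G.HasExpFamilyResponse D μ)
    (hsp : G.IsSplineModel) (hd : G.CondDensity D μ)
    {g : ℝ × (Fin p → ℝ) × (Fin q → ℝ) → ℝ} (hg : Measurable g)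
    (hint : Integrable (fun ω => g (obs D 0 ω) * G.respResid D 0 ω) μ) :
    ∫ ω, g (obs D 0 ω) * G.respResid D 0 ω ∂μ = 0 := by
  have hc := G.measurable_covariate
  have hη : Measurable fun w => G.flat G.trueParam ⬝ᵥ G.covariate w := by
    unfold dotProduct; fun_prop
  exact hr.isExpFamily.integral_residual_eq_zero (measurable_obs hS 0) (hS.measurable_y 0)
    hη (ae_predictor_mem hS hr hsp hd) (ae_condDistrib_eq hS hr hsp hd) hg hint

theorem isGLMSample (hS : G.IsSample D μ) (hr : G.HasExpFamilyResponse D μ)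
    (hsp : G.IsSplineModel) (hd : G.CondDensity D μ) (hreg : G.GLMRegular D μ) :
    IsGLMSample μ (fun i ω => G.covariate (obs D i ω)) D.y G.b G.Θ (G.flat G.trueParam) := by
  classical
  have hc := G.measurable_covariate
  have hm : Measurable fun z : (ℝ × (Fin p → ℝ) × (Fin q → ℝ)) × ℝ => (G.covariate z.1, z.2) := by
    fun_prop
  have hLp : ∀ j, MemLp (fun ω => G.covariate (obs D 0 ω) j * G.respResid D 0 ω) 2 μ := fun j => by
    have := (memLp_score hS hr hsp hd hreg (Pi.single j 1)).1
    simpa using this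
  refine ⟨fun i => hc.comp (measurable_obs hS i),
    (iIndepFun_obs hS).comp (fun _ => fun z => (G.covariate z.1, z.2)) (fun _ => hm),
    fun i => (identDistrib_obs hS i).comp hm, hLp, fun j => ?_, regular_flat hreg⟩
  exact integral_mul_respResid hS hr hsp hd (g := fun w => G.covariate w j) (by fun_prop)
    ((hLp j).integrable one_le_two)

end Model

end GVCMM

/-! ### Positive definiteness of the information matrix. -/

namespace GVCMM

theorem EigenvaluesBounded.eq_zero_of_mulVec_eq_zero {r : ℕ} {S : Matrix (Fin r) (Fin r) ℝ}
    (hS : EigenvaluesBounded S) {a : Fin r → ℝ} (ha : S *ᵥ a = 0) : a = 0 := by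
  by_contra hne
  obtain ⟨N₁, N₂, hN, h⟩ := hS
  have := h 0 (Module.End.hasEigenvalue_of_hasEigenvector (x := a)
    ⟨by simpa [Module.End.mem_eigenspace_iff] using ha, hne⟩)
  linarith [this.1]

namespace Model

variable {p q : ℕ} {G : Model p q} {Ω : Type*} {D : Data Ω p q} [MeasurableSpace Ω] {μ : Measure Ω}

theorem memLp_regressor (hS : G.IsSample D μ) (hd : G.CondDensity D μ) (hm : CondMoments D μ)
    (k : Fin q × Fin G.knotsM.dim) : MemLp (fun ω => G.regressor (obs D 0 ω) k) 2 μ := by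
  obtain ⟨K, hK⟩ := G.knotsM.basis_bounded
  have hr := G.measurable_regressor
  have hW := measurable_obs hS 0
  refine MemLp.of_le_mul (c := K) (hm.memLp_x k.1)
    (Measurable.aestronglyMeasurable (by fun_prop)) ?_
  filter_upwards [hd.ae_mem (hS.measurable_u 0)] with ω hω
  simp only [regressor, obs, stack, norm_mul]
  rw [mul_comm]
  exact mul_le_mul_of_nonneg_right (hK _ hω _) (norm_nonneg _)

theorem memLp_resid (hS : G.IsSample D μ) (hd : G.CondDensity D μ) (hm : CondMoments D μ)
    (j : Fin p) : MemLp (fun ω => G.resid (obs D 0 ω) j) 2 μ := by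
  simp only [resid, Pi.sub_apply, Matrix.mulVec, dotProduct]
  exact (hm.memLp_m j).sub
    (memLp_finsetSum _ fun k _ => (memLp_regressor hS hd hm k).const_mul _)

theorem err_ae_eq (hS : G.IsSample D μ) (hsp : G.IsSplineModel) (hd : G.CondDensity D μ) :
    G.err D 0 =ᵐ[μ] fun ω => G.resid (obs D 0 ω) := by
  filter_upwards [hd.ae_mem (hS.measurable_u 0)] with ω hω using hsp.err_eq hω

theorem indepFun_resid (hS : G.IsSample D μ) (hsp : G.IsSplineModel) (hd : G.CondDensity D μ) :
    IndepFun (fun ω => G.resid (obs D 0 ω)) (fun ω => (D.x 0 ω, D.u 0 ω)) μ :=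
  hS.err_indep.congr (err_ae_eq hS hsp hd) (EventuallyEq.refl _ _)

theorem integral_resid (hS : G.IsSample D μ) (hsp : G.IsSplineModel) (hd : G.CondDensity D μ)
    (j : Fin p) : ∫ ω, G.resid (obs D 0 ω) j ∂μ = 0 := by
  rw [← hS.err_mean j]
  refine integral_congr_ae ?_
  filter_upwards [err_ae_eq hS hsp hd] with ω hω
  rw [hω]

theorem integral_dotProduct_resid (hS : G.IsSample D μ) (hsp : G.IsSplineModel)
    (hd : G.CondDensity D μ) [IsFiniteMeasure μ] (hm : CondMoments D μ) (a : Fin p → ℝ) :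
    ∫ ω, a ⬝ᵥ G.resid (obs D 0 ω) ∂μ = 0 := by
  simp only [dotProduct]
  rw [integral_finsetSum _ fun j _ =>
    ((memLp_resid hS hd hm j).integrable one_le_two).const_mul _]
  simp [integral_const_mul, integral_resid hS hsp hd]

theorem integrable_resid_mul (hS : G.IsSample D μ) (hd : G.CondDensity D μ)
    (hm : CondMoments D μ) (j k : Fin p) :
    Integrable (fun ω => G.resid (obs D 0 ω) j * G.resid (obs D 0 ω) k) μ :=
  (memLp_resid hS hd hm j).integrable_mul (memLp_resid hS hd hm k)

theorem covErr_eq (hS : G.IsSample D μ) (hsp : G.IsSplineModel) (hd : G.CondDensity D μ) :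
    G.covErr D μ = Matrix.of fun j k =>
      ∫ ω, G.resid (obs D 0 ω) j * G.resid (obs D 0 ω) k ∂μ := by
  ext j k
  refine integral_congr_ae ?_
  filter_upwards [err_ae_eq hS hsp hd] with ω hω
  rw [hω]

theorem sq_dotProduct_resid (hS : G.IsSample D μ) (hsp : G.IsSplineModel)
    (hd : G.CondDensity D μ) (hm : CondMoments D μ) (a : Fin p → ℝ) :
    Integrable (fun ω => (a ⬝ᵥ G.resid (obs D 0 ω)) ^ 2) μ ∧
    ∫ ω, (a ⬝ᵥ G.resid (obs D 0 ω)) ^ 2 ∂μ = a ⬝ᵥ G.covErr D μ *ᵥ a := by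
  have h := integral_sum_sum_mul (fun j k => integrable_resid_mul hS hd hm j k) a a
  rw [covErr_eq hS hsp hd]
  have hexp : ∀ ω, (a ⬝ᵥ G.resid (obs D 0 ω)) ^ 2 = ∑ j, ∑ k, a j * a k *
      (G.resid (obs D 0 ω) j * G.resid (obs D 0 ω) k) := by
    intro ω
    rw [pow_two]
    simp only [dotProduct]
    rw [Finset.sum_mul_sum]
    exact Finset.sum_congr rfl fun j _ => Finset.sum_congr rfl fun k _ => by ring
  simp_rw [hexp]
  exact h

theorem covErr_mulVec_eq_zero (hS : G.IsSample D μ) (hsp : G.IsSplineModel)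
    (hd : G.CondDensity D μ) (hm : CondMoments D μ) {a : Fin p → ℝ}
    (ha : ∀ᵐ ω ∂μ, a ⬝ᵥ G.resid (obs D 0 ω) = 0) : G.covErr D μ *ᵥ a = 0 := by
  ext j
  rw [covErr_eq hS hsp hd]
  simp only [Matrix.mulVec, dotProduct, Matrix.of_apply, Pi.zero_apply, ← integral_mul_const]
  rw [← integral_finsetSum _ fun k _ => (integrable_resid_mul hS hd hm j k).mul_const _]
  refine integral_eq_zero_of_ae ?_
  filter_upwards [ha] with ω hω
  have : ∑ k, G.resid (obs D 0 ω) j * G.resid (obs D 0 ω) k * a k =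
      G.resid (obs D 0 ω) j * (a ⬝ᵥ G.resid (obs D 0 ω)) := by
    rw [dotProduct, Finset.mul_sum]
    exact Finset.sum_congr rfl fun k _ => by ring
  rw [this, hω, mul_zero]; rfl

/-- The information matrix of the spline coefficients. -/
def info (G : Model p q) (D : Data Ω p q) (μ : Measure Ω) : Matrix G.Idx G.Idx ℝ :=
  information μ (fun ω => G.covariate (obs D 0 ω)) G.b (G.flat G.trueParam)

theorem info_eq_fromBlocks : G.info D μ =
    Matrix.fromBlocks (G.gramMM D μ) (G.gramMX D μ) (G.gramXMStar D μ) (G.gramXX D μ) := by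
  ext (j | j) (k | k) <;>
    simp [info, information, gramMM, gramMX, gramXMStar, gramXX, weightedMoment, covariate_obs,
      predictor_eq]

/-- Block inversion: the corner of the inverse is the inverse of the Schur complement. This is how
the nuisance coefficients of α₁ enter the variance of the estimator of α₀. -/
theorem inv_info_submatrix (hJ : (G.info D μ).PosDef) (hxx : IsUnit (G.gramXX D μ)) :
    (G.info D μ)⁻¹.submatrix Sum.inl Sum.inl = (G.gramMMGivenX D μ)⁻¹ := by
  have hu := hJ.isUnit
  rw [info_eq_fromBlocks] at hu ⊢
  let := hxx.invertible
  let := hu.invertible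
  have hs : IsUnit (G.gramMM D μ - G.gramMX D μ * ⅟(G.gramXX D μ) * G.gramXMStar D μ) :=
    Matrix.isUnit_fromBlocks_iff_of_invertible₂₂.1 hu
  let := hs.invertible
  rw [← Matrix.invOf_eq_nonsing_inv, Matrix.invOf_fromBlocks₂₂_eq, gramMMGivenX,
    ← Matrix.invOf_eq_nonsing_inv (G.gramXX D μ), ← Matrix.invOf_eq_nonsing_inv]
  rfl

variable [IsProbabilityMeasure μ]

/-- A linear combination of the mediators with coefficients depending on `(x, u)` can vanish only if
the coefficients do. -/
theorem kronRow_mulVec_ae_eq_zero (hS : G.IsSample D μ) (hsp : G.IsSplineModel)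
    (hd : G.CondDensity D μ) (hm : CondMoments D μ) (hcov : EigenvaluesBounded (G.covErr D μ))
    (s : G.Idx → ℝ) (hs : ∀ᵐ ω ∂μ, s ⬝ᵥ G.covariate (obs D 0 ω) = 0) :
    ∀ᵐ ω ∂μ, kronRow p (G.knots₀.basis (D.u 0 ω)) *ᵥ (fun j => s (Sum.inl j)) = 0 := by
  set s₀ : Fin p × Fin G.knots₀.dim → ℝ := fun j => s (Sum.inl j) with hs₀
  set s₁ : Fin q × Fin G.knots₁.dim → ℝ := fun l => s (Sum.inr l) with hs₁
  have hselim : s = Sum.elim s₀ s₁ := by ext (j | l) <;> rfl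
  set c : (Fin q → ℝ) × ℝ → ℝ := fun z =>
    s₀ ⬝ᵥ stack ((G.C)ᵀ *ᵥ stack z.1 (G.knotsM.basis z.2)) (G.knots₀.basis z.2) +
      s₁ ⬝ᵥ stack z.1 (G.knots₁.basis z.2) with hc
  -- Substituting m = Cᵀxᵐ + ε makes the combination affine in ε, with slope and offset depending
  -- only on (x, u).
  set f : ((Fin q → ℝ) × ℝ) × (Fin p → ℝ) → ℝ := fun z =>
    s₀ ⬝ᵥ stack z.2 (G.knots₀.basis z.1.2) + c z.1 with hf
  have hb₀ := G.knots₀.measurable_basis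
  have hb₁ := G.knots₁.measurable_basis
  have hbM := G.knotsM.measurable_basis
  have hfm : Measurable f := by
    simp only [hf, hc, dotProduct, stack, Matrix.mulVec]
    fun_prop
  have hW := measurable_obs hS 0
  have hresm : Measurable fun ω => G.resid (obs D 0 ω) := G.measurable_resid.comp hW
  have hxu : Measurable fun ω => (D.x 0 ω, D.u 0 ω) :=
    (hS.measurable_x 0).prodMk (hS.measurable_u 0)
  have hsplit : ∀ ω, s ⬝ᵥ G.covariate (obs D 0 ω) =
      f ((D.x 0 ω, D.u 0 ω), G.resid (obs D 0 ω)) := by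
    intro ω
    simp only [hf, hc]
    rw [hselim, covariate, sumElim_dotProduct_sumElim, ← add_assoc, ← dotProduct_add]
    congr 2
    ext ⟨j, k⟩
    simp only [stack, Pi.add_apply, resid, regressor, obs, Pi.sub_apply]
    ring
  -- By independence the joint law is a product, so Fubini allows (x, u) to be frozen while ε still
  -- varies.
  have hprod : ∀ᵐ z ∂((μ.map fun ω => (D.x 0 ω, D.u 0 ω)).prod
      (μ.map fun ω => G.resid (obs D 0 ω))), f z = 0 := by
    rw [← (indepFun_iff_map_prod_eq_prod_map_map hxu.aemeasurable hresm.aemeasurable).1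
      (indepFun_resid hS hsp hd).symm]
    refine (ae_map_iff (p := fun z => f z = 0) (hxu.prodMk hresm).aemeasurable
      (hfm (measurableSet_singleton 0))).2 ?_
    filter_upwards [hs] with ω hω
    rw [← hsplit, hω]
  have h1 := ae_of_ae_map hxu.aemeasurable (Measure.ae_ae_of_ae_prod hprod)
  filter_upwards [h1] with ω₀ hω₀
  set a := kronRow p (G.knots₀.basis (D.u 0 ω₀)) *ᵥ s₀ with ha
  have h2 : ∀ᵐ ω ∂μ, a ⬝ᵥ G.resid (obs D 0 ω) = - c (D.x 0 ω₀, D.u 0 ω₀) := by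
    filter_upwards [ae_of_ae_map hresm.aemeasurable hω₀] with ω hω
    rw [ha, kronRow_mulVec_dotProduct]
    simp only [hf] at hω
    linarith
  -- For frozen (x, u) the variable aᵀε is constant; being centred it is zero, whence Σ_ε a = 0.
  have h3 : ∫ ω, a ⬝ᵥ G.resid (obs D 0 ω) ∂μ = 0 :=
    integral_dotProduct_resid hS hsp hd hm a
  have h4 : c (D.x 0 ω₀, D.u 0 ω₀) = 0 := by
    rw [integral_congr_ae h2] at h3
    simpa using h3
  rw [h4, neg_zero] at h2
  exact hcov.eq_zero_of_mulVec_eq_zero (covErr_mulVec_eq_zero hS hsp hd hm h2)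

/-- The coefficients of m* vanish through the error variation and the independence of the basis.
What remains is a relation among the x* alone, and it lies in the kernel of Σ_{x*x*}. -/
theorem eq_zero_of_dotProduct_covariate (hS : G.IsSample D μ) (hr : G.HasExpFamilyResponse D μ)
    (hsp : G.IsSplineModel) (hd : G.CondDensity D μ) (hm : CondMoments D μ)
    (hcov : EigenvaluesBounded (G.covErr D μ)) (hreg : G.GLMRegular D μ)
    (hxx : IsUnit (G.gramXX D μ)) (s : G.Idx → ℝ)
    (hs : ∀ᵐ ω ∂μ, s ⬝ᵥ G.covariate (obs D 0 ω) = 0) : s = 0 := by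
  have hb₀ := G.knots₀.measurable_basis
  have h₀ : ∀ j, s (Sum.inl j) = 0 := by
    have h1 := kronRow_mulVec_ae_eq_zero hS hsp hd hm hcov s hs
    intro ⟨l, k⟩
    have h2 : ∀ᵐ t ∂(μ.map (D.u 0)),
        (fun k => s (Sum.inl (l, k))) ⬝ᵥ G.knots₀.basis t = 0 := by
      have hmeas : Measurable fun t => (fun k => s (Sum.inl (l, k))) ⬝ᵥ G.knots₀.basis t := by
        unfold dotProduct; fun_prop
      refine (ae_map_iff (p := fun t => (fun k => s (Sum.inl (l, k))) ⬝ᵥ G.knots₀.basis t = 0)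
        (hS.measurable_u 0).aemeasurable (hmeas (measurableSet_singleton 0))).2 ?_
      filter_upwards [h1] with ω hω
      rw [← kronRow_mulVec_apply p _ (fun j => s (Sum.inl j)) l, hω]; rfl
    exact congrFun (G.knots₀.eq_zero_of_dotProduct_basis_eq_zero G.lo_lt_hi _
      (hd.ae_restrict h2)) k
  have h₁ : (fun l => s (Sum.inr l)) = 0 := by
    have h1 : ∀ᵐ ω ∂μ, (fun l => s (Sum.inr l)) ⬝ᵥ G.xStar D 0 ω = 0 := by
      filter_upwards [hs] with ω hω
      rw [show s = Sum.elim (0 : Fin p × Fin G.knots₀.dim → ℝ) (fun l => s (Sum.inr l)) by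
        ext (j | l)
        · exact h₀ j
        · rfl, covariate_obs, sumElim_dotProduct_sumElim] at hω
      simpa using hω
    have h2 : G.gramXX D μ *ᵥ (fun l => s (Sum.inr l)) = 0 := by
      ext j
      have hint : ∀ k, Integrable (fun ω => G.xStar D 0 ω j * G.xStar D 0 ω k *
          iteratedDeriv 2 G.b (G.flat G.trueParam ⬝ᵥ G.covariate (obs D 0 ω))) μ := fun k =>
        (isGLMSample hS hr hsp hd hreg).integrable_information hr.isExpFamily
          (Sum.inr j) (Sum.inr k)
      simp only [gramXX, weightedMoment, Matrix.mulVec, dotProduct, Matrix.of_apply, Pi.zero_apply,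
        ← integral_mul_const]
      simp_rw [predictor_eq]
      rw [← integral_finsetSum _ fun k _ => (hint k).mul_const _]
      refine integral_eq_zero_of_ae ?_
      filter_upwards [h1] with ω hω
      have : ∑ k, G.xStar D 0 ω j * G.xStar D 0 ω k * iteratedDeriv 2 G.b
          (G.flat G.trueParam ⬝ᵥ G.covariate (obs D 0 ω)) * s (Sum.inr k) =
          G.xStar D 0 ω j * iteratedDeriv 2 G.b
          (G.flat G.trueParam ⬝ᵥ G.covariate (obs D 0 ω)) *
          ((fun l => s (Sum.inr l)) ⬝ᵥ G.xStar D 0 ω) := by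
        rw [show (fun l => s (Sum.inr l)) ⬝ᵥ G.xStar D 0 ω =
          ∑ k, s (Sum.inr k) * G.xStar D 0 ω k from rfl, Finset.mul_sum]
        exact Finset.sum_congr rfl fun k _ => by ring
      rw [this, hω, mul_zero]; rfl
    exact Matrix.mulVec_injective_of_isUnit hxx (by rw [h2, Matrix.mulVec_zero])
  ext (j | l)
  · exact h₀ j
  · exact congrFun h₁ l

/-- A zero of b'' would spread to all of Θ and make Σ_{x*x*} the zero matrix. For q = 0 the empty
zero matrix is a unit, hence the condition on q. -/
theorem iteratedDeriv_two_pos [NeZero q] (hr : G.HasExpFamilyResponse D μ)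
    (hreg : G.GLMRegular D μ) (hxx : IsUnit (G.gramXX D μ)) {θ : ℝ} (hθ : θ ∈ G.Θ) :
    0 < iteratedDeriv 2 G.b θ := by
  refine lt_of_le_of_ne (hr.isExpFamily.iteratedDeriv_two_nonneg hθ) fun h0 => ?_
  obtain ⟨δ, hδ, H, hH, h⟩ := hreg
  have hzero : G.gramXX D μ = 0 := by
    ext j k
    refine integral_eq_zero_of_ae ?_
    filter_upwards [h] with ω hω
    rw [hr.isExpFamily.iteratedDeriv_two_eq_zero hθ (hω _ (Metric.mem_ball_self hδ)).1 h0.symm,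
      mul_zero]
    rfl
  have : Nonempty (Fin q × Fin G.knots₁.dim) :=
    ⟨(0, ⟨0, by unfold Knots.dim; omega⟩)⟩
  rw [hzero] at hxx
  exact not_isUnit_zero hxx

theorem posDef_info [NeZero q] (hS : G.IsSample D μ) (hr : G.HasExpFamilyResponse D μ)
    (hsp : G.IsSplineModel) (hd : G.CondDensity D μ) (hm : CondMoments D μ)
    (hcov : EigenvaluesBounded (G.covErr D μ)) (hreg : G.GLMRegular D μ)
    (hxx : IsUnit (G.gramXX D μ)) : (G.info D μ).PosDef := by
  have hGLM := isGLMSample hS hr hsp hd hreg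
  refine Matrix.PosDef.of_dotProduct_mulVec_pos ?_ fun s hs => ?_
  · ext j k
    simp only [info, information, Matrix.conjTranspose_apply, Matrix.of_apply, star_trivial]
    congr with ω
    ring
  · obtain ⟨h1, h2⟩ := hGLM.dotProduct_information_mulVec hr.isExpFamily s
    have hmem : ∀ᵐ ω ∂μ, G.flat G.trueParam ⬝ᵥ G.covariate (obs D 0 ω) ∈ G.Θ :=
      ae_of_ae_map (measurable_obs hS 0).aemeasurable (ae_predictor_mem hS hr hsp hd)
    have hnn : 0 ≤ᵐ[μ] fun ω => (s ⬝ᵥ G.covariate (obs D 0 ω)) ^ 2 *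
        iteratedDeriv 2 G.b (G.flat G.trueParam ⬝ᵥ G.covariate (obs D 0 ω)) := by
      filter_upwards [hmem] with ω hω
      exact mul_nonneg (sq_nonneg _) (hr.isExpFamily.iteratedDeriv_two_nonneg hω)
    rw [star_trivial, info, ← h2]
    refine lt_of_le_of_ne (integral_nonneg_of_ae hnn) fun h0 => hs ?_
    refine eq_zero_of_dotProduct_covariate hS hr hsp hd hm hcov hreg hxx s ?_
    filter_upwards [(integral_eq_zero_iff_of_nonneg_ae hnn h1).1 h0.symm, hmem] with ω hω hmω
    have := (mul_eq_zero.1 hω).resolve_right (iteratedDeriv_two_pos hr hreg hxx hmω).ne'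
    exact pow_eq_zero_iff two_ne_zero |>.1 this

end Model

end GVCMM

/-! ### The two estimators of the mediation model. -/

namespace GVCMM

/-- The sandwich formula: a vector with covariance S, mapped by K S⁻¹, has covariance K S⁻¹ Kᵀ. -/
theorem dotProduct_mulVec_vecMul_inv {ι κ : Type*} [Fintype ι] [Fintype κ] [DecidableEq κ]
    (K : Matrix ι κ ℝ) {S : Matrix κ κ ℝ} (hS : IsUnit S) (hsymm : Sᵀ = S) (t : ι → ℝ) :
    (t ᵥ* (K * S⁻¹)) ⬝ᵥ S *ᵥ (t ᵥ* (K * S⁻¹)) = t ⬝ᵥ (K * S⁻¹ * Kᵀ) *ᵥ t := by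
  have hdet := (Matrix.isUnit_iff_isUnit_det _).1 hS
  rw [Matrix.dotProduct_mulVec, Matrix.vecMul_vecMul, Matrix.mul_assoc,
    Matrix.nonsing_inv_mul _ hdet, Matrix.mul_one, ← Matrix.dotProduct_mulVec,
    ← Matrix.mulVec_transpose, Matrix.transpose_mul, Matrix.transpose_nonsing_inv, hsymm,
    Matrix.mulVec_mulVec, Matrix.mul_assoc]

/-- Independence lets second moments suffice for products of regressors and errors, where fourth
moments would otherwise be needed. -/
theorem memLp_two_mul_of_indepFun {Ω : Type*} [MeasurableSpace Ω] {μ : Measure Ω} {f g : Ω → ℝ}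
    (hfg : IndepFun f g μ) (hf : MemLp f 2 μ) (hg : MemLp g 2 μ) :
    MemLp (fun ω => f ω * g ω) 2 μ ∧
      ∫ ω, (f ω * g ω) ^ 2 ∂μ = (∫ ω, f ω ^ 2 ∂μ) * ∫ ω, g ω ^ 2 ∂μ := by
  have h2 : IndepFun (fun ω => f ω ^ 2) (fun ω => g ω ^ 2) μ :=
    hfg.comp (φ := fun x => x ^ 2) (ψ := fun x => x ^ 2) (by fun_prop) (by fun_prop)
  constructor
  · change MemLp (f * g) 2 μ
    rw [memLp_two_iff_integrable_sq (hf.1.mul hg.1)]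
    simp_rw [Pi.mul_apply, mul_pow]
    exact h2.integrable_mul hf.integrable_sq hg.integrable_sq
  · simp_rw [mul_pow]
    exact h2.integral_fun_mul_eq_mul_integral (hf.1.pow 2) (hg.1.pow 2)

namespace Model

variable {p q : ℕ} {G : Model p q} {Ω : Type*} {D : Data Ω p q}

/-- The terms log c cancel and φ is a constant factor, so for φ > 0 maximizing the likelihood is
minimizing this function of s. -/
theorem negLogLikRatio_eq (hφ : G.φ ≠ 0) (n : ℕ) (ω : Ω) (s : G.Idx → ℝ) :
    negLogLikRatio (fun i ω => G.covariate (obs D i ω)) D.y G.b (G.flat G.trueParam) n ω s =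
      G.φ * (G.logLik D n ω G.trueParam -
        G.logLik D n ω (G.unflat (G.flat G.trueParam + (√(n : ℝ))⁻¹ • s))) := by
  simp only [negLogLikRatio, logLik]
  rw [← Finset.sum_sub_distrib, Finset.mul_sum]
  refine Finset.sum_congr rfl fun i _ => ?_
  simp only [predictor_eq, flat_unflat]
  have : (G.flat G.trueParam + (√(n : ℝ))⁻¹ • s) ⬝ᵥ G.covariate (obs D i ω) =
      G.flat G.trueParam ⬝ᵥ G.covariate (obs D i ω) +
        (√(n : ℝ))⁻¹ * (s ⬝ᵥ G.covariate (obs D i ω)) := by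
    rw [add_dotProduct, smul_dotProduct, smul_eq_mul]
  rw [this]
  generalize (√(n : ℝ))⁻¹ * (s ⬝ᵥ G.covariate (obs D i ω)) = z
  field_simp
  ring

theorem mem_localAdmissible_iff (n : ℕ) (ω : Ω) (s : G.Idx → ℝ) :
    s ∈ localAdmissible (fun i ω => G.covariate (obs D i ω)) G.Θ (G.flat G.trueParam) n ω ↔
      G.unflat (G.flat G.trueParam + (√(n : ℝ))⁻¹ • s) ∈ G.admissible D n ω := by
  simp [localAdmissible, admissible, predictor_eq, flat_unflat]

/-- The local parameter belonging to `θ`. -/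
def localParam (G : Model p q) (n : ℕ) (θ : G.Param) : G.Idx → ℝ :=
  √(n : ℝ) • (G.flat θ - G.flat G.trueParam)

theorem unflat_localParam {n : ℕ} (hn : n ≠ 0) (θ : G.Param) :
    G.unflat (G.flat G.trueParam + (√(n : ℝ))⁻¹ • G.localParam n θ) = θ := by
  have : √(n : ℝ) ≠ 0 := by positivity
  rw [localParam, inv_smul_smul₀ this, add_sub_cancel, unflat_flat]

theorem isMaximizer_iff (hφ : 0 < G.φ) {n : ℕ} (hn : n ≠ 0) (ω : Ω) (s : G.Idx → ℝ) :
    G.IsMaximizer D n ω (G.unflat (G.flat G.trueParam + (√(n : ℝ))⁻¹ • s)) ↔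
      s ∈ localAdmissible (fun i ω => G.covariate (obs D i ω)) G.Θ (G.flat G.trueParam) n ω ∧
      IsMinOn (negLogLikRatio (fun i ω => G.covariate (obs D i ω)) D.y G.b
          (G.flat G.trueParam) n ω)
        (localAdmissible (fun i ω => G.covariate (obs D i ω)) G.Θ (G.flat G.trueParam) n ω) s := by
  refine and_congr (mem_localAdmissible_iff n ω s).symm ?_
  simp only [isMaxOn_iff, isMinOn_iff, mem_localAdmissible_iff, negLogLikRatio_eq hφ.ne',
    mul_le_mul_iff_right₀ hφ, sub_le_sub_iff_left]
  refine ⟨fun h s' hs' => h _ hs', fun h θ hθ => ?_⟩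
  have := h (G.localParam n θ)
  rw [unflat_localParam hn] at this
  exact this hθ

variable [MeasurableSpace Ω] {μ : Measure Ω}

theorem dotProduct_gramXM_mulVec (hS : G.IsSample D μ) (hd : G.CondDensity D μ)
    (hm : CondMoments D μ) (w : Fin q × Fin G.knotsM.dim → ℝ) :
    MemLp (fun ω => w ⬝ᵥ G.regressor (obs D 0 ω)) 2 μ ∧
    ∫ ω, (w ⬝ᵥ G.regressor (obs D 0 ω)) ^ 2 ∂μ = w ⬝ᵥ G.gramXM D μ *ᵥ w := by
  refine ⟨memLp_finsetSum _ fun k _ => (memLp_regressor hS hd hm k).const_mul _, ?_⟩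
  have h := integral_sum_sum_mul (fun j k =>
    (memLp_regressor hS hd hm j).integrable_mul (memLp_regressor hS hd hm k)) w w
  have hexp : ∀ ω, (w ⬝ᵥ G.regressor (obs D 0 ω)) ^ 2 = ∑ j, ∑ k, w j * w k *
      (G.regressor (obs D 0 ω) j * G.regressor (obs D 0 ω) k) := by
    intro ω
    rw [pow_two]
    simp only [dotProduct]
    rw [Finset.sum_mul_sum]
    exact Finset.sum_congr rfl fun j _ => Finset.sum_congr rfl fun k _ => by ring
  simp_rw [hexp]
  exact h.2

theorem indepFun_regressor_resid (hS : G.IsSample D μ) (hsp : G.IsSplineModel)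
    (hd : G.CondDensity D μ) :
    IndepFun (fun ω => G.regressor (obs D 0 ω)) (fun ω => G.resid (obs D 0 ω)) μ := by
  have hB := G.knotsM.measurable_basis
  have hg : Measurable fun z : (Fin q → ℝ) × ℝ => stack z.1 (G.knotsM.basis z.2) :=
    measurable_stack.comp (measurable_fst.prodMk (hB.comp measurable_snd))
  exact (indepFun_resid hS hsp hd).symm.comp hg measurable_id

/-- Moments of `(wᵀ xᵐ) (aᵀ ε)`. -/
theorem memLp_regressor_mul_resid (hS : G.IsSample D μ) (hsp : G.IsSplineModel)
    (hd : G.CondDensity D μ) [IsFiniteMeasure μ] (hm : CondMoments D μ)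
    (w : Fin q × Fin G.knotsM.dim → ℝ) (a : Fin p → ℝ) :
    MemLp (fun ω => (w ⬝ᵥ G.regressor (obs D 0 ω)) * (a ⬝ᵥ G.resid (obs D 0 ω))) 2 μ ∧
    ∫ ω, (w ⬝ᵥ G.regressor (obs D 0 ω)) * (a ⬝ᵥ G.resid (obs D 0 ω)) ∂μ = 0 ∧
    ∫ ω, ((w ⬝ᵥ G.regressor (obs D 0 ω)) * (a ⬝ᵥ G.resid (obs D 0 ω))) ^ 2 ∂μ =
      (w ⬝ᵥ G.gramXM D μ *ᵥ w) * (a ⬝ᵥ G.covErr D μ *ᵥ a) := by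
  have hind : IndepFun (fun ω => w ⬝ᵥ G.regressor (obs D 0 ω))
      (fun ω => a ⬝ᵥ G.resid (obs D 0 ω)) μ :=
    (indepFun_regressor_resid hS hsp hd).comp (φ := fun z => w ⬝ᵥ z) (ψ := fun z => a ⬝ᵥ z)
      (by unfold dotProduct; fun_prop) (by unfold dotProduct; fun_prop)
  obtain ⟨h1, h2⟩ := dotProduct_gramXM_mulVec hS hd hm w
  have h3 : MemLp (fun ω => a ⬝ᵥ G.resid (obs D 0 ω)) 2 μ :=
    memLp_finsetSum _ fun k _ => (memLp_resid hS hd hm k).const_mul _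
  obtain ⟨h4, h5⟩ := memLp_two_mul_of_indepFun hind h1 h3
  refine ⟨h4, ?_, by rw [h5, h2, (sq_dotProduct_resid hS hsp hd hm a).2]⟩
  rw [hind.integral_fun_mul_eq_mul_integral h1.1 h3.1]
  rw [integral_dotProduct_resid hS hsp hd hm, mul_zero]

theorem iIndepFun_regressor (hS : G.IsSample D μ) :
    iIndepFun (fun i ω => (G.regressor (obs D i ω), D.m i ω)) μ := by
  have hr := G.measurable_regressor
  exact (iIndepFun_obs hS).comp (fun _ z => (G.regressor z.1, z.1.2.1)) (fun _ => by fun_prop)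

theorem identDistrib_regressor (hS : G.IsSample D μ) (i : ℕ) :
    IdentDistrib (fun ω => (G.regressor (obs D i ω), D.m i ω))
      (fun ω => (G.regressor (obs D 0 ω), D.m 0 ω)) μ μ := by
  have hr := G.measurable_regressor
  exact (identDistrib_obs hS i).comp
    (u := fun z : (ℝ × (Fin p → ℝ) × (Fin q → ℝ)) × ℝ => (G.regressor z.1, z.1.2.1)) (by fun_prop)

/-- The normalized cross products of regressors and errors of the mediator equation. -/
def cross (G : Model p q) (D : Data Ω p q) (n : ℕ) (ω : Ω) :
    Matrix (Fin q × Fin G.knotsM.dim) (Fin p) ℝ :=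
  normalizedCross (fun i ω => G.regressor (obs D i ω)) D.m G.C n ω

variable [IsProbabilityMeasure μ]

theorem smallInProb_localParam_sub (hS : G.IsSample D μ) (hr : G.HasExpFamilyResponse D μ)
    (hsp : G.IsSplineModel) (hd : G.CondDensity D μ) (hreg : G.GLMRegular D μ)
    (hJ : (G.info D μ).PosDef) {est : ℕ → Ω → G.Param} (hmle : G.IsMLE D μ est) :
    SmallInProb μ fun n ω => G.localParam n (est n ω) - (G.info D μ)⁻¹ *ᵥ
      score (fun i ω => G.covariate (obs D i ω)) D.y G.b (G.flat G.trueParam) n ω := by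
  refine IsGLMSample.smallInProb_mle_sub hr.isExpFamily (isGLMSample hS hr hsp hd hreg) hJ
    fun n => ?_
  filter_upwards [hmle.isMaximizer n] with ω hω
  -- For n = 0 the likelihood is an empty sum and every parameter is optimal; the rescaling by √n is
  -- not invertible there.
  rcases eq_or_ne n 0 with rfl | hn
  · intro _
    exact ⟨by simp [localAdmissible], fun s _ => by simp [negLogLikRatio]⟩
  · rintro ⟨s, hs⟩
    rw [← isMaximizer_iff hr.φ_pos hn, unflat_localParam hn]
    exact hω ⟨_, (isMaximizer_iff hr.φ_pos hn ω s).2 hs⟩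

theorem memLp_regressor_mul_resid_apply (hS : G.IsSample D μ) (hsp : G.IsSplineModel)
    (hd : G.CondDensity D μ) (hm : CondMoments D μ) (k : Fin q × Fin G.knotsM.dim) (j : Fin p) :
    MemLp (fun ω => G.regressor (obs D 0 ω) k * G.resid (obs D 0 ω) j) 2 μ ∧
    ∫ ω, G.regressor (obs D 0 ω) k * G.resid (obs D 0 ω) j ∂μ = 0 := by
  classical
  have := memLp_regressor_mul_resid hS hsp hd hm (Pi.single k 1) (Pi.single j 1)
  simp only [single_dotProduct, one_mul] at this
  exact ⟨this.1, this.2.1⟩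

theorem boundedInProb_cross (hS : G.IsSample D μ) (hsp : G.IsSplineModel)
    (hd : G.CondDensity D μ) (hm : CondMoments D μ) (k : Fin q × Fin G.knotsM.dim) (j : Fin p) :
    BoundedInProb μ fun n ω => G.cross D n ω k j :=
  boundedInProb_normalizedCross (iIndepFun_regressor hS) (identDistrib_regressor hS)
    (fun k j => (memLp_regressor_mul_resid_apply hS hsp hd hm k j).1)
    (fun k j => (memLp_regressor_mul_resid_apply hS hsp hd hm k j).2) k j

theorem smallInProb_hatC_sub (hS : G.IsSample D μ) (hsp : G.IsSplineModel)
    (hd : G.CondDensity D μ) (hm : CondMoments D μ) (hX : IsUnit (G.gramXM D μ))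
    (k : Fin q × Fin G.knotsM.dim) (j : Fin p) :
    SmallInProb μ fun n ω => (√(n : ℝ) • (G.hatC D n ω - G.C) -
      (G.gramXM D μ)⁻¹ * G.cross D n ω) k j :=
  smallInProb_leastSquares_sub (fun i => G.measurable_regressor.comp (measurable_obs hS i))
    (iIndepFun_regressor hS) (identDistrib_regressor hS)
    (fun k l => (memLp_regressor hS hd hm k).integrable_mul (memLp_regressor hS hd hm l)) hX
    (fun k j => (memLp_regressor_mul_resid_apply hS hsp hd hm k j).1)
    (fun k j => (memLp_regressor_mul_resid_apply hS hsp hd hm k j).2) k j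

end Model

end GVCMM

/-! ### Linearization of β̂(u) and the covariance of its influence. -/

theorem SmallInProb.mulVec {Ω ι κ : Type*} [MeasurableSpace Ω] [Fintype ι] [Fintype κ]
    {μ : Measure Ω} [IsFiniteMeasure μ] {f : ℕ → Ω → κ → ℝ} (hf : SmallInProb μ f)
    (A : Matrix ι κ ℝ) : SmallInProb μ fun n ω => A *ᵥ f n ω :=
  smallInProb_pi fun i => SmallInProb.sum _ fun k _ => (hf.eval k).const_mul (A i k)

theorem smallInProb_mulVec {Ω ι κ : Type*} [MeasurableSpace Ω] [Fintype ι] [Fintype κ]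
    {μ : Measure Ω} [IsFiniteMeasure μ] {R : ℕ → Ω → Matrix ι κ ℝ}
    (hR : ∀ i k, SmallInProb μ fun n ω => R n ω i k) (a : κ → ℝ) :
    SmallInProb μ fun n ω => R n ω *ᵥ a :=
  smallInProb_pi fun i => SmallInProb.sum _ fun k _ =>
    (hR i k).mul_bounded (boundedInProb_const (a k))

theorem boundedInProb_mulVec {Ω ι κ : Type*} [MeasurableSpace Ω] [Fintype ι] [Fintype κ]
    {μ : Measure Ω} [IsFiniteMeasure μ] {R : ℕ → Ω → Matrix ι κ ℝ} {f : ℕ → Ω → κ → ℝ}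
    (hR : ∀ i k, BoundedInProb μ fun n ω => R n ω i k) (hf : BoundedInProb μ f) :
    BoundedInProb μ fun n ω => R n ω *ᵥ f n ω :=
  boundedInProb_pi fun i => BoundedInProb.sum _ fun k _ => (hR i k).mul
    (hf.mono (Eventually.of_forall fun _ => ae_of_all _ fun _ => norm_le_pi_norm _ _))

theorem BoundedInProb.mulVec {Ω ι κ : Type*} [MeasurableSpace Ω] [Fintype ι] [Fintype κ]
    {μ : Measure Ω} [IsFiniteMeasure μ] {f : ℕ → Ω → κ → ℝ} (hf : BoundedInProb μ f)
    (A : Matrix ι κ ℝ) : BoundedInProb μ fun n ω => A *ᵥ f n ω :=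
  boundedInProb_mulVec (fun i k => boundedInProb_const (A i k)) hf

theorem BoundedInProb.smallInProb_smul {Ω ι : Type*} [MeasurableSpace Ω] [Fintype ι]
    {μ : Measure Ω} [IsFiniteMeasure μ] {f : ℕ → Ω → ι → ℝ} (hf : BoundedInProb μ f)
    {c : ℕ → ℝ} (hc : Tendsto c atTop (𝓝 0)) : SmallInProb μ fun n ω => c n • f n ω :=
  smallInProb_pi fun _ => SmallInProb.mul_bounded (smallInProb_of_tendsto hc)
    (hf.mono (Eventually.of_forall fun _ => ae_of_all _ fun _ => norm_le_pi_norm _ _))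

theorem integral_add_sq_of_integral_mul_eq_zero {Ω : Type*} [MeasurableSpace Ω] {μ : Measure Ω}
    {f g : Ω → ℝ} (hf : MemLp f 2 μ) (hg : MemLp g 2 μ) (h : ∫ ω, f ω * g ω ∂μ = 0) :
    ∫ ω, (f ω + g ω) ^ 2 ∂μ = ∫ ω, f ω ^ 2 ∂μ + ∫ ω, g ω ^ 2 ∂μ := by
  have hfg : Integrable (fun ω => 2 * (f ω * g ω)) μ := (hf.integrable_mul hg).const_mul 2
  have hff : Integrable (fun ω => f ω ^ 2 + 2 * (f ω * g ω)) μ := hf.integrable_sq.add hfg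
  simp_rw [add_sq, mul_assoc]
  rw [integral_add hff hg.integrable_sq, integral_add hf.integrable_sq hfg, integral_const_mul, h,
    mul_zero, add_zero]

namespace GVCMM

namespace Model

variable {p q : ℕ} {G : Model p q} {Ω : Type*} {D : Data Ω p q}

/-- The extraction of the coefficients of `α₀`. -/
def selectMediator (G : Model p q) : Matrix (Fin p × Fin G.knots₀.dim) G.Idx ℝ :=
  (1 : Matrix G.Idx G.Idx ℝ).submatrix Sum.inl id

theorem selectMediator_mulVec (s : G.Idx → ℝ) :
    G.selectMediator *ᵥ s = fun j => s (Sum.inl j) := by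
  ext j
  simp [selectMediator, Matrix.mulVec, dotProduct, Matrix.one_apply]

/-- The exact product rule for Γ̂α̂₀ - Γα₀ after scaling by √n. The last term keeps a factor 1/√n in
front of a product of two quantities bounded in probability. -/
theorem smul_hatβ_sub (hsp : G.IsSplineModel) (est : ℕ → Ω → G.Param) {u : ℝ}
    (hu : u ∈ Icc G.lo G.hi) {n : ℕ} (hn : n ≠ 0) (ω : Ω) :
    √(n : ℝ) • (G.hatβ D est n ω u - G.β u) =
      (kronRow q (G.knotsM.basis u) * (√(n : ℝ) • (G.hatC D n ω - G.C))) *ᵥ G.α₀ u +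
      (G.Γ u * kronRow p (G.knots₀.basis u) * G.selectMediator) *ᵥ G.localParam n (est n ω) +
      (√(n : ℝ))⁻¹ • ((kronRow q (G.knotsM.basis u) * (√(n : ℝ) • (G.hatC D n ω - G.C))) *ᵥ
        ((kronRow p (G.knots₀.basis u) * G.selectMediator) *ᵥ G.localParam n (est n ω))) := by
  set KB := kronRow q (G.knotsM.basis u) with hKB
  set Kb := kronRow p (G.knots₀.basis u) with hKb
  have hsq : √(n : ℝ) ≠ 0 := by positivity
  set r := √(n : ℝ) with hrdef
  have hest : (est n ω).1 = G.a₀ + r⁻¹ • (G.selectMediator *ᵥ G.localParam n (est n ω)) := by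
    ext j
    rw [selectMediator_mulVec]
    simp only [Pi.add_apply, Pi.smul_apply, localParam, flat, trueParam, Pi.sub_apply,
      Sum.elim_inl, smul_eq_mul, ← hrdef]
    field_simp
    ring
  have hα : G.α₀ u = Kb *ᵥ G.a₀ := hsp.α₀_eq u hu
  have hΓ : G.Γ u = KB * G.C := hsp.Γ_eq u hu
  rw [hatβ, hatΓ, hatα₀, β, hest, ← hKB, ← hKb]
  generalize G.localParam n (est n ω) = s
  obtain ⟨B, hB⟩ : ∃ B, r • (G.hatC D n ω - G.C) = B := ⟨_, rfl⟩
  have hhatC : KB * G.hatC D n ω = G.Γ u + r⁻¹ • (KB * B) := by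
    rw [hΓ, ← hB, Matrix.mul_smul, inv_smul_smul₀ hsq, Matrix.mul_sub, add_sub_cancel]
  rw [hB, hhatC, Matrix.mulVec_add, ← hα]
  simp only [Matrix.mulVec_add, Matrix.add_mulVec, Matrix.mulVec_smul, Matrix.smul_mulVec,
    smul_sub, smul_add, smul_inv_smul₀ hsq, Matrix.mulVec_mulVec, Matrix.mul_assoc,
    Matrix.add_mul, Matrix.smul_mul]
  abel

variable [MeasurableSpace Ω] {μ : Measure Ω}

/-- The loading of `xᵐ εᵀ α₀` in the linearization of `β̂ (u)`. -/
def mediatorLoading (G : Model p q) (D : Data Ω p q) (μ : Measure Ω) (u : ℝ) :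
    Matrix (Fin q) (Fin q × Fin G.knotsM.dim) ℝ :=
  kronRow q (G.knotsM.basis u) * (G.gramXM D μ)⁻¹

/-- The loading of the score in the linearization of `β̂ (u)`. -/
def responseLoading (G : Model p q) (D : Data Ω p q) (μ : Measure Ω) (u : ℝ) :
    Matrix (Fin q) G.Idx ℝ :=
  G.Γ u * kronRow p (G.knots₀.basis u) * G.selectMediator * (G.info D μ)⁻¹

/-- The contribution of the `i`-th observation to the linearization of `β̂ (u)`. -/
def influence (G : Model p q) (D : Data Ω p q) (μ : Measure Ω) (u : ℝ) (i : ℕ) (ω : Ω) :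
    Fin q → ℝ :=
  G.mediatorLoading D μ u *ᵥ ((G.α₀ u ⬝ᵥ G.resid (obs D i ω)) • G.regressor (obs D i ω)) +
    G.responseLoading D μ u *ᵥ (G.respResid D i ω • G.covariate (obs D i ω))

theorem selectMediator_mul_mul (A : Matrix G.Idx G.Idx ℝ) :
    G.selectMediator * A * (G.selectMediator)ᵀ = A.submatrix Sum.inl Sum.inl := by
  ext j k
  simp [selectMediator, Matrix.mul_apply, Matrix.one_apply]

theorem transpose_gramXM : (G.gramXM D μ)ᵀ = G.gramXM D μ := by
  ext j k
  simp [gramXM, crossMoment, mul_comm]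

/-- Both sandwich terms of the variance are rewritten as quadratic forms in the loadings of xᵐεᵀα₀
and of the score; the Schur complement enters as a corner of the inverse information. -/
theorem dotProduct_scaledVarβ_mulVec (hJ : (G.info D μ).PosDef) (hX : IsUnit (G.gramXM D μ))
    (hxx : IsUnit (G.gramXX D μ)) (u : ℝ) (t : Fin q → ℝ) :
    t ⬝ᵥ G.scaledVarβ D μ u *ᵥ t =
      ((t ᵥ* G.mediatorLoading D μ u) ⬝ᵥ G.gramXM D μ *ᵥ (t ᵥ* G.mediatorLoading D μ u)) *
        (G.α₀ u ⬝ᵥ G.covErr D μ *ᵥ G.α₀ u) +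
      G.φ * ((t ᵥ* G.responseLoading D μ u) ⬝ᵥ G.info D μ *ᵥ
        (t ᵥ* G.responseLoading D μ u)) := by
  rw [mediatorLoading, responseLoading, dotProduct_mulVec_vecMul_inv _ hX transpose_gramXM,
    dotProduct_mulVec_vecMul_inv _ hJ.isUnit (by simpa using hJ.isHermitian.eq)]
  have : G.Γ u * kronRow p (G.knots₀.basis u) * G.selectMediator * (G.info D μ)⁻¹ *
      (G.Γ u * kronRow p (G.knots₀.basis u) * G.selectMediator)ᵀ =
      G.Γ u * kronRow p (G.knots₀.basis u) * (G.gramMMGivenX D μ)⁻¹ *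
      (kronRow p (G.knots₀.basis u))ᵀ * (G.Γ u)ᵀ := by
    rw [← inv_info_submatrix hJ hxx, ← selectMediator_mul_mul]
    simp only [Matrix.transpose_mul, Matrix.mul_assoc]
  rw [this, scaledVarβ, Matrix.add_mulVec, dotProduct_add, Matrix.smul_mulVec, Matrix.smul_mulVec,
    dotProduct_smul, dotProduct_smul, smul_eq_mul, smul_eq_mul]
  ring

theorem dotProduct_influence (u : ℝ) (i : ℕ) (ω : Ω) (t : Fin q → ℝ) :
    t ⬝ᵥ G.influence D μ u i ω =
      ((t ᵥ* G.mediatorLoading D μ u) ⬝ᵥ G.regressor (obs D i ω)) *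
        (G.α₀ u ⬝ᵥ G.resid (obs D i ω)) +
      ((t ᵥ* G.responseLoading D μ u) ⬝ᵥ G.covariate (obs D i ω)) * G.respResid D i ω := by
  rw [influence, dotProduct_add, Matrix.dotProduct_mulVec, Matrix.dotProduct_mulVec,
    dotProduct_smul, dotProduct_smul, smul_eq_mul, smul_eq_mul, mul_comm,
    mul_comm (G.respResid _ _ _)]

/-- The influence of an observation as a function of `((u, m, x), y)`. -/
theorem exists_measurable_influence (u : ℝ) :
    ∃ g : (ℝ × (Fin p → ℝ) × (Fin q → ℝ)) × ℝ → Fin q → ℝ, Measurable g ∧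
      ∀ i ω, G.influence D μ u i ω = g (obs D i ω, D.y i ω) := by
  have hc := G.measurable_covariate
  have hX := G.measurable_regressor
  have he := G.measurable_resid
  have hd := measurable_deriv G.b
  refine ⟨fun z =>
    G.mediatorLoading D μ u *ᵥ ((G.α₀ u ⬝ᵥ G.resid z.1) • G.regressor z.1) +
    G.responseLoading D μ u *ᵥ ((z.2 - deriv G.b (G.flat G.trueParam ⬝ᵥ G.covariate z.1)) •
      G.covariate z.1), ?_, fun i ω => rfl⟩
  refine measurable_pi_lambda _ fun l => ?_
  simp only [Pi.add_apply, Matrix.mulVec, dotProduct, Pi.smul_apply, smul_eq_mul]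
  fun_prop

theorem smul_sum_influence (u : ℝ) (n : ℕ) (ω : Ω) :
    (√(n : ℝ))⁻¹ • ∑ i ∈ Finset.range n, G.influence D μ u i ω =
      G.mediatorLoading D μ u *ᵥ (G.cross D n ω *ᵥ G.α₀ u) + G.responseLoading D μ u *ᵥ
        score (fun i ω => G.covariate (obs D i ω)) D.y G.b (G.flat G.trueParam) n ω := by
  have hcross : (√(n : ℝ))⁻¹ • ∑ i ∈ Finset.range n,
      ((G.α₀ u ⬝ᵥ G.resid (obs D i ω)) • G.regressor (obs D i ω)) = G.cross D n ω *ᵥ G.α₀ u := by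
    ext k
    simp only [Pi.smul_apply, Finset.sum_apply, smul_eq_mul, cross, normalizedCross, Matrix.mulVec,
      dotProduct, Matrix.of_apply, resid, obs, Finset.mul_sum, Finset.sum_mul]
    rw [Finset.sum_comm]
    exact Finset.sum_congr rfl fun j _ => Finset.sum_congr rfl fun i _ => by ring
  have hscore : (√(n : ℝ))⁻¹ • ∑ i ∈ Finset.range n,
      (G.respResid D i ω • G.covariate (obs D i ω)) =
      score (fun i ω => G.covariate (obs D i ω)) D.y G.b (G.flat G.trueParam) n ω := by
    ext k
    simp only [Pi.smul_apply, Finset.sum_apply, smul_eq_mul, score, respResid]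
    exact congrArg _ (Finset.sum_congr rfl fun i _ => mul_comm _ _)
  simp only [influence]
  rw [Finset.sum_add_distrib, ← Matrix.mulVec_sum, ← Matrix.mulVec_sum, smul_add,
    ← Matrix.mulVec_smul, ← Matrix.mulVec_smul, hcross, hscore]

variable [IsProbabilityMeasure μ]

theorem memLp_influence (hS : G.IsSample D μ) (hr : G.HasExpFamilyResponse D μ)
    (hsp : G.IsSplineModel) (hd : G.CondDensity D μ) (hm : CondMoments D μ)
    (hreg : G.GLMRegular D μ) (u : ℝ) (t : Fin q → ℝ) :
    MemLp (fun ω => t ⬝ᵥ G.influence D μ u 0 ω) 2 μ ∧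
      ∫ ω, t ⬝ᵥ G.influence D μ u 0 ω ∂μ = 0 := by
  obtain ⟨h1, h2, -⟩ := memLp_regressor_mul_resid hS hsp hd hm (t ᵥ* G.mediatorLoading D μ u)
    (G.α₀ u)
  have h3 := (memLp_score hS hr hsp hd hreg (t ᵥ* G.responseLoading D μ u)).1
  have hc := G.measurable_covariate
  simp_rw [dotProduct_influence]
  refine ⟨h1.add h3, ?_⟩
  rw [integral_add (h1.integrable one_le_two) (h3.integrable one_le_two), h2, zero_add]
  exact integral_mul_respResid hS hr hsp hd
    (g := fun w => (t ᵥ* G.responseLoading D μ u) ⬝ᵥ G.covariate w)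
    (by unfold dotProduct; fun_prop) (h3.integrable one_le_two)

/-- The covariance matrix of the influence is `scaledVarβ`. -/
theorem integral_influence_sq (hS : G.IsSample D μ) (hr : G.HasExpFamilyResponse D μ)
    (hsp : G.IsSplineModel) (hd : G.CondDensity D μ) (hm : CondMoments D μ)
    (hreg : G.GLMRegular D μ) (hJ : (G.info D μ).PosDef) (hX : IsUnit (G.gramXM D μ))
    (hxx : IsUnit (G.gramXX D μ)) (u : ℝ) (t : Fin q → ℝ) :
    ∫ ω, (t ⬝ᵥ G.influence D μ u 0 ω) ^ 2 ∂μ = t ⬝ᵥ G.scaledVarβ D μ u *ᵥ t := by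
  set w := t ᵥ* G.mediatorLoading D μ u with hw
  set s := t ᵥ* G.responseLoading D μ u with hs
  obtain ⟨h1, -, h2⟩ := memLp_regressor_mul_resid hS hsp hd hm w (G.α₀ u)
  obtain ⟨h3, h4⟩ := memLp_score hS hr hsp hd hreg s
  have hc := G.measurable_covariate
  have hXm := G.measurable_regressor
  have he := G.measurable_resid
  -- The mediator part is a function of (u, m, x), given which the response residual is centred. So
  -- the variance is a plain sum of two terms.
  have hcross : ∫ ω, ((w ⬝ᵥ G.regressor (obs D 0 ω)) * (G.α₀ u ⬝ᵥ G.resid (obs D 0 ω))) *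
      ((s ⬝ᵥ G.covariate (obs D 0 ω)) * G.respResid D 0 ω) ∂μ = 0 := by
    have hint := h1.integrable_mul h3
    simp only [← mul_assoc] at hint ⊢
    exact integral_mul_respResid hS hr hsp hd
      (g := fun z => (w ⬝ᵥ G.regressor z) * (G.α₀ u ⬝ᵥ G.resid z) * (s ⬝ᵥ G.covariate z))
      (by unfold dotProduct; fun_prop) (by simpa [Pi.mul_def, mul_assoc] using hint)
  simp_rw [dotProduct_influence]
  rw [integral_add_sq_of_integral_mul_eq_zero h1 h3 hcross, h2, h4,
    dotProduct_scaledVarβ_mulVec hJ hX hxx, ← hw, ← hs, info,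
    ← ((isGLMSample hS hr hsp hd hreg).dotProduct_information_mulVec hr.isExpFamily s).2]

theorem boundedInProb_hatC_sub (hS : G.IsSample D μ) (hsp : G.IsSplineModel)
    (hd : G.CondDensity D μ) (hm : CondMoments D μ) (hX : IsUnit (G.gramXM D μ))
    (k : Fin q × Fin G.knotsM.dim) (j : Fin p) :
    BoundedInProb μ fun n ω => (√(n : ℝ) • (G.hatC D n ω - G.C)) k j := by
  have h1 : BoundedInProb μ fun n ω => ((G.gramXM D μ)⁻¹ * G.cross D n ω) k j := by
    simp only [Matrix.mul_apply]
    exact BoundedInProb.sum _ fun l _ => (boundedInProb_const _).mul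
      (boundedInProb_cross hS hsp hd hm l j)
  refine ((smallInProb_hatC_sub hS hsp hd hm hX k j).boundedInProb.add h1).mono
    (Eventually.of_forall fun n => ae_of_all _ fun ω => le_of_eq ?_)
  rw [Matrix.sub_apply, sub_add_cancel]

theorem boundedInProb_localParam (hS : G.IsSample D μ) (hr : G.HasExpFamilyResponse D μ)
    (hsp : G.IsSplineModel) (hd : G.CondDensity D μ) (hreg : G.GLMRegular D μ)
    (hJ : (G.info D μ).PosDef) {est : ℕ → Ω → G.Param} (hmle : G.IsMLE D μ est) :
    BoundedInProb μ fun n ω => G.localParam n (est n ω) := by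
  have h1 := (BoundedInProb.mulVec (isGLMSample hS hr hsp hd hreg).boundedInProb_score
    (G.info D μ)⁻¹)
  refine ((smallInProb_localParam_sub hS hr hsp hd hreg hJ hmle).boundedInProb.add h1).mono
    (Eventually.of_forall fun n => ae_of_all _ fun ω => le_of_eq ?_)
  rw [sub_add_cancel]

/-- Asymptotic linearity of `β̂ (u)`. -/
theorem smallInProb_hatβ_sub (hS : G.IsSample D μ) (hr : G.HasExpFamilyResponse D μ)
    (hsp : G.IsSplineModel) (hd : G.CondDensity D μ) (hm : CondMoments D μ)
    (hreg : G.GLMRegular D μ) (hJ : (G.info D μ).PosDef) (hX : IsUnit (G.gramXM D μ))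
    {est : ℕ → Ω → G.Param} (hmle : G.IsMLE D μ est) {u : ℝ} (hu : u ∈ Icc G.lo G.hi) :
    SmallInProb μ fun n ω => √(n : ℝ) • (G.hatβ D est n ω u - G.β u) -
      (√(n : ℝ))⁻¹ • ∑ i ∈ Finset.range n, G.influence D μ u i ω := by
  have ht1 := SmallInProb.mulVec
    (smallInProb_mulVec (smallInProb_hatC_sub hS hsp hd hm hX) (G.α₀ u))
    (kronRow q (G.knotsM.basis u))
  have ht2 := (smallInProb_localParam_sub hS hr hsp hd hreg hJ hmle).mulVec
    (G.Γ u * kronRow p (G.knots₀.basis u) * G.selectMediator)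
  -- The second-order term of the product rule.
  have ht3 : SmallInProb μ fun n ω => (√(n : ℝ))⁻¹ •
      ((kronRow q (G.knotsM.basis u) * (√(n : ℝ) • (G.hatC D n ω - G.C))) *ᵥ
        ((kronRow p (G.knots₀.basis u) * G.selectMediator) *ᵥ G.localParam n (est n ω))) := by
    have hs0 : Tendsto (fun n : ℕ => (√(n : ℝ))⁻¹) atTop (𝓝 0) :=
      (Real.tendsto_sqrt_atTop.comp tendsto_natCast_atTop_atTop).inv_tendsto_atTop
    refine BoundedInProb.smallInProb_smul (boundedInProb_mulVec (fun l j => ?_) <|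
      BoundedInProb.mulVec (boundedInProb_localParam hS hr hsp hd hreg hJ hmle) _) hs0
    simp only [Matrix.mul_apply]
    exact BoundedInProb.sum _ fun k _ => (boundedInProb_const _).mul
      (boundedInProb_hatC_sub hS hsp hd hm hX k j)
  refine ((ht1.add ht2).add ht3).congr ?_
  filter_upwards [eventually_ne_atTop 0] with n hn
  refine ae_of_all _ fun ω => ?_
  simp only
  rw [smul_hatβ_sub hsp est hu hn, smul_sum_influence]
  simp only [mediatorLoading, responseLoading, Matrix.mulVec_sub, Matrix.sub_mulVec,
    Matrix.mulVec_mulVec, Matrix.mul_assoc]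
  abel

end Model

end GVCMM

/-! ### Standardization and the limit theorem. -/

theorem SmallInProb.continuousLinearMap {Ω E F : Type*} [MeasurableSpace Ω] {μ : Measure Ω}
    [IsFiniteMeasure μ] [NormedAddCommGroup E] [NormedSpace ℝ E] [NormedAddCommGroup F]
    [NormedSpace ℝ F] {f : ℕ → Ω → E} (hf : SmallInProb μ f) (L : E →L[ℝ] F) :
    SmallInProb μ fun n ω => L (f n ω) := by
  have h1 : SmallInProb μ fun n ω => ‖f n ω‖ := hf.mono (by simp)
  refine (h1.const_mul ‖L‖).mono (Eventually.of_forall fun n => ae_of_all _ fun ω => ?_)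
  rw [norm_mul, norm_norm, norm_norm]
  exact L.le_opNorm _

/-- Covers q = 0: every set is empty or everything, so all probability measures coincide. -/
theorem ProbabilityTheory.tendstoInDistribution_of_subsingleton {Ω Ω' E : Type*}
    [MeasurableSpace Ω] [MeasurableSpace Ω'] {μ : Measure Ω} {μ' : Measure Ω'}
    [IsProbabilityMeasure μ] [IsProbabilityMeasure μ'] [TopologicalSpace E] [MeasurableSpace E]
    [OpensMeasurableSpace E] [Subsingleton E] (X : ℕ → Ω → E) (Z : Ω' → E) :
    TendstoInDistribution X atTop Z (fun _ => μ) μ' where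
  forall_aemeasurable _ := (measurable_of_subsingleton_codomain _).aemeasurable
  aemeasurable_limit := (measurable_of_subsingleton_codomain _).aemeasurable
  tendsto := by
    have h : ∀ P Q : ProbabilityMeasure E, P = Q := fun P Q => by
      ext s hs
      rcases Subsingleton.set_cases (p := fun s => (P : Measure E) s = (Q : Measure E) s)
        (by simp) (by simp) s with h
      exact h
    exact tendsto_const_nhds.congr fun _ => h _ _

theorem measurable_matrix_mul_apply {Ω ι κ ρ : Type*} [MeasurableSpace Ω] [Fintype κ]
    {A : Ω → Matrix ι κ ℝ} {B : Ω → Matrix κ ρ ℝ} (hA : ∀ i k, Measurable fun ω => A ω i k)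
    (hB : ∀ k j, Measurable fun ω => B ω k j) (i : ι) (j : ρ) :
    Measurable fun ω => (A ω * B ω) i j := by
  simp only [Matrix.mul_apply]
  exact Finset.measurable_fun_sum _ fun k _ => (hA i k).mul (hB k j)

theorem aemeasurable_mulVec {Ω ι κ : Type*} [MeasurableSpace Ω] [Countable ι]
    [Fintype κ] {μ : Measure Ω}
    {A : Ω → Matrix ι κ ℝ} {v : Ω → κ → ℝ} (hA : ∀ i k, Measurable fun ω => A ω i k)
    (hv : AEMeasurable v μ) : AEMeasurable (fun ω => A ω *ᵥ v ω) μ :=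
  aemeasurable_pi_lambda _ fun i => Finset.aemeasurable_fun_sum _ fun k _ =>
    (hA i k).aemeasurable.mul ((measurable_pi_apply k).comp_aemeasurable hv)

namespace GVCMM.Model

variable {p q : ℕ} {G : Model p q} {Ω : Type*} {D : Data Ω p q} [MeasurableSpace Ω] {μ : Measure Ω}

theorem measurable_hatC (hS : G.IsSample D μ) (n : ℕ) (k : Fin q × Fin G.knotsM.dim) (j : Fin p) :
    Measurable fun ω => G.hatC D n ω k j := by
  have hX : ∀ i k, Measurable fun ω => G.xM D i ω k := fun i k =>
    (measurable_pi_apply k).comp (G.measurable_regressor.comp (measurable_obs hS i))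
  have hXn : ∀ (i : Fin n) k, Measurable fun ω => G.designM D n ω i k := fun i => hX i
  have hXT : ∀ k (i : Fin n), Measurable fun ω => (G.designM D n ω)ᵀ k i := fun k i => hX i k
  exact measurable_matrix_mul_apply (measurable_matrix_mul_apply
    (measurable_matrix_inv_apply (measurable_matrix_mul_apply hXT hXn)) hXT)
    (fun i j => (measurable_pi_apply j).comp (hS.measurable_m i)) k j

theorem aemeasurable_hatβ (hS : G.IsSample D μ) {est : ℕ → Ω → G.Param} (hmle : G.IsMLE D μ est)
    (n : ℕ) (u : ℝ) : AEMeasurable (fun ω => G.hatβ D est n ω u) μ :=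
  aemeasurable_mulVec
    (measurable_matrix_mul_apply (fun _ _ => measurable_const) (measurable_hatC hS n))
    (aemeasurable_mulVec (fun _ _ => measurable_const)
      (measurable_fst.comp_aemeasurable (hmle.aemeasurable n)))

theorem isSymm_scaledVarβ (hJ : (G.info D μ).PosDef) (hxx : IsUnit (G.gramXX D μ)) (u : ℝ) :
    (G.scaledVarβ D μ u)ᵀ = G.scaledVarβ D μ u := by
  have h : ((G.gramMMGivenX D μ)⁻¹)ᵀ = (G.gramMMGivenX D μ)⁻¹ := by
    rw [← inv_info_submatrix hJ hxx, Matrix.transpose_submatrix, Matrix.transpose_nonsing_inv]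
    congr 2
    simpa using hJ.isHermitian.eq
  simp only [scaledVarβ, Matrix.transpose_add, Matrix.transpose_smul, Matrix.transpose_mul,
    Matrix.transpose_transpose, h, Matrix.transpose_nonsing_inv, transpose_gramXM, Matrix.mul_assoc]

variable [IsProbabilityMeasure μ]

theorem posSemidef_scaledVarβ (hS : G.IsSample D μ) (hr : G.HasExpFamilyResponse D μ)
    (hsp : G.IsSplineModel) (hd : G.CondDensity D μ) (hm : CondMoments D μ)
    (hreg : G.GLMRegular D μ) (hJ : (G.info D μ).PosDef) (hX : IsUnit (G.gramXM D μ))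
    (hxx : IsUnit (G.gramXX D μ)) (u : ℝ) : (G.scaledVarβ D μ u).PosSemidef := by
  refine Matrix.PosSemidef.of_dotProduct_mulVec_nonneg ?_ fun t => ?_
  · simpa [Matrix.IsHermitian] using isSymm_scaledVarβ hJ hxx u
  · rw [star_trivial, ← integral_influence_sq hS hr hsp hd hm hreg hJ hX hxx]
    exact integral_nonneg fun _ => sq_nonneg _

/-- The central limit theorem for the standardized influences. -/
theorem tendstoInDistribution_influence (hS : G.IsSample D μ) (hr : G.HasExpFamilyResponse D μ)
    (hsp : G.IsSplineModel) (hd : G.CondDensity D μ) (hm : CondMoments D μ)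
    (hreg : G.GLMRegular D μ) (hJ : (G.info D μ).PosDef) (hX : IsUnit (G.gramXM D μ))
    (hxx : IsUnit (G.gramXX D μ)) (u : ℝ) {A : Matrix (Fin q) (Fin q) ℝ}
    (hA : A * G.scaledVarβ D μ u * Aᵀ = 1) :
    TendstoInDistribution
      (fun (n : ℕ) ω => (√(n : ℝ))⁻¹ • ∑ i ∈ Finset.range n,
        (WithLp.toLp 2 (A *ᵥ G.influence D μ u i ω) : EuclideanSpace ℝ (Fin q)))
      atTop (id : EuclideanSpace ℝ (Fin q) → EuclideanSpace ℝ (Fin q)) (fun _ => μ)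
      (stdGaussian (EuclideanSpace ℝ (Fin q))) := by
  obtain ⟨g, hg, hinf⟩ := exists_measurable_influence (G := G) (D := D) (μ := μ) u
  have hAg : Measurable fun z => (WithLp.toLp 2 (A *ᵥ g z) : EuclideanSpace ℝ (Fin q)) := by
    refine (WithLp.measurable_toLp 2 _).comp (measurable_pi_lambda _ fun l => ?_)
    simp only [Matrix.mulVec, dotProduct]
    fun_prop
  have hinner : ∀ (t : EuclideanSpace ℝ (Fin q)) ω,
      inner ℝ (WithLp.toLp 2 (A *ᵥ G.influence D μ u 0 ω) : EuclideanSpace ℝ (Fin q)) t =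
        (t.ofLp ᵥ* A) ⬝ᵥ G.influence D μ u 0 ω := by
    intro t ω
    rw [EuclideanSpace.inner_eq_star_dotProduct, star_trivial, Matrix.dotProduct_mulVec]
  simp_rw [hinf] at hinner ⊢
  refine tendstoInDistribution_stdGaussian
    (X := fun i ω => (WithLp.toLp 2 (A *ᵥ g (obs D i ω, D.y i ω)) : EuclideanSpace ℝ (Fin q)))
    (fun i => hAg.comp ((measurable_obs hS i).prodMk (hS.measurable_y i)))
    ((iIndepFun_obs hS).comp _ fun _ => hAg) (fun i => (identDistrib_obs hS i).comp hAg)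
    (fun t => ?_) (fun t => ?_) (fun t => ?_) <;> simp_rw [hinner, ← hinf]
  · exact (memLp_influence hS hr hsp hd hm hreg u _).1
  · exact (memLp_influence hS hr hsp hd hm hreg u _).2
  -- The variance of the projection on t is tᵀ(A V Aᵀ)t with V = `scaledVarβ`, which is ‖t‖² by the
  -- choice of A.
  · rw [integral_influence_sq hS hr hsp hd hm hreg hJ hX hxx, EuclideanSpace.real_norm_sq_eq,
      ← Matrix.dotProduct_mulVec, Matrix.mulVec_mulVec, ← Matrix.mulVec_transpose,
      Matrix.mulVec_mulVec, hA, Matrix.one_mulVec, dotProduct]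
    exact Finset.sum_congr rfl fun _ _ => (pow_two _).symm

end GVCMM.Model

/-- Uniqueness of the nonnegative square root; it extracts the factor 1/n from the variance. -/
theorem Matrix.sqrt_smul {q : ℕ} {S : Matrix (Fin q) (Fin q) ℝ} (hS : S.PosSemidef) {c : ℝ}
    (hc : 0 ≤ c) : CFC.sqrt (c • S) = √c • CFC.sqrt S := by
  refine CFC.sqrt_unique ?_ ?_
  · rw [smul_mul_smul_comm, Real.mul_self_sqrt hc, CFC.sqrt_mul_sqrt_self S hS.nonneg]
  · exact smul_nonneg (Real.sqrt_nonneg c) (CFC.sqrt_nonneg S)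

end

theorem theorem3 {Ω : Type*} [MeasurableSpace Ω] (μ : Measure Ω) [IsProbabilityMeasure μ]
    {p q : ℕ} (G : GVCMM.Model p q) (D : GVCMM.Data Ω p q)
    -- the model
    (sample : G.IsSample D μ) (response : G.HasExpFamilyResponse D μ) (spline : G.IsSplineModel)
    -- distribution of u, smoothness, moments, error covariance
    (density : G.CondDensity D μ) (holder : G.CondHolder) (moments : GVCMM.CondMoments D μ)
    (errCov : GVCMM.EigenvaluesBounded (G.covErr D μ)) (smooth : G.CondSmooth)
    -- regularity of the likelihood, and the two Gram matrices that are inverted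
    (regular : G.GLMRegular D μ) (unit_xM : IsUnit (G.gramXM D μ)) (unit_xx : IsUnit (G.gramXX D μ))
    -- the maximum likelihood estimators of the spline coefficients of `α₀` and `α₁`
    (est : ℕ → Ω → G.Param) (mle : G.IsMLE D μ est)
    -- a point at which the asymptotic variance is nonsingular
    (u : ℝ) (hu : u ∈ Icc G.lo G.hi) (unit_var : IsUnit (G.scaledVarβ D μ u)) :
    TendstoInDistribution
      (fun (n : ℕ) (ω : Ω) => (WithLp.toLp 2
        ((CFC.sqrt (G.varβ D μ n u))⁻¹ *ᵥ (G.hatβ D est n ω u - G.β u)) :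
          EuclideanSpace ℝ (Fin q)))
      atTop (id : EuclideanSpace ℝ (Fin q) → EuclideanSpace ℝ (Fin q))
      (fun _ => μ) (stdGaussian (EuclideanSpace ℝ (Fin q))) := by
  rcases Nat.eq_zero_or_pos q with rfl | hq
  · exact tendstoInDistribution_of_subsingleton _ _
  have : NeZero q := ⟨hq.ne'⟩
  have hJ := GVCMM.Model.posDef_info sample response spline density moments errCov regular unit_xx
  have hpsd := GVCMM.Model.posSemidef_scaledVarβ sample response spline density moments regular hJ
    unit_xM unit_xx u
  set R := CFC.sqrt (G.scaledVarβ D μ u) with hRdef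
  have hRR : R * R = G.scaledVarβ D μ u := CFC.sqrt_mul_sqrt_self _ hpsd.nonneg
  have hRdet : IsUnit R.det := by
    rw [← Matrix.isUnit_iff_isUnit_det]
    exact isUnit_of_mul_isUnit_left (hRR ▸ unit_var)
  have hRT : Rᵀ = R := by
    simpa using (Matrix.nonneg_iff_posSemidef.1 (CFC.sqrt_nonneg (G.scaledVarβ D μ u))).1.eq
  have hstd : R⁻¹ * G.scaledVarβ D μ u * (R⁻¹)ᵀ = 1 := by
    rw [Matrix.transpose_nonsing_inv, hRT, ← hRR, ← Matrix.mul_assoc,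
      Matrix.nonsing_inv_mul _ hRdet, Matrix.one_mul, Matrix.mul_nonsing_inv _ hRdet]
  -- n = 0 is left out because 1 / 0 = 0 makes the variance zero there; the limit does not see it.
  have hsqrt : ∀ n : ℕ, n ≠ 0 → (CFC.sqrt (G.varβ D μ n u))⁻¹ = √(n : ℝ) • R⁻¹ := by
    intro n hn
    have hn' : √(n : ℝ) ≠ 0 := by positivity
    refine Matrix.inv_eq_right_inv ?_
    rw [GVCMM.Model.varβ, Matrix.sqrt_smul hpsd (by positivity), smul_mul_smul_comm,
      Matrix.mul_nonsing_inv _ hRdet, one_div, Real.sqrt_inv, inv_mul_cancel₀ hn', one_smul]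
  -- Slutsky: the standardized estimator differs from the standardized sum of influences by the
  -- image of a small term under the fixed linear map `R⁻¹`.
  refine tendstoInDistribution_of_tendstoInMeasure_sub _ _
    (GVCMM.Model.tendstoInDistribution_influence sample response spline density moments regular hJ
      unit_xM unit_xx u hstd) (SmallInProb.tendstoInMeasure ?_) fun n => ?_
  · refine ((GVCMM.Model.smallInProb_hatβ_sub sample response spline density moments regular hJ
      unit_xM mle hu).continuousLinearMap (((PiLp.continuousLinearEquiv 2 ℝ
        (fun _ : Fin q => ℝ)).symm : (Fin q → ℝ) →L[ℝ] EuclideanSpace ℝ (Fin q)).comp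
          (LinearMap.toContinuousLinearMap (Matrix.toLin' R⁻¹)))).congr ?_
    filter_upwards [eventually_ne_atTop 0] with n hn
    refine ae_of_all _ fun ω => ?_
    simp [hsqrt n hn, Matrix.mulVec_sub, Matrix.mulVec_smul, Matrix.smul_mulVec, Matrix.mulVec_sum,
      smul_sub]
  · refine (WithLp.measurable_toLp 2 _).comp_aemeasurable ?_
    exact aemeasurable_mulVec (fun _ _ => measurable_const)
      ((GVCMM.Model.aemeasurable_hatβ sample mle n u).sub_const (G.β u))
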